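/- Let $\mathbb{D}=\{z\in\mathbb{C}:|z|<1\}$ and let $K\ge 1$. Write $f_z=\tfrac12(f_x-if_y)$, $f_{\bar z}=\tfrac12(f_x+if_y)$, and $J_f=|f_z|^2-|f_{\bar z}|^2$. A harmonic map $f:\mathbb{D}\to\mathbb{C}$ is called $K$-quasiregular if it is absolutely continuous on lines with partial derivatives locally in $L^2$, and $J_f\ge 0$ and $(|f_z|+|f_{\bar z}|)^2\le K J_f$ almost everywhere in $\mathbb{D}$. Let $\mathcal S_H(K)$ be the class of all sense-preserving ($J_f>0$ in $\mathbb{D}$) univalent harmonic $K$-quasiregular maps $f=h+\overline{g}$ of $\mathbb{D}$ into $\mathbb{C}$, where $h$ and $g$ are analytic in $\mathbb{D}$ with $h(0)=g(0)=h'(0)-1=0$, and put $$\gamma^{*}=\gamma^*(K)=\sup_{f\in\mathcal S_H(K)}\frac{|f_{zz}(0)|}{2},\qquad M_p(r,f)=\Big(\frac1{2\pi}\int_0^{2\pi}|f(re^{i\theta})|^p\,d\theta\Big)^{1/p}.$$ **Theorem.** The supremum $\gamma^*$ is finite, and the following hold. 1. For every $f\in\mathcal S_H(K)$ and every $p\in(1/\gamma^*,\infty)$,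 $$M_p(r,f)=O\left(\frac{1}{(1-r)^{\gamma^*-1/p}}\right)\quad\text{as } r\to1^-.$$ 2. There is a constant $C$, depending only on $K$, such that for every $f=h+\overline g\in\mathcal S_H(K)$ with $h(z)=z+\sum_{n=2}^\infty a_nz^n$, $$|a_n|\le C\,n^{\gamma^*-1}\qquad\text{for all } n\in\{2,3,\dots\}.$$ 3. If $K=1$, the exponent $\gamma^*-1$ in part 2 is sharp: there is $f=h+\overline g\in\mathcal S_H(1)$ with $h(z)=z+\sum_{n=2}^\infty a_nz^n$ such that for no $\beta<\gamma^*-1$ is there a constant $C$ with $|a_n|\le C\,n^{\beta}$ for all $n\ge2$. -/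

import Mathlib

open Set Filter Topology MeasureTheory
open scoped ComplexConjugate

noncomputable section

namespace HarmonicQR

/-- The open unit disk. -/
def unitDisk : Set ℂ := Metric.ball (0 : ℂ) 1

/-- The partial derivative `∂f/∂x`, where `z = x + iy`. -/
def partialX (f : ℂ → ℂ) (z : ℂ) : ℂ := lineDeriv ℝ f z 1

/-- The partial derivative `∂f/∂y`, where `z = x + iy`. -/
def partialY (f : ℂ → ℂ) (z : ℂ) : ℂ := lineDeriv ℝ f z Complex.I

/-- The Wirtinger derivative `f_z = (f_x - i f_y) / 2`. -/
def dz (f : ℂ → ℂ) (z : ℂ) : ℂ := (partialX f z - Complex.I * partialY f z) / 2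

/-- The Wirtinger derivative `f_{\bar z} = (f_x + i f_y) / 2`. -/
def dzbar (f : ℂ → ℂ) (z : ℂ) : ℂ := (partialX f z + Complex.I * partialY f z) / 2

/-- The maximal directional derivative `Λ_f = |f_z| + |f_{\bar z}|`. -/
def maxDilation (f : ℂ → ℂ) (z : ℂ) : ℝ := ‖dz f z‖ + ‖dzbar f z‖

/-- The Jacobian `J_f = |f_z|² - |f_{\bar z}|²`. -/
def jacobian (f : ℂ → ℂ) (z : ℂ) : ℝ := ‖dz f z‖ ^ 2 - ‖dzbar f z‖ ^ 2

/-- Absolute continuity on lines: in every closed rectangle contained in `Ω` with sides parallel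
to the axes, `f` is absolutely continuous on almost every horizontal and almost every vertical
line segment. -/
def IsACL (f : ℂ → ℂ) (Ω : Set ℂ) : Prop :=
  ∀ a b c d : ℝ, a ≤ b → c ≤ d → Icc a b ×ℂ Icc c d ⊆ Ω →
    (∀ᵐ y : ℝ, y ∈ Icc c d →
      AbsolutelyContinuousOnInterval (fun x : ℝ => f (⟨x, y⟩ : ℂ)) a b) ∧
    (∀ᵐ x : ℝ, x ∈ Icc a b →
      AbsolutelyContinuousOnInterval (fun y : ℝ => f (⟨x, y⟩ : ℂ)) c d)

/-- `ACL²`: absolutely continuous on lines, with partial derivatives locally in `L²`. -/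
structure IsACL2 (f : ℂ → ℂ) (Ω : Set ℂ) : Prop where
  acl : IsACL f Ω
  memLp_partialX : ∀ S : Set ℂ, IsCompact S → S ⊆ Ω → MemLp (partialX f) 2 (volume.restrict S)
  memLp_partialY : ∀ S : Set ℂ, IsCompact S → S ⊆ Ω → MemLp (partialY f) 2 (volume.restrict S)

/-- `(K, K')`-quasiregular mappings of `Ω` into `ℂ`. -/
structure IsQuasiregular (K K' : ℝ) (f : ℂ → ℂ) (Ω : Set ℂ) : Prop where
  acl2 : IsACL2 f Ω
  jacobian_nonneg : ∀ᵐ z : ℂ, z ∈ Ω → 0 ≤ jacobian f z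
  dilation_le : ∀ᵐ z : ℂ, z ∈ Ω → maxDilation f z ^ 2 ≤ K * jacobian f z + K'

/-- Harmonic `(K, K')`-quasiregular mappings of `Ω` into `ℂ`. -/
structure IsHarmonicQuasiregular (K K' : ℝ) (f : ℂ → ℂ) (Ω : Set ℂ) : Prop where
  harmonic : InnerProductSpace.HarmonicOnNhd f Ω
  quasiregular : IsQuasiregular K K' f Ω

/-- `f = h + \bar g` in the unit disk, where `h` and `g` are analytic there and
`h(0) = g(0) = h'(0) - 1 = 0`. -/
structure IsNormalizedDecomposition (f h g : ℂ → ℂ) : Prop where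
  analytic_h : DifferentiableOn ℂ h unitDisk
  analytic_g : DifferentiableOn ℂ g unitDisk
  eq_add_conj : ∀ z ∈ unitDisk, f z = h z + conj (g z)
  h_zero : h 0 = 0
  g_zero : g 0 = 0
  deriv_h_zero : deriv h 0 = 1

/-- The class `S_H` of normalized sense-preserving univalent harmonic mappings of the unit disk.
Only the values of `f` in the disk matter. -/
def SH : Set (ℂ → ℂ) :=
  {f | (∃ h g : ℂ → ℂ, IsNormalizedDecomposition f h g) ∧
    InjOn f unitDisk ∧ ∀ z ∈ unitDisk, 0 < jacobian f z}

/-- The class `S_H(K, K')`. -/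
def SHKK' (K K' : ℝ) : Set (ℂ → ℂ) :=
  {f | f ∈ SH ∧ IsHarmonicQuasiregular K K' f unitDisk}

/-- The class `S_H(K) = S_H(K, 0)`. -/
def SHK (K : ℝ) : Set (ℂ → ℂ) := SHKK' K 0

/-- The set of the values `|f_{zz}(0)| / 2`, where `f` ranges over `S_H(K)`. -/
def secondCoeffs (K : ℝ) : Set ℝ := (fun f => ‖dz (dz f) 0‖ / 2) '' SHK K

/-- `γ* = sup_{f ∈ S_H(K)} |f_{zz}(0)| / 2`. -/
def gammaStar (K : ℝ) : ℝ := sSup (secondCoeffs K)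

/-- The integral mean
`M_p(r, f) = ((1 / 2π) ∫_0^{2π} |f(r e^{iθ})|^p dθ)^{1/p}`. -/
def integralMean (p : ℝ) (f : ℂ → ℂ) (r : ℝ) : ℝ :=
  ((1 / (2 * Real.pi)) *
    ∫ θ in (0 : ℝ)..(2 * Real.pi), ‖f (r * Complex.exp (θ * Complex.I))‖ ^ p) ^ (1 / p)

/-- `h(z) = z + ∑_{n ≥ 2} a_n z^n` in the unit disk. -/
def HasNormalizedExpansion (h : ℂ → ℂ) (a : ℕ → ℂ) : Prop :=
  ∀ z ∈ unitDisk, HasSum (fun n : ℕ => a (n + 2) * z ^ (n + 2)) (h z - z)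

end HarmonicQR

end

/-!
Write `k = (K - 1) / (K + 1)`. The class `S_H(K)` consists of the injective maps `f = h + \bar g`
of the disk with `h' ≠ 0`, `|g'| ≤ k |h'|` and the stated normalization (`QCPair.of_mem_SHK`,
`QCPair.mem_SHK`), and `f_{zz}(0) = h''(0)`.

**Finiteness of `γ*`** (`exists_bound_deriv_deriv`). If `h''/h'` could be arbitrarily large at the
origin, rescaling at a suitable point would give maps on disks of radius `R → ∞` with `h'(0) = 1`,
`h''(0) = 1` and `|h''/h'| ≤ 2`. By the Schwarz lemma `h''/h'` and `g'/h'` are then nearly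
constant, so that `f` is close to `w + \overline{c w}` with `w = e^z - 1` and `|c| ≤ k < 1`. This
model has period `2πi` and is quantitatively locally invertible, hence `f` takes the value `f(0)`
again near `2πi` and is not injective (`exists_radius_not_injective`).

**Growth.** The class is invariant under Koebe transforms, so the bound `γ*` of the second
coefficient becomes a bound of `h''/h'` in the whole disk; integrating it along radii gives
`|h'| = O((1 - r)^{-γ* - 1})` and `|f| = O((1 - r)^{-γ*})` (`norm_deriv_le`,
`norm_le_of_mem_SHK`).

**Integral means** (`exists_powMean_le`). In the coordinates `z = e^{s + iθ}` Green's formula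
(`powMeanD_sub`) expresses the change of the `s`-derivative of `∫ (|f|² + 1)^{p/2} dθ` by the
integral of a Laplacian, which bounded dilatation compares with `(|f|² + 1)^{p/2 - 1}` times the
Jacobian. As `f` is injective, the change of variables bounds the latter by an integral over a disk
containing the image (`integral_jacobian_le`), that is by a multiple of `max |f|^p`. Thus the
derivative is `O((1 - r)^{-γ* p})`, and one integration gains the exponent `1`. The case `p = 1` and
Cauchy's estimate on the circle of radius `1 - 1/n` bound the coefficients.

**Sharpness for `K = 1`.** Here `g = 0` and the Koebe function has `a_n = n`, so it is enough that
`γ*(1) ≤ 2`, which is Bieberbach's inequality (`norm_deriv_deriv_zero_le_four`). It comes from the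
same two tools applied to `|h|^{-2α}` with `0 < α < 1/2`: its circular means decrease
(`powMeanD_nonpos`). In Parseval's formula for `(h(z)/z)^{-α} = ∑ d_n z^n` the terms with `n ≥ 2`
increase, so the first two decrease, which says `α (1 - α) |a_2|² ≤ 1`; then `α → 1/2`.
-/

namespace HarmonicQR

/-! ### Wirtinger derivatives and the class `S_H(K)` -/

/-- The real-linear map `w ↦ a w + \overline{b w}`: the derivative of `h + \bar g` at a point where
`h' = a` and `g' = b`. -/
noncomputable def wirtingerCLM (a b : ℂ) : ℂ →L[ℝ] ℂ :=
  (ContinuousLinearMap.toSpanSingleton ℂ a).restrictScalars ℝ +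
    (Complex.conjCLE : ℂ →L[ℝ] ℂ).comp ((ContinuousLinearMap.toSpanSingleton ℂ b).restrictScalars ℝ)

@[simp] lemma wirtingerCLM_apply (a b w : ℂ) : wirtingerCLM a b w = w * a + conj (w * b) := by
  simp [wirtingerCLM]

lemma hasFDerivAt_add_conj {h g : ℂ → ℂ} {a b z : ℂ} (hh : HasDerivAt h a z)
    (hg : HasDerivAt g b z) :
    HasFDerivAt (fun z => h z + conj (g z)) (wirtingerCLM a b) z := by
  have h1 := hh.hasFDerivAt.restrictScalars ℝ
  have h2 := (Complex.conjCLE : ℂ →L[ℝ] ℂ).hasFDerivAt.comp z (hg.hasFDerivAt.restrictScalars ℝ)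
  exact h1.add h2

lemma det_wirtingerCLM (a b : ℂ) : (wirtingerCLM a b).det = ‖a‖ ^ 2 - ‖b‖ ^ 2 := by
  rw [ContinuousLinearMap.det, ← LinearMap.det_toMatrix Complex.basisOneI, Matrix.det_fin_two]
  simp [LinearMap.toMatrix_apply, Complex.sq_norm, Complex.normSq_apply]
  ring

lemma norm_wirtingerCLM_le (a b : ℂ) : ‖wirtingerCLM a b‖ ≤ ‖a‖ + ‖b‖ := by
  refine ContinuousLinearMap.opNorm_le_bound _ (by positivity) fun w => ?_
  rw [wirtingerCLM_apply]
  refine (norm_add_le _ _).trans ?_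
  rw [RCLike.norm_conj, norm_mul, norm_mul]
  exact le_of_eq (by ring)

section Partials

variable {f : ℂ → ℂ} {a b z : ℂ}

lemma partialX_eq (hf : HasFDerivAt f (wirtingerCLM a b) z) : partialX f z = a + conj b := by
  rw [partialX, (hf.hasLineDerivAt 1).lineDeriv]; simp

lemma partialY_eq (hf : HasFDerivAt f (wirtingerCLM a b) z) :
    partialY f z = Complex.I * (a - conj b) := by
  rw [partialY, (hf.hasLineDerivAt Complex.I).lineDeriv]; simp; ring

lemma dz_eq (hf : HasFDerivAt f (wirtingerCLM a b) z) : dz f z = a := by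
  rw [dz, partialX_eq hf, partialY_eq hf, ← mul_assoc, Complex.I_mul_I]; ring

lemma dzbar_eq (hf : HasFDerivAt f (wirtingerCLM a b) z) : dzbar f z = conj b := by
  rw [dzbar, partialX_eq hf, partialY_eq hf, ← mul_assoc, Complex.I_mul_I]; ring

end Partials

/-- `h` and `g` are analytic in `U`, `h` is locally univalent, the dilatation `g' / h'` is bounded
by `k`, and `h + \bar g` is injective. For `k = (K - 1) / (K + 1)` and `U` the unit disk these are,
up to normalization, the maps of `S_H(K)`. -/
structure QCPair (k : ℝ) (h g : ℂ → ℂ) (U : Set ℂ) : Prop where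
  diff_h : DifferentiableOn ℂ h U
  diff_g : DifferentiableOn ℂ g U
  deriv_ne : ∀ z ∈ U, deriv h z ≠ 0
  deriv_le : ∀ z ∈ U, ‖deriv g z‖ ≤ k * ‖deriv h z‖
  inj : InjOn (fun z => h z + conj (g z)) U

/-- The bound `k = (K - 1) / (K + 1)` of the dilatation of a `K`-quasiregular map. -/
noncomputable def dilBound (K : ℝ) : ℝ := (K - 1) / (K + 1)

lemma dilBound_nonneg {K : ℝ} (hK : 1 ≤ K) : 0 ≤ dilBound K :=
  div_nonneg (by linarith) (by linarith)

lemma dilBound_lt_one {K : ℝ} (hK : 1 ≤ K) : dilBound K < 1 := by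
  rw [dilBound, div_lt_one (by linarith)]; linarith

lemma isOpen_unitDisk : IsOpen unitDisk := Metric.isOpen_ball

lemma mem_unitDisk {z : ℂ} : z ∈ unitDisk ↔ ‖z‖ < 1 := by simp [unitDisk]

lemma zero_mem_unitDisk : (0 : ℂ) ∈ unitDisk := by simp [mem_unitDisk]

namespace IsNormalizedDecomposition

variable {f h g : ℂ → ℂ} (hd : IsNormalizedDecomposition f h g)
include hd

lemma hasFDerivAt {z : ℂ} (hz : z ∈ unitDisk) :
    HasFDerivAt f (wirtingerCLM (deriv h z) (deriv g z)) z := by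
  have hn := isOpen_unitDisk.mem_nhds hz
  have h1 := (hd.analytic_h.differentiableAt hn).hasDerivAt
  have h2 := (hd.analytic_g.differentiableAt hn).hasDerivAt
  refine (hasFDerivAt_add_conj h1 h2).congr_of_eventuallyEq ?_
  filter_upwards [hn] with w hw using hd.eq_add_conj w hw

lemma dz_eq_deriv {z : ℂ} (hz : z ∈ unitDisk) : dz f z = deriv h z := dz_eq (hd.hasFDerivAt hz)

lemma dzbar_eq_conj_deriv {z : ℂ} (hz : z ∈ unitDisk) : dzbar f z = conj (deriv g z) :=
  dzbar_eq (hd.hasFDerivAt hz)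

lemma jacobian_eq {z : ℂ} (hz : z ∈ unitDisk) :
    jacobian f z = ‖deriv h z‖ ^ 2 - ‖deriv g z‖ ^ 2 := by
  rw [jacobian, hd.dz_eq_deriv hz, hd.dzbar_eq_conj_deriv hz, RCLike.norm_conj]

lemma maxDilation_eq {z : ℂ} (hz : z ∈ unitDisk) :
    maxDilation f z = ‖deriv h z‖ + ‖deriv g z‖ := by
  rw [maxDilation, hd.dz_eq_deriv hz, hd.dzbar_eq_conj_deriv hz, RCLike.norm_conj]

lemma dz_dz_zero : dz (dz f) 0 = deriv (deriv h) 0 := by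
  have hn := isOpen_unitDisk.mem_nhds zero_mem_unitDisk
  have h1 := ((hd.analytic_h.deriv isOpen_unitDisk).differentiableAt hn).hasDerivAt
  have h2 : HasFDerivAt (dz f) (wirtingerCLM (deriv (deriv h) 0) 0) 0 := by
    refine (hasFDerivAt_add_conj h1 (hasDerivAt_const (0 : ℂ) (0 : ℂ))).congr_of_eventuallyEq ?_
    filter_upwards [hn] with w hw
    simp [hd.dz_eq_deriv hw]
  exact dz_eq h2

end IsNormalizedDecomposition

lemma continuousOn_deriv_of_differentiableOn {h : ℂ → ℂ} {U : Set ℂ} (hU : IsOpen U)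
    (hh : DifferentiableOn ℂ h U) : ContinuousOn (deriv h) U :=
  (hh.deriv hU).continuousOn

/-- The two quasiregularity inequalities `x² - y² ≥ 0` and `(x + y)² ≤ K (x² - y²)` say that
`y ≤ k x`. -/
lemma dilatation_iff {K x y : ℝ} (hK : 1 ≤ K) (hx : 0 < x) (hy : 0 ≤ y) :
    (0 ≤ x ^ 2 - y ^ 2 ∧ (x + y) ^ 2 ≤ K * (x ^ 2 - y ^ 2)) ↔ y ≤ dilBound K * x := by
  have hK1 : 0 < K + 1 := by linarith
  have key : y ≤ dilBound K * x ↔ x + y ≤ K * (x - y) := by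
    rw [dilBound, div_mul_eq_mul_div, le_div_iff₀ hK1]
    constructor <;> intro h <;> linarith
  rw [key]
  constructor
  · rintro ⟨-, h⟩
    have : (x + y) * (x + y) ≤ (x + y) * (K * (x - y)) := by linarith [h, sq (x + y)]
    exact le_of_mul_le_mul_left this (by linarith)
  · intro h
    have hxy : 0 ≤ x - y := by
      by_contra hc
      push Not at hc
      nlinarith
    constructor
    · nlinarith
    · nlinarith [mul_le_mul_of_nonneg_left h (by linarith : 0 ≤ x + y)]

/-- An inequality between continuous functions which holds almost everywhere in an open set holds
everywhere in it. -/
lemma le_of_ae_le {U : Set ℂ} (hU : IsOpen U) {u v : ℂ → ℝ} (hu : ContinuousOn u U)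
    (hv : ContinuousOn v U) (h : ∀ᵐ z : ℂ, z ∈ U → u z ≤ v z) {z : ℂ} (hz : z ∈ U) :
    u z ≤ v z := by
  by_contra hc
  push Not at hc
  have hopen : IsOpen {w ∈ U | v w < u w} := by
    have := (hu.sub hv).isOpen_inter_preimage hU (isOpen_Ioi (a := (0 : ℝ)))
    convert this using 1
    ext w; simp
  have hnull : volume {w ∈ U | v w < u w} = 0 := by
    refine measure_mono_null ?_ h
    intro w hw hcon
    exact absurd (hcon hw.1) (not_le.2 hw.2)
  exact (hopen.measure_pos volume ⟨z, hz, hc⟩).ne' hnull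

lemma QCPair.of_mem_SHK {K : ℝ} (hK : 1 ≤ K) {f h g : ℂ → ℂ} (hf : f ∈ SHK K)
    (hd : IsNormalizedDecomposition f h g) : QCPair (dilBound K) h g unitDisk := by
  obtain ⟨⟨-, hinj, hjac⟩, hqr⟩ := hf
  have hch := continuousOn_deriv_of_differentiableOn isOpen_unitDisk hd.analytic_h
  have hcg := continuousOn_deriv_of_differentiableOn isOpen_unitDisk hd.analytic_g
  have hne : ∀ z ∈ unitDisk, deriv h z ≠ 0 := by
    intro z hz h0
    have := hjac z hz
    rw [hd.jacobian_eq hz, h0, norm_zero] at this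
    nlinarith [sq_nonneg ‖deriv g z‖]
  refine ⟨hd.analytic_h, hd.analytic_g, hne, fun z hz => ?_, ?_⟩
  · refine le_of_ae_le isOpen_unitDisk (u := fun z => ‖deriv g z‖)
      (v := fun z => dilBound K * ‖deriv h z‖) hcg.norm (continuousOn_const.mul hch.norm) ?_ hz
    filter_upwards [hqr.quasiregular.jacobian_nonneg, hqr.quasiregular.dilation_le]
      with w h1 h2 hw
    have h1 := h1 hw
    have h2 := h2 hw
    rw [hd.jacobian_eq hw] at h1 h2
    rw [hd.maxDilation_eq hw, add_zero] at h2
    exact (dilatation_iff hK (norm_pos_iff.2 (hne w hw)) (norm_nonneg _)).1 ⟨h1, h2⟩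
  · exact hinj.congr fun z hz => hd.eq_add_conj z hz

lemma isACL2_of_decomposition {f h g : ℂ → ℂ} (hd : IsNormalizedDecomposition f h g) :
    IsACL2 f unitDisk := by
  have hch := continuousOn_deriv_of_differentiableOn isOpen_unitDisk hd.analytic_h
  have hcg := continuousOn_deriv_of_differentiableOn isOpen_unitDisk hd.analytic_g
  have hmem : ∀ (v : ℂ → ℂ), ContinuousOn v unitDisk → ∀ S : Set ℂ, IsCompact S → S ⊆ unitDisk →
      MemLp v 2 (volume.restrict S) := by
    intro v hv S hS hSU
    obtain ⟨C, hC⟩ := hS.exists_bound_of_continuousOn (hv.mono hSU)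
    have : IsFiniteMeasure (volume.restrict S) := ⟨by simpa using hS.measure_lt_top⟩
    refine MemLp.of_bound ((hv.mono hSU).aestronglyMeasurable hS.measurableSet) C ?_
    exact (ae_restrict_iff' hS.measurableSet).2 (Eventually.of_forall fun z hz => hC z hz)
  have hline : ∀ (ι : ℝ → ℂ) (d : ℂ), (∀ x, HasDerivAt ι d x) → ∀ a b : ℝ, a ≤ b →
      MapsTo ι (Icc a b) unitDisk → AbsolutelyContinuousOnInterval (fun x => f (ι x)) a b := by
    intro ι d hι a b hab hmaps
    have hιc : Continuous ι := continuous_iff_continuousAt.2 fun x => (hι x).continuousAt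
    have hc : ContinuousOn (fun x => ‖deriv h (ι x)‖ + ‖deriv g (ι x)‖) (Icc a b) :=
      ((hch.comp hιc.continuousOn hmaps).norm).add ((hcg.comp hιc.continuousOn hmaps).norm)
    obtain ⟨C, hC⟩ := isCompact_Icc.exists_bound_of_continuousOn hc
    have hC0 : 0 ≤ C := (norm_nonneg _).trans (hC a ⟨le_rfl, hab⟩)
    have : LipschitzOnWith (C * ‖d‖).toNNReal (fun x => f (ι x)) (uIcc a b) := by
      rw [uIcc_of_le hab]
      refine (convex_Icc a b).lipschitzOnWith_of_nnnorm_hasDerivWithin_le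
        (f' := fun x => wirtingerCLM (deriv h (ι x)) (deriv g (ι x)) d) (fun x hx => ?_)
        (fun x hx => ?_)
      · exact ((hd.hasFDerivAt (hmaps hx)).comp_hasDerivAt x (hι x)).hasDerivWithinAt
      · rw [← NNReal.coe_le_coe, coe_nnnorm, Real.coe_toNNReal _ (by positivity)]
        refine (ContinuousLinearMap.le_opNorm _ _).trans ?_
        gcongr
        refine (norm_wirtingerCLM_le _ _).trans ((le_abs_self _).trans (hC x hx))
    exact this.absolutelyContinuousOnInterval
  refine ⟨fun a b c d hab hcd hsub => ⟨Eventually.of_forall fun y hy => ?_,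
    Eventually.of_forall fun x hx => ?_⟩, ?_, ?_⟩
  · refine hline (fun x : ℝ => (⟨x, y⟩ : ℂ)) 1 (fun x => ?_) a b hab
      (fun x hx => hsub (by simpa [Complex.mem_reProdIm] using ⟨hx, hy⟩))
    have : (fun x : ℝ => (⟨x, y⟩ : ℂ)) = fun x : ℝ => (x : ℂ) + y * Complex.I := by
      funext x; simp [Complex.ext_iff]
    rw [this]
    exact (Complex.ofRealCLM.hasDerivAt (x := x)).add_const _
  · refine hline (fun y : ℝ => (⟨x, y⟩ : ℂ)) Complex.I (fun y => ?_) c d hcd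
      (fun y hy => hsub (by simpa [Complex.mem_reProdIm] using ⟨hx, hy⟩))
    have : (fun y : ℝ => (⟨x, y⟩ : ℂ)) = fun y : ℝ => (x : ℂ) + y * Complex.I := by
      funext x; simp [Complex.ext_iff]
    rw [this]
    simpa using ((Complex.ofRealCLM.hasDerivAt (x := y)).mul_const Complex.I).const_add (x : ℂ)
  · intro S hS hSU
    refine hmem _ (ContinuousOn.congr (hch.add (Complex.continuous_conj.comp_continuousOn hcg))
      fun z hz => partialX_eq (hd.hasFDerivAt hz)) S hS hSU
  · intro S hS hSU
    refine hmem _ (ContinuousOn.congr (continuousOn_const.mul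
      (hch.sub (Complex.continuous_conj.comp_continuousOn hcg)))
      fun z hz => partialY_eq (hd.hasFDerivAt hz)) S hS hSU

lemma QCPair.mem_SHK {K : ℝ} (hK : 1 ≤ K) {f h g : ℂ → ℂ}
    (hd : IsNormalizedDecomposition f h g) (hq : QCPair (dilBound K) h g unitDisk) :
    f ∈ SHK K := by
  have hpos : ∀ z ∈ unitDisk, 0 < ‖deriv h z‖ := fun z hz => norm_pos_iff.2 (hq.deriv_ne z hz)
  have hiff := fun z (hz : z ∈ unitDisk) =>
    (dilatation_iff hK (hpos z hz) (norm_nonneg (deriv g z))).2 (hq.deriv_le z hz)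
  refine ⟨⟨⟨h, g, hd⟩, hq.inj.congr fun z hz => (hd.eq_add_conj z hz).symm, fun z hz => ?_⟩, ?_,
    isACL2_of_decomposition hd, Eventually.of_forall fun z hz => ?_,
    Eventually.of_forall fun z hz => ?_⟩
  · rw [hd.jacobian_eq hz]
    have h1 := hq.deriv_le z hz
    have h2 : ‖deriv g z‖ < ‖deriv h z‖ :=
      h1.trans_lt (by nlinarith [hpos z hz, dilBound_lt_one hK])
    nlinarith [norm_nonneg (deriv g z)]
  · intro z hz
    have hn := isOpen_unitDisk.mem_nhds hz
    have h1 := (hd.analytic_h.analyticAt hn).harmonicAt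
    have h2 := (hd.analytic_g.analyticAt hn).harmonicAt_conj
    refine (InnerProductSpace.harmonicAt_congr_nhds ?_).2 (h1.add h2)
    filter_upwards [hn] with w hw
    simpa using hd.eq_add_conj w hw
  · rw [hd.jacobian_eq hz]; exact (hiff z hz).1
  · rw [hd.jacobian_eq hz, hd.maxDilation_eq hz, add_zero]; exact (hiff z hz).2

/-! ### Finiteness of the supremum -/

lemma norm_add_conj_sub_le {h g h' g' : ℂ → ℂ} {s : Set ℂ} (hs : Convex ℝ s) {C : ℝ}
    (hh : ∀ z ∈ s, HasDerivAt h (h' z) z) (hg : ∀ z ∈ s, HasDerivAt g (g' z) z)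
    (hC : ∀ z ∈ s, ‖h' z‖ + ‖g' z‖ ≤ C) {x y : ℂ} (hx : x ∈ s) (hy : y ∈ s) :
    ‖(h y + conj (g y)) - (h x + conj (g x))‖ ≤ C * ‖y - x‖ :=
  hs.norm_image_sub_le_of_norm_hasFDerivWithin_le
    (f := fun z => h z + conj (g z)) (f' := fun z => wirtingerCLM (h' z) (g' z))
    (fun z hz => (hasFDerivAt_add_conj (hh z hz) (hg z hz)).hasFDerivWithinAt)
    (fun z hz => (norm_wirtingerCLM_le _ _).trans (hC z hz)) hx hy

/-- The inverse of `w ↦ w + \overline{b w}` when `|b| ≤ k < 1`. -/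
noncomputable def wirtingerRightInverse {k : ℝ} (hk : k < 1) {b : ℂ} (hb : ‖b‖ ≤ k) :
    (wirtingerCLM 1 b).NonlinearRightInverse where
  toFun w := (w - conj b * conj w) / (1 - ‖b‖ ^ 2 : ℝ)
  nnnorm := (Real.toNNReal (1 - k))⁻¹
  bound' w := by
    have hb1 : 0 < 1 - ‖b‖ := by linarith
    have hD : (1 - ‖b‖ ^ 2 : ℝ) = (1 - ‖b‖) * (1 + ‖b‖) := by ring
    have hDpos : 0 < 1 - ‖b‖ ^ 2 := by rw [hD]; positivity
    rw [norm_div, Complex.norm_real, Real.norm_of_nonneg hDpos.le, NNReal.coe_inv,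
      Real.coe_toNNReal _ (by linarith), div_le_iff₀ hDpos]
    have h1 : ‖w - conj b * conj w‖ ≤ ‖w‖ + ‖b‖ * ‖w‖ := by
      refine (norm_sub_le _ _).trans ?_
      rw [norm_mul, RCLike.norm_conj, RCLike.norm_conj]
    refine h1.trans ?_
    rw [hD]
    have h2 : 1 ≤ (1 - k)⁻¹ * (1 - ‖b‖) := by
      rw [inv_mul_eq_div, one_le_div (by linarith)]; linarith
    calc ‖w‖ + ‖b‖ * ‖w‖ = 1 * (‖w‖ * (1 + ‖b‖)) := by ring
      _ ≤ ((1 - k)⁻¹ * (1 - ‖b‖)) * (‖w‖ * (1 + ‖b‖)) := by gcongr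
      _ = _ := by ring
  right_inv' w := by
    have hDpos : 0 < 1 - ‖b‖ ^ 2 := by nlinarith [norm_nonneg b]
    have hDne : ((1 - ‖b‖ ^ 2 : ℝ) : ℂ) ≠ 0 := by exact_mod_cast hDpos.ne'
    have hbb : conj b * b = ((‖b‖ ^ 2 : ℝ) : ℂ) := by
      rw [Complex.conj_mul']; push_cast; rfl
    rw [wirtingerCLM_apply]
    simp only [map_div₀, map_mul, map_sub, Complex.conj_conj, Complex.conj_ofReal, mul_one]
    field_simp
    push_cast at hbb ⊢
    linear_combination (-w) * hbb

/-- If `|q'| ≤ ε |q|` in the disk of radius `8` and `q(0) = 1`, then `q` is close to `1` there. -/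
lemma norm_sub_one_le_of_norm_deriv_le {q q' : ℂ → ℂ} {ε : ℝ} (hε : ε ≤ 1 / 16)
    (hε0 : 0 ≤ ε) (hq : ∀ z ∈ Metric.closedBall (0 : ℂ) 8, HasDerivAt q (q' z) z)
    (hb : ∀ z ∈ Metric.closedBall (0 : ℂ) 8, ‖q' z‖ ≤ ε * ‖q z‖) (h1 : q 0 = 1) :
    ∀ z ∈ Metric.closedBall (0 : ℂ) 8, ‖q z - 1‖ ≤ 16 * ε := by
  have h0 : (0 : ℂ) ∈ Metric.closedBall (0 : ℂ) 8 := by simp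
  obtain ⟨z0, hz0, hmax⟩ := (isCompact_closedBall (0 : ℂ) 8).exists_isMaxOn ⟨0, h0⟩
    (f := fun z => ‖q z‖) (fun z hz => (hq z hz).continuousAt.continuousWithinAt.norm)
  have hle : ∀ z ∈ Metric.closedBall (0 : ℂ) 8, ‖q z - 1‖ ≤ (ε * ‖q z0‖) * 8 := by
    intro z hz
    have := (convex_closedBall (0 : ℂ) 8).norm_image_sub_le_of_norm_hasDerivWithin_le
      (fun z hz => (hq z hz).hasDerivWithinAt)
      (fun z hz => (hb z hz).trans (mul_le_mul_of_nonneg_left (hmax hz) hε0)) h0 hz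
    rw [h1, sub_zero] at this
    refine this.trans ?_
    have : ‖z‖ ≤ 8 := by simpa using hz
    gcongr
  have hM : ‖q z0‖ ≤ 2 := by
    have h2 := hle z0 hz0
    have h3 : ‖q z0‖ ≤ ‖q z0 - 1‖ + 1 := by
      simpa using norm_add_le (q z0 - 1) 1
    nlinarith [norm_nonneg (q z0)]
  intro z hz
  refine (hle z hz).trans ?_
  nlinarith

/-- A harmonic map with bounded dilatation whose pre-Schwarzian `h'' / h'` is bounded by `2` in a
large disk and equals `1` at the centre is close to `w + \overline{c w}` with `w = e^z - 1`, and
hence takes its value at `0` again near `2πi`. -/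
lemma exists_radius_not_injective {k : ℝ} (hk0 : 0 ≤ k) (hk : k < 1) :
    ∃ R₀ : ℝ, 0 < R₀ ∧ ∀ (R : ℝ) (h g : ℂ → ℂ), R₀ ≤ R → QCPair k h g (Metric.ball 0 R) →
      deriv h 0 = 1 → deriv (deriv h) 0 = 1 →
      ¬ ∀ z ∈ Metric.ball (0 : ℂ) R, ‖deriv (deriv h) z‖ ≤ 2 * ‖deriv h z‖ := by
  -- `η` is the radius around `2πi` on which the model is nearly linear, `δ` bounds the distance
  -- from the derivative of `f` to that of the model in the disk of radius `8 > 2π + η`, and `ε`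
  -- bounds the oscillation of `h''/h'` and `g'/h'` there, which the Schwarz lemma makes `≤ 32 / R`.
  set η : ℝ := (1 - k) / 32 with hη
  have hη0 : 0 < η := by rw [hη]; linarith
  have hη1 : η ≤ 1 / 32 := by rw [hη]; linarith
  set δ : ℝ := (1 - k) * η / 16 with hδ
  have hδ0 : 0 < δ := by rw [hδ]; have : 0 < 1 - k := by linarith
                         positivity
  set E : ℝ := Real.exp 8 with hE
  have hE1 : 1 ≤ E := Real.one_le_exp (by norm_num)
  set ε : ℝ := δ / (34 * E) with hε
  have hε0 : 0 < ε := by positivity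
  have hεE : 34 * E * ε = δ := by rw [hε]; field_simp
  have hδ1 : δ ≤ 1 / 16 := by rw [hδ]; nlinarith
  have hε1 : ε ≤ 1 / 16 := by
    have : ε * 1 ≤ ε * (34 * E) := by gcongr; linarith
    linarith
  refine ⟨32 / ε, by positivity, ?_⟩
  intro R h g hR hq hh0 hh1 hP
  have hRpos : 0 < R := lt_of_lt_of_le (by positivity) hR
  have hRε : 32 / R ≤ ε := by
    rw [div_le_iff₀ hRpos]; rw [div_le_iff₀ hε0] at hR; linarith
  have hR8 : 8 < R := by
    have : 32 / R ≤ 1 / 16 := hRε.trans hε1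
    rw [div_le_iff₀ hRpos] at this; linarith
  have hsub : Metric.closedBall (0 : ℂ) 8 ⊆ Metric.ball 0 R :=
    Metric.closedBall_subset_ball hR8
  have hop : IsOpen (Metric.ball (0 : ℂ) R) := Metric.isOpen_ball
  have h0R : (0 : ℂ) ∈ Metric.ball (0 : ℂ) R := by simpa using hRpos
  have dh : ∀ z ∈ Metric.ball (0 : ℂ) R, HasDerivAt h (deriv h z) z := fun z hz =>
    (hq.diff_h.differentiableAt (hop.mem_nhds hz)).hasDerivAt
  have dg : ∀ z ∈ Metric.ball (0 : ℂ) R, HasDerivAt g (deriv g z) z := fun z hz =>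
    (hq.diff_g.differentiableAt (hop.mem_nhds hz)).hasDerivAt
  have dh' : ∀ z ∈ Metric.ball (0 : ℂ) R, HasDerivAt (deriv h) (deriv (deriv h) z) z :=
    fun z hz => ((hq.diff_h.deriv hop).differentiableAt (hop.mem_nhds hz)).hasDerivAt
  -- The Schwarz lemma keeps the pre-Schwarzian and the dilatation almost constant.
  have hpre : ∀ z ∈ Metric.closedBall (0 : ℂ) 8,
      ‖deriv (deriv h) z / deriv h z - 1‖ ≤ ε := by
    intro z hz
    have hz8 : ‖z‖ ≤ 8 := by simpa using hz
    have hd : DifferentiableOn ℂ (fun z => deriv (deriv h) z / deriv h z) (Metric.ball 0 R) :=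
      ((hq.diff_h.deriv hop).deriv hop).div (hq.diff_h.deriv hop) hq.deriv_ne
    have hm : MapsTo (fun z => deriv (deriv h) z / deriv h z) (Metric.ball 0 R)
        (Metric.ball (deriv (deriv h) 0 / deriv h 0) 4) := by
      intro w hw
      rw [hh0, hh1, div_one, Metric.mem_ball, dist_eq_norm]
      have h2 : ‖deriv (deriv h) w / deriv h w‖ ≤ 2 := by
        rw [norm_div, div_le_iff₀ (norm_pos_iff.2 (hq.deriv_ne w hw))]; exact hP w hw
      calc _ ≤ ‖deriv (deriv h) w / deriv h w‖ + ‖(1 : ℂ)‖ := norm_sub_le _ _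
        _ < 4 := by rw [norm_one]; linarith
    have := Complex.dist_le_div_mul_dist_of_mapsTo_ball hd
      (hm.mono_right Metric.ball_subset_closedBall) (hsub hz)
    simp only [hh0, hh1, div_one, dist_eq_norm, sub_zero] at this
    refine this.trans (le_trans ?_ hRε)
    rw [div_mul_eq_mul_div]; gcongr; linarith
  set ω₀ : ℂ := deriv g 0 with hω₀
  have hω₀k : ‖ω₀‖ ≤ k := by simpa [hh0] using hq.deriv_le 0 h0R
  have hdil : ∀ z ∈ Metric.closedBall (0 : ℂ) 8,
      ‖deriv g z / deriv h z - ω₀‖ ≤ ε := by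
    intro z hz
    have hz8 : ‖z‖ ≤ 8 := by simpa using hz
    have hd : DifferentiableOn ℂ (fun z => deriv g z / deriv h z) (Metric.ball 0 R) :=
      (hq.diff_g.deriv hop).div (hq.diff_h.deriv hop) hq.deriv_ne
    have hm : MapsTo (fun z => deriv g z / deriv h z) (Metric.ball 0 R)
        (Metric.ball (deriv g 0 / deriv h 0) 4) := by
      intro w hw
      rw [hh0, div_one, Metric.mem_ball, dist_eq_norm]
      have h2 : ‖deriv g w / deriv h w‖ ≤ k := by
        rw [norm_div, div_le_iff₀ (norm_pos_iff.2 (hq.deriv_ne w hw))]; exact hq.deriv_le w hw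
      calc _ ≤ ‖deriv g w / deriv h w‖ + ‖deriv g 0‖ := norm_sub_le _ _
        _ < 4 := by linarith
    have := Complex.dist_le_div_mul_dist_of_mapsTo_ball hd
      (hm.mono_right Metric.ball_subset_closedBall) (hsub hz)
    simp only [hh0, div_one, dist_eq_norm, sub_zero] at this
    refine this.trans (le_trans ?_ hRε)
    rw [div_mul_eq_mul_div]; gcongr; linarith
  have hQ : ∀ z ∈ Metric.closedBall (0 : ℂ) 8, ‖deriv h z * Complex.exp (-z) - 1‖ ≤ 16 * ε := by
    refine norm_sub_one_le_of_norm_deriv_le (q := fun z => deriv h z * Complex.exp (-z))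
      (q' := fun z => deriv (deriv h) z * Complex.exp (-z) +
        deriv h z * (Complex.exp (-z) * (-1))) hε1 hε0.le (fun z hz => ?_) (fun z hz => ?_) ?_
    · exact (dh' z (hsub hz)).mul ((Complex.hasDerivAt_exp _).comp z (hasDerivAt_neg z))
    · have hne := hq.deriv_ne z (hsub hz)
      have : deriv (deriv h) z * Complex.exp (-z) + deriv h z * (Complex.exp (-z) * (-1))
          = (deriv (deriv h) z / deriv h z - 1) * (deriv h z * Complex.exp (-z)) := by
        field_simp; ring
      rw [this, norm_mul]
      gcongr
      exact hpre z hz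
    · simp [hh0]
  have hexp : ∀ z ∈ Metric.closedBall (0 : ℂ) 8, ‖Complex.exp z‖ ≤ E := by
    intro z hz
    rw [Complex.norm_exp, hE]
    have : ‖z‖ ≤ 8 := by simpa using hz
    exact Real.exp_le_exp.2 ((Complex.re_le_norm z).trans this)
  have hherr : ∀ z ∈ Metric.closedBall (0 : ℂ) 8, ‖deriv h z - Complex.exp z‖ ≤ 16 * ε * E := by
    intro z hz
    have : deriv h z - Complex.exp z = (deriv h z * Complex.exp (-z) - 1) * Complex.exp z := by
      rw [sub_mul, mul_assoc, ← Complex.exp_add]; simp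
    rw [this, norm_mul]
    gcongr
    · exact hQ z hz
    · exact hexp z hz
  have herr : ∀ z ∈ Metric.closedBall (0 : ℂ) 8,
      ‖deriv h z - Complex.exp z‖ + ‖deriv g z - ω₀ * Complex.exp z‖ ≤ δ := by
    intro z hz
    have hne := hq.deriv_ne z (hsub hz)
    have h1 := hherr z hz
    have h2 : ‖deriv h z‖ ≤ 2 * E := by
      have h3 := norm_add_le (deriv h z - Complex.exp z) (Complex.exp z)
      rw [sub_add_cancel] at h3
      have := hexp z hz
      nlinarith
    have h4 : deriv g z - ω₀ * Complex.exp z = (deriv g z / deriv h z - ω₀) * deriv h z +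
        ω₀ * (deriv h z - Complex.exp z) := by
      field_simp; ring
    have h5 : ‖deriv g z - ω₀ * Complex.exp z‖ ≤ ε * (2 * E) + 1 * (16 * ε * E) := by
      rw [h4]
      refine (norm_add_le _ _).trans ?_
      rw [norm_mul, norm_mul]
      gcongr
      · exact hdil z hz
      · linarith
    rw [← hεE]
    linarith
  set T : ℂ := 2 * Real.pi * Complex.I with hT
  have hTn : ‖T‖ = 2 * Real.pi := by
    rw [hT]; simp [abs_of_pos Real.pi_pos]
  have hpi := Real.pi_lt_d2
  have hpi3 := Real.pi_gt_three
  have hballT : Metric.closedBall T η ⊆ Metric.closedBall (0 : ℂ) 8 := by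
    refine Metric.closedBall_subset_closedBall' ?_
    rw [dist_zero_right, hTn]; linarith
  set f : ℂ → ℂ := fun z => h z + conj (g z) with hf
  -- `f` and its model agree up to `7 δ` at the period `2πi`.
  have hfT : ‖f T - f 0‖ ≤ 7 * δ := by
    have hTm : T ∈ Metric.closedBall (0 : ℂ) 8 := hballT (Metric.mem_closedBall_self hη0.le)
    have := norm_add_conj_sub_le (convex_closedBall (0 : ℂ) 8)
      (h := fun z => h z - Complex.exp z) (g := fun z => g z - ω₀ * Complex.exp z)
      (fun z hz => (dh z (hsub hz)).sub (Complex.hasDerivAt_exp z))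
      (fun z hz => (dg z (hsub hz)).sub ((Complex.hasDerivAt_exp z).const_mul ω₀)) herr
      (x := 0) (by simp) hTm
    have hexpT : Complex.exp T = 1 := by rw [hT]; exact Complex.exp_two_pi_mul_I
    rw [hexpT, Complex.exp_zero, sub_zero, hTn] at this
    have heq : (h T - 1 + conj (g T - ω₀ * 1)) - (h 0 - 1 + conj (g 0 - ω₀ * 1)) = f T - f 0 := by
      simp only [hf, map_sub]; ring
    rw [heq] at this
    nlinarith
  have happ : ApproximatesLinearOn f (wirtingerCLM 1 ω₀) (Metric.closedBall T η)
      (Real.toNNReal ((1 - k) / 4)) := by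
    intro x hx y hy
    rw [Real.coe_toNNReal _ (by linarith)]
    have := norm_add_conj_sub_le (convex_closedBall T η) (C := (1 - k) / 4)
      (h := fun z => h z - z) (g := fun z => g z - ω₀ * z)
      (fun z hz => (dh z (hsub (hballT hz))).sub (hasDerivAt_id z))
      (fun z hz => (dg z (hsub (hballT hz))).sub ((hasDerivAt_id z).const_mul ω₀))
      (fun z hz => ?_) hy hx
    · refine le_of_eq_of_le ?_ this
      congr 1
      rw [wirtingerCLM_apply]
      simp only [hf, map_sub, map_mul]; ring
    · have h1 := herr z (hballT hz)
      have h2 : ‖Complex.exp z - 1‖ ≤ 2 * η := by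
        have hzT : ‖z - T‖ ≤ η := by simpa [dist_eq_norm] using hz
        have h3 := Complex.norm_exp_sub_one_le (x := z - T) (by linarith)
        have h4 : Complex.exp (z - T) = Complex.exp z := by
          rw [Complex.exp_sub, hT, Complex.exp_two_pi_mul_I, div_one]
        rw [h4] at h3
        linarith
      have h3 : ‖deriv h z - 1‖ ≤ ‖deriv h z - Complex.exp z‖ + 2 * η := by
        have := norm_add_le (deriv h z - Complex.exp z) (Complex.exp z - 1)
        rw [sub_add_sub_cancel] at this; linarith
      have h4 : ‖deriv g z - ω₀ * 1‖ ≤ ‖deriv g z - ω₀ * Complex.exp z‖ + 1 * (2 * η) := by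
        have := norm_add_le (deriv g z - ω₀ * Complex.exp z) (ω₀ * (Complex.exp z - 1))
        rw [norm_mul] at this
        have h6 : ‖ω₀‖ * ‖Complex.exp z - 1‖ ≤ 1 * (2 * η) := by
          gcongr
          linarith
        have h7 : deriv g z - ω₀ * 1 =
            deriv g z - ω₀ * Complex.exp z + ω₀ * (Complex.exp z - 1) := by ring
        rw [h7]; linarith
      have h8 : 4 * η = (1 - k) / 8 := by rw [hη]; ring
      have h9 : δ ≤ (1 - k) / 8 := by rw [hδ]; nlinarith
      linarith
  -- The quantitative inverse function theorem: `f` maps the disk of radius `η` about `2πi` onto a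
  -- disk that contains `f 0`.
  have hsurj := happ.surjOn_closedBall_of_nonlinearRightInverse
    (wirtingerRightInverse hk hω₀k) hη0.le subset_rfl
  have hmem : f 0 ∈ Metric.closedBall (f T)
      ((((wirtingerRightInverse hk hω₀k).nnnorm : ℝ)⁻¹ -
        (Real.toNNReal ((1 - k) / 4) : ℝ)) * η) := by
    have : (((wirtingerRightInverse hk hω₀k).nnnorm : ℝ)⁻¹ = 1 - k) := by
      simp only [wirtingerRightInverse]
      rw [NNReal.coe_inv, inv_inv, Real.coe_toNNReal _ (by linarith)]
    rw [this, Real.coe_toNNReal _ (by linarith), Metric.mem_closedBall, dist_comm, dist_eq_norm]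
    refine hfT.trans ?_
    rw [hδ]
    have : 0 < (1 - k) * η := mul_pos (by linarith) hη0
    nlinarith
  obtain ⟨z, hz, hfz⟩ := hsurj hmem
  have hz0 := hq.inj (hsub (hballT hz)) h0R hfz
  rw [hz0, Metric.mem_closedBall, dist_comm, dist_zero_right, hTn] at hz
  linarith

/-- Precomposition with a conformal map and postcomposition with a similarity `w ↦ c w + const`
preserve injectivity and the bound of the dilatation. -/
lemma QCPair.comp {k : ℝ} {h g : ℂ → ℂ} {U V : Set ℂ} (hq : QCPair k h g U) (hU : IsOpen U)
    {φ φ' : ℂ → ℂ} (hφ : ∀ z ∈ V, HasDerivAt φ (φ' z) z)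
    (hφ' : ∀ z ∈ V, φ' z ≠ 0) (hmaps : MapsTo φ V U) (hinj : InjOn φ V) {c : ℂ} (hc : c ≠ 0)
    (b d : ℂ) :
    QCPair k (fun z => c * (h (φ z) - b)) (fun z => conj c * (g (φ z) - d)) V ∧
      (∀ z ∈ V, deriv (fun z => c * (h (φ z) - b)) z = c * (deriv h (φ z) * φ' z)) ∧
      ∀ z ∈ V, deriv (fun z => conj c * (g (φ z) - d)) z = conj c * (deriv g (φ z) * φ' z) := by
  have dh : ∀ z ∈ V, HasDerivAt (fun z => c * (h (φ z) - b)) (c * (deriv h (φ z) * φ' z)) z :=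
    fun z hz => (((hq.diff_h.differentiableAt (hU.mem_nhds (hmaps hz))).hasDerivAt.comp z
      (hφ z hz)).sub_const b).const_mul c
  have dg : ∀ z ∈ V, HasDerivAt (fun z => conj c * (g (φ z) - d))
      (conj c * (deriv g (φ z) * φ' z)) z :=
    fun z hz => (((hq.diff_g.differentiableAt (hU.mem_nhds (hmaps hz))).hasDerivAt.comp z
      (hφ z hz)).sub_const d).const_mul _
  refine ⟨⟨fun z hz => (dh z hz).differentiableAt.differentiableWithinAt,
    fun z hz => (dg z hz).differentiableAt.differentiableWithinAt, fun z hz => ?_, fun z hz => ?_,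
    fun x hx y hy hxy => ?_⟩, fun z hz => (dh z hz).deriv, fun z hz => (dg z hz).deriv⟩
  · rw [(dh z hz).deriv]
    exact mul_ne_zero hc (mul_ne_zero (hq.deriv_ne _ (hmaps hz)) (hφ' z hz))
  · rw [(dh z hz).deriv, (dg z hz).deriv]
    simp only [norm_mul, RCLike.norm_conj]
    have := hq.deriv_le _ (hmaps hz)
    calc ‖c‖ * (‖deriv g (φ z)‖ * ‖φ' z‖) ≤ ‖c‖ * ((k * ‖deriv h (φ z)‖) * ‖φ' z‖) := by gcongr
      _ = _ := by ring
  · have e : ∀ z, c * (h (φ z) - b) + conj (conj c * (g (φ z) - d)) =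
        c * ((h (φ z) + conj (g (φ z))) - (b + conj d)) := by
      intro z; simp only [map_mul, map_sub, Complex.conj_conj]; ring
    simp only [e] at hxy
    exact hinj hx hy (hq.inj (hmaps hx) (hmaps hy) (sub_left_injective (mul_left_cancel₀ hc hxy)))

/-- The pre-Schwarzian at the origin is bounded over all injective harmonic maps of the disk of
dilatation at most `k`. If it were large somewhere, rescaling at a point where
`(1/2 - |z|) |h''(z) / h'(z)|` is maximal would give a map excluded by
`exists_radius_not_injective`. -/
lemma exists_bound_deriv_deriv {k : ℝ} (hk0 : 0 ≤ k) (hk : k < 1) :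
    ∃ M : ℝ, ∀ h g : ℂ → ℂ, QCPair k h g unitDisk →
      ‖deriv (deriv h) 0‖ ≤ M * ‖deriv h 0‖ := by
  obtain ⟨R₀, hR₀, hno⟩ := exists_radius_not_injective hk0 hk
  refine ⟨4 * R₀, fun h g hq => ?_⟩
  by_contra hc
  push Not at hc
  have hop := isOpen_unitDisk
  set P : ℂ → ℂ := fun z => deriv (deriv h) z / deriv h z with hP
  have hPc : ContinuousOn P unitDisk :=
    (((hq.diff_h.deriv hop).deriv hop).div (hq.diff_h.deriv hop) hq.deriv_ne).continuousOn
  have hsub : Metric.closedBall (0 : ℂ) (1 / 2) ⊆ unitDisk :=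
    Metric.closedBall_subset_ball (by norm_num)
  obtain ⟨z₀, hz₀, hmax⟩ := (isCompact_closedBall (0 : ℂ) (1 / 2)).exists_isMaxOn
    ⟨0, by simp⟩ (f := fun z => (1 / 2 - ‖z‖) * ‖P z‖)
    ((continuousOn_const.sub continuous_norm.continuousOn).mul (hPc.mono hsub).norm)
  have hz₀2 : ‖z₀‖ ≤ 1 / 2 := by simpa using hz₀
  have hP0 : 4 * R₀ < ‖P 0‖ := by
    rw [hP]; simp only [norm_div]
    rwa [lt_div_iff₀ (norm_pos_iff.2 (hq.deriv_ne 0 zero_mem_unitDisk))]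
  set m : ℝ := (1 / 2 - ‖z₀‖) * ‖P z₀‖ with hm
  have hm0 : 2 * R₀ < m := by
    have := hmax (show (0 : ℂ) ∈ Metric.closedBall (0 : ℂ) (1 / 2) by simp)
    simp only [mem_ofPred_eq, norm_zero, sub_zero] at this
    linarith
  have hmpos : 0 < m := by linarith
  have hz₀lt : 0 < 1 / 2 - ‖z₀‖ := by
    rcases (sub_nonneg.2 hz₀2).eq_or_lt with h0 | h0
    · rw [hm, ← h0, zero_mul] at hmpos; exact absurd hmpos (lt_irrefl _)
    · exact h0
  have hPz₀ : P z₀ ≠ 0 := by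
    intro h0; rw [hm, h0, norm_zero, mul_zero] at hmpos; exact lt_irrefl _ hmpos
  have hz₀d := hsub hz₀
  have hh'z₀ := hq.deriv_ne z₀ hz₀d
  set ρ : ℂ := (P z₀)⁻¹ with hρ
  have hρ0 : ρ ≠ 0 := inv_ne_zero hPz₀
  have hρn : ‖ρ‖ * (m / 2) = (1 / 2 - ‖z₀‖) / 2 := by
    rw [hρ, norm_inv, hm]; field_simp
  have hin : ∀ ζ ∈ Metric.ball (0 : ℂ) (m / 2), ‖z₀ + ρ * ζ‖ < ‖z₀‖ + (1 / 2 - ‖z₀‖) / 2 := by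
    intro ζ hζ
    have : ‖ζ‖ < m / 2 := by simpa using hζ
    refine (norm_add_le _ _).trans_lt ?_
    rw [norm_mul, ← hρn]
    have := mul_lt_mul_of_pos_left this (norm_pos_iff.2 hρ0)
    linarith
  have hmaps : MapsTo (fun ζ => z₀ + ρ * ζ) (Metric.ball 0 (m / 2)) unitDisk := by
    intro ζ hζ
    rw [mem_unitDisk]
    have := hin ζ hζ
    linarith
  have hder : ∀ z ∈ Metric.ball (0 : ℂ) (m / 2), HasDerivAt (fun ζ => z₀ + ρ * ζ) ρ z := by
    intro z _
    simpa using ((hasDerivAt_id z).const_mul ρ).const_add z₀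
  have hinj : InjOn (fun ζ => z₀ + ρ * ζ) (Metric.ball (0 : ℂ) (m / 2)) := by
    intro x _ y _ hxy
    exact mul_left_cancel₀ hρ0 (add_left_cancel hxy)
  set c : ℂ := (ρ * deriv h z₀)⁻¹ with hcdef
  have hc0 : c ≠ 0 := inv_ne_zero (mul_ne_zero hρ0 hh'z₀)
  obtain ⟨hQ, hd1, -⟩ := hq.comp hop hder (fun _ _ => hρ0) hmaps hinj
    hc0 0 0
  have hd2 : ∀ z ∈ Metric.ball (0 : ℂ) (m / 2),
      deriv (deriv (fun ζ => c * (h (z₀ + ρ * ζ) - 0))) z =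
        c * (deriv (deriv h) (z₀ + ρ * z) * ρ * ρ) := by
    intro z hz
    have h1 : HasDerivAt (fun ζ => c * (deriv h (z₀ + ρ * ζ) * ρ))
        (c * (deriv (deriv h) (z₀ + ρ * z) * ρ * ρ)) z := by
      have h2 : HasDerivAt (fun ζ => deriv h (z₀ + ρ * ζ)) (deriv (deriv h) (z₀ + ρ * z) * ρ) z :=
        HasDerivAt.comp z (h₂ := deriv h) ((hq.diff_h.deriv hop).differentiableAt
          (hop.mem_nhds (hmaps hz))).hasDerivAt (hder z hz)
      exact (h2.mul_const ρ).const_mul c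
    refine (h1.congr_of_eventuallyEq ?_).deriv
    filter_upwards [Metric.isOpen_ball.mem_nhds hz] with w hw using hd1 w hw
  have h0m : (0 : ℂ) ∈ Metric.ball (0 : ℂ) (m / 2) := by
    simp only [Metric.mem_ball, dist_self]; linarith
  refine hno (m / 2) _ _ (by linarith) hQ ?_ ?_ ?_
  · rw [hd1 0 h0m, mul_zero, add_zero, hcdef, mul_comm (deriv h z₀) ρ]
    exact inv_mul_cancel₀ (mul_ne_zero hρ0 hh'z₀)
  · rw [hd2 0 h0m, mul_zero, add_zero, hcdef]
    have : deriv (deriv h) z₀ = P z₀ * deriv h z₀ := by rw [hP]; field_simp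
    rw [this, hρ]
    field_simp
  · intro ζ hζ
    rw [hd2 ζ hζ, hd1 ζ hζ]
    set z := z₀ + ρ * ζ with hz
    have hzn : ‖z‖ < ‖z₀‖ + (1 / 2 - ‖z₀‖) / 2 := hin ζ hζ
    have hzm := hmax (show z ∈ Metric.closedBall (0 : ℂ) (1 / 2) by
      simp only [Metric.mem_closedBall, dist_zero_right]; linarith)
    simp only [mem_ofPred_eq, ← hm] at hzm
    have hPz : ‖P z‖ ≤ 2 * ‖P z₀‖ := by
      have h1 : (1 / 2 - ‖z₀‖) / 2 * ‖P z‖ ≤ (1 / 2 - ‖z‖) * ‖P z‖ := by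
        gcongr; linarith
      have h2 : (1 / 2 - ‖z₀‖) * ‖P z‖ ≤ (1 / 2 - ‖z₀‖) * (2 * ‖P z₀‖) := by
        have := h1.trans hzm
        rw [hm] at this; linarith
      exact le_of_mul_le_mul_left h2 hz₀lt
    have hPe : ‖deriv (deriv h) z‖ = ‖P z‖ * ‖deriv h z‖ := by
      rw [hP]; simp only [norm_div]
      rw [div_mul_cancel₀ _ (norm_ne_zero_iff.2 (hq.deriv_ne z (hmaps hζ)))]
    have hρP : ‖P z₀‖ * ‖ρ‖ = 1 := by
      rw [← norm_mul, hρ, mul_inv_cancel₀ hPz₀, norm_one]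
    simp only [norm_mul, hPe]
    calc ‖c‖ * (‖P z‖ * ‖deriv h z‖ * ‖ρ‖ * ‖ρ‖)
        ≤ ‖c‖ * ((2 * ‖P z₀‖) * ‖deriv h z‖ * ‖ρ‖ * ‖ρ‖) := by gcongr
      _ = 2 * (‖c‖ * (‖deriv h z‖ * ‖ρ‖)) * (‖P z₀‖ * ‖ρ‖) := by ring
      _ = _ := by rw [hρP, mul_one]

lemma mem_secondCoeffs {K : ℝ} {f h g : ℂ → ℂ} (hf : f ∈ SHK K)
    (hd : IsNormalizedDecomposition f h g) : ‖deriv (deriv h) 0‖ / 2 ∈ secondCoeffs K :=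
  ⟨f, hf, by simp only [hd.dz_dz_zero]⟩

lemma bddAbove_secondCoeffs {K : ℝ} (hK : 1 ≤ K) : BddAbove (secondCoeffs K) := by
  obtain ⟨M, hM⟩ := exists_bound_deriv_deriv (dilBound_nonneg hK) (dilBound_lt_one hK)
  refine ⟨M / 2, ?_⟩
  rintro _ ⟨f, hf, rfl⟩
  obtain ⟨h, g, hd⟩ := hf.1.1
  have := hM h g (QCPair.of_mem_SHK hK hf hd)
  rw [hd.deriv_h_zero, norm_one, mul_one] at this
  simp only [hd.dz_dz_zero]
  linarith

lemma norm_deriv_deriv_zero_le {K : ℝ} (hK : 1 ≤ K) {f h g : ℂ → ℂ} (hf : f ∈ SHK K)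
    (hd : IsNormalizedDecomposition f h g) : ‖deriv (deriv h) 0‖ ≤ 2 * gammaStar K := by
  have := le_csSup (bddAbove_secondCoeffs hK) (mem_secondCoeffs hf hd)
  rw [← gammaStar] at this
  linarith

/-! ### The Koebe function -/

/-- The Koebe function `z / (1 - z)²`. -/
noncomputable def koebe (z : ℂ) : ℂ := z / (1 - z) ^ 2

lemma one_sub_ne_zero_of_mem {z : ℂ} (hz : z ∈ unitDisk) : 1 - z ≠ 0 := by
  intro h
  have : z = 1 := (sub_eq_zero.1 h).symm
  rw [this, mem_unitDisk, norm_one] at hz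
  exact lt_irrefl _ hz

lemma hasDerivAt_koebe {z : ℂ} (hz : z ∈ unitDisk) :
    HasDerivAt koebe ((1 + z) / (1 - z) ^ 3) z := by
  have hne := one_sub_ne_zero_of_mem hz
  have := (hasDerivAt_id z).div (((hasDerivAt_id z).const_sub 1).pow 2) (pow_ne_zero 2 hne)
  refine this.congr_deriv ?_
  simp only [id, Pi.pow_apply]
  field_simp
  push_cast
  ring

lemma deriv_deriv_koebe_zero : deriv (deriv koebe) 0 = 4 := by
  have h1 : HasDerivAt (fun z : ℂ => (1 + z) / (1 - z) ^ 3) 4 0 := by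
    have := ((hasDerivAt_id (0 : ℂ)).const_add 1).div (((hasDerivAt_id (0 : ℂ)).const_sub 1).pow 3)
      (by simp)
    refine this.congr_deriv ?_
    norm_num
  refine (h1.congr_of_eventuallyEq ?_).deriv
  filter_upwards [isOpen_unitDisk.mem_nhds zero_mem_unitDisk] with w hw
    using (hasDerivAt_koebe hw).deriv

lemma injOn_koebe : InjOn koebe unitDisk := by
  intro z hz w hw hzw
  have h1 := one_sub_ne_zero_of_mem hz
  have h2 := one_sub_ne_zero_of_mem hw
  rw [koebe, koebe, div_eq_div_iff (pow_ne_zero 2 h1) (pow_ne_zero 2 h2)] at hzw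
  have h3 : (z - w) * (1 - z * w) = 0 := by linear_combination hzw
  have h4 : z * w ∈ unitDisk := by
    rw [mem_unitDisk] at *
    rw [norm_mul]
    nlinarith [norm_nonneg z, norm_nonneg w]
  exact sub_eq_zero.1 ((mul_eq_zero.1 h3).resolve_right (one_sub_ne_zero_of_mem h4))

lemma koebe_decomposition : IsNormalizedDecomposition koebe koebe (fun _ => 0) where
  analytic_h z hz := (hasDerivAt_koebe hz).differentiableAt.differentiableWithinAt
  analytic_g := differentiableOn_const _
  eq_add_conj z _ := by simp
  h_zero := by simp [koebe]
  g_zero := rfl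
  deriv_h_zero := by rw [(hasDerivAt_koebe zero_mem_unitDisk).deriv]; simp

lemma koebe_mem_SHK {K : ℝ} (hK : 1 ≤ K) : koebe ∈ SHK K := by
  refine QCPair.mem_SHK hK koebe_decomposition ⟨koebe_decomposition.analytic_h,
    koebe_decomposition.analytic_g, fun z hz => ?_, fun z hz => ?_, ?_⟩
  · rw [(hasDerivAt_koebe hz).deriv]
    refine div_ne_zero ?_ (pow_ne_zero 3 (one_sub_ne_zero_of_mem hz))
    have : -z ∈ unitDisk := by simpa [mem_unitDisk] using hz
    simpa using one_sub_ne_zero_of_mem this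
  · simpa using mul_nonneg (dilBound_nonneg hK) (norm_nonneg _)
  · simpa using injOn_koebe

lemma two_le_gammaStar {K : ℝ} (hK : 1 ≤ K) : 2 ≤ gammaStar K := by
  have := norm_deriv_deriv_zero_le hK (koebe_mem_SHK hK) koebe_decomposition
  rw [deriv_deriv_koebe_zero] at this
  norm_num at this
  linarith

/-! ### The Koebe transform and the growth theorem -/

section Mobius

variable {ζ z : ℂ}

lemma one_add_conj_mul_ne_zero (hζ : ζ ∈ unitDisk) (hz : z ∈ unitDisk) : 1 + conj ζ * z ≠ 0 := by
  have : -(conj ζ * z) ∈ unitDisk := by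
    rw [mem_unitDisk] at *
    rw [norm_neg, norm_mul, RCLike.norm_conj]
    nlinarith [norm_nonneg z, norm_nonneg ζ]
  simpa using one_sub_ne_zero_of_mem this

lemma one_sub_norm_sq_pos (hζ : ζ ∈ unitDisk) : 0 < 1 - ‖ζ‖ ^ 2 := by
  rw [mem_unitDisk] at hζ; nlinarith [norm_nonneg ζ]

/-- The automorphism `z ↦ (z + ζ) / (1 + \bar ζ z)` of the disk. -/
noncomputable def mobius (ζ z : ℂ) : ℂ := (z + ζ) / (1 + conj ζ * z)

lemma mapsTo_mobius (hζ : ζ ∈ unitDisk) : MapsTo (mobius ζ) unitDisk unitDisk := by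
  intro z hz
  have hne := one_add_conj_mul_ne_zero hζ hz
  rw [mem_unitDisk, mobius, norm_div, div_lt_one (norm_pos_iff.2 hne)]
  refine lt_of_pow_lt_pow_left₀ 2 (norm_nonneg _) ?_
  have h := mul_pos (one_sub_norm_sq_pos hζ) (one_sub_norm_sq_pos hz)
  have key : ‖1 + conj ζ * z‖ ^ 2 - ‖z + ζ‖ ^ 2 = (1 - ‖ζ‖ ^ 2) * (1 - ‖z‖ ^ 2) := by
    simp only [Complex.sq_norm, Complex.normSq_apply, Complex.add_re, Complex.add_im,
      Complex.mul_re, Complex.mul_im, Complex.conj_re, Complex.conj_im, Complex.one_re,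
      Complex.one_im]
    ring
  linarith

lemma conj_mul_self_eq (ζ : ℂ) : conj ζ * ζ = ((‖ζ‖ ^ 2 : ℝ) : ℂ) := by
  rw [Complex.conj_mul']; push_cast; rfl

lemma injOn_mobius (hζ : ζ ∈ unitDisk) : InjOn (mobius ζ) unitDisk := by
  intro z hz w hw hzw
  rw [mobius, mobius, div_eq_div_iff (one_add_conj_mul_ne_zero hζ hz)
    (one_add_conj_mul_ne_zero hζ hw)] at hzw
  have h1 : (z - w) * ((1 - ‖ζ‖ ^ 2 : ℝ) : ℂ) = 0 := by
    have := conj_mul_self_eq ζ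
    push_cast at this ⊢
    linear_combination hzw + (z - w) * this
  have h2 : ((1 - ‖ζ‖ ^ 2 : ℝ) : ℂ) ≠ 0 := by exact_mod_cast (one_sub_norm_sq_pos hζ).ne'
  exact sub_eq_zero.1 ((mul_eq_zero.1 h1).resolve_right h2)

lemma hasDerivAt_mobius (hζ : ζ ∈ unitDisk) (hz : z ∈ unitDisk) :
    HasDerivAt (mobius ζ) (((1 - ‖ζ‖ ^ 2 : ℝ) : ℂ) / (1 + conj ζ * z) ^ 2) z := by
  have hne := one_add_conj_mul_ne_zero hζ hz
  have := ((hasDerivAt_id z).add_const ζ).div (((hasDerivAt_id z).const_mul (conj ζ)).const_add 1)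
    hne
  refine this.congr_deriv ?_
  have h1 := conj_mul_self_eq ζ
  push_cast at h1 ⊢
  simp only [id]
  congr 1
  linear_combination -h1

end Mobius

/-- The class is invariant under Koebe transforms, so the bound of the second coefficient at the
origin gives a bound of the pre-Schwarzian everywhere. -/
lemma norm_preSchwarzian_le {K : ℝ} (hK : 1 ≤ K) {f h g : ℂ → ℂ} (hf : f ∈ SHK K)
    (hd : IsNormalizedDecomposition f h g) {ζ : ℂ} (hζ : ζ ∈ unitDisk) :
    (1 - ‖ζ‖ ^ 2) * ‖deriv (deriv h) ζ‖ ≤ (2 * gammaStar K + 2 * ‖ζ‖) * ‖deriv h ζ‖ := by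
  have hop := isOpen_unitDisk
  have hq := QCPair.of_mem_SHK hK hf hd
  have hh' := hq.deriv_ne ζ hζ
  have hs := one_sub_norm_sq_pos hζ
  set s : ℂ := ((1 - ‖ζ‖ ^ 2 : ℝ) : ℂ) with hsdef
  have hs0 : s ≠ 0 := by rw [hsdef]; exact_mod_cast hs.ne'
  set c : ℂ := (s * deriv h ζ)⁻¹ with hc
  have hc0 : c ≠ 0 := inv_ne_zero (mul_ne_zero hs0 hh')
  have hφ0 : mobius ζ 0 = ζ := by simp [mobius]
  obtain ⟨hQ, hd1, -⟩ := hq.comp hop (fun z hz => hasDerivAt_mobius hζ hz)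
    (fun z hz => div_ne_zero hs0 (pow_ne_zero 2 (one_add_conj_mul_ne_zero hζ hz)))
    (mapsTo_mobius hζ) (injOn_mobius hζ) hc0 (h ζ) (g ζ)
  set H : ℂ → ℂ := fun z => c * (h (mobius ζ z) - h ζ) with hH
  set G : ℂ → ℂ := fun z => conj c * (g (mobius ζ z) - g ζ) with hG
  have hdec : IsNormalizedDecomposition (fun z => H z + conj (G z)) H G := by
    refine ⟨hQ.diff_h, hQ.diff_g, fun z _ => rfl, by simp [hH, hφ0], by simp [hG, hφ0], ?_⟩
    rw [hd1 0 zero_mem_unitDisk, hφ0, mul_zero, add_zero, one_pow, div_one, mul_comm (deriv h ζ) s]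
    exact inv_mul_cancel₀ (mul_ne_zero hs0 hh')
  have hmem := hQ.mem_SHK hK hdec
  have hbd := norm_deriv_deriv_zero_le hK hmem hdec
  have hd2 : deriv (deriv H) 0 = c * (deriv (deriv h) ζ * s * s + deriv h ζ * (-2 * conj ζ * s)) := by
    have h2 : HasDerivAt (fun z => deriv h (mobius ζ z)) (deriv (deriv h) ζ * s) 0 := by
      have h3 := ((hq.diff_h.deriv hop).differentiableAt (hop.mem_nhds hζ)).hasDerivAt
      rw [← hφ0] at h3
      have := h3.comp 0 (hasDerivAt_mobius hζ zero_mem_unitDisk)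
      rw [hφ0] at this
      simpa [Function.comp_def, hsdef] using this
    have h4 : HasDerivAt (fun z => s / (1 + conj ζ * z) ^ 2) (-2 * conj ζ * s) 0 := by
      have := (hasDerivAt_const (0 : ℂ) s).div
        ((((hasDerivAt_id (0 : ℂ)).const_mul (conj ζ)).const_add 1).pow 2) (by simp)
      refine this.congr_deriv ?_
      simp; ring
    have h5 := (h2.mul h4).const_mul c
    simp only [hφ0, mul_zero, add_zero, one_pow, div_one] at h5
    refine (h5.congr_of_eventuallyEq ?_).deriv
    filter_upwards [hop.mem_nhds zero_mem_unitDisk] with w hw using hd1 w hw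
  have e : s * deriv (deriv h) ζ = deriv h ζ * (deriv (deriv H) 0 + 2 * conj ζ) := by
    rw [hd2, hc]; field_simp; ring
  have e2 : (1 - ‖ζ‖ ^ 2) * ‖deriv (deriv h) ζ‖ = ‖s * deriv (deriv h) ζ‖ := by
    rw [norm_mul, hsdef, Complex.norm_real, Real.norm_of_nonneg hs.le]
  rw [e2, e, norm_mul, mul_comm]
  gcongr
  refine (norm_add_le _ _).trans ?_
  rw [norm_mul, RCLike.norm_conj, Complex.norm_ofNat]
  linarith

/-- The bound of the pre-Schwarzian integrated along the ray in direction `e`. -/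
lemma norm_deriv_ray_le {K : ℝ} (hK : 1 ≤ K) {f h g : ℂ → ℂ} (hf : f ∈ SHK K)
    (hd : IsNormalizedDecomposition f h g) {e : ℂ} (he : ‖e‖ = 1) {r : ℝ} (hr0 : 0 ≤ r)
    (hr1 : r < 1) :
    ‖deriv h (r * e)‖ ≤ 2 ^ gammaStar K * (1 - r) ^ (-gammaStar K - 1) := by
  set γ := gammaStar K with hγ
  have hγ2 : 2 ≤ γ := two_le_gammaStar hK
  have hop := isOpen_unitDisk
  have hmem : ∀ t ∈ Ico (0 : ℝ) 1, (t : ℂ) * e ∈ unitDisk ∧ ‖(t : ℂ) * e‖ = t := by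
    intro t ht
    have : ‖(t : ℂ) * e‖ = t := by rw [norm_mul, he, mul_one, Complex.norm_real,
      Real.norm_of_nonneg ht.1]
    exact ⟨by rw [mem_unitDisk, this]; exact ht.2, this⟩
  -- The logarithmic derivative of `W` is minus twice the bound of the pre-Schwarzian.
  set W : ℝ → ℝ := fun t => (1 - t) ^ (2 * γ + 2) * (1 + t) ^ (2 - 2 * γ) with hW
  have hN : ∀ t ∈ Ico (0 : ℝ) 1, HasDerivAt (fun t : ℝ => ‖deriv h (t * e)‖ ^ 2 * W t)
      (2 * inner ℝ (deriv h (t * e)) (deriv (deriv h) (t * e) * e) * W t +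
        ‖deriv h (t * e)‖ ^ 2 * (W t * (-(4 * γ + 4 * t) / (1 - t ^ 2)))) t := by
    intro t ht
    have h1 : HasDerivAt (fun t : ℝ => deriv h (t * e)) (deriv (deriv h) (t * e) * e) t := by
      have h2 := ((hd.analytic_h.deriv hop).differentiableAt
        (hop.mem_nhds (hmem t ht).1)).hasDerivAt
      have h3 : HasDerivAt (fun t : ℝ => (t : ℂ) * e) e t := by
        simpa using (Complex.ofRealCLM.hasDerivAt (x := t)).mul_const e
      exact h2.comp t h3
    have ha : (1 - t) ≠ 0 := by linarith [ht.2]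
    have hb : (1 + t) ≠ 0 := by linarith [ht.1]
    have h4 : HasDerivAt W (W t * (-(4 * γ + 4 * t) / (1 - t ^ 2))) t := by
      have h5 := ((hasDerivAt_id t).const_sub 1).rpow_const (p := 2 * γ + 2) (Or.inl ha)
      have h6 := ((hasDerivAt_id t).const_add 1).rpow_const (p := 2 - 2 * γ) (Or.inl hb)
      refine (h5.mul h6).congr_deriv ?_
      simp only [hW, id]
      rw [Real.rpow_sub_one ha, Real.rpow_sub_one hb]
      have hc : 1 - t ^ 2 = (1 - t) * (1 + t) := by ring
      rw [hc]
      field_simp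
      ring
    exact (h1.norm_sq).mul h4
  have hWpos : ∀ t ∈ Ico (0 : ℝ) 1, 0 < W t := fun t ht =>
    mul_pos (Real.rpow_pos_of_pos (by linarith [ht.2]) _)
      (Real.rpow_pos_of_pos (by linarith [ht.1]) _)
  have hanti : AntitoneOn (fun t : ℝ => ‖deriv h (t * e)‖ ^ 2 * W t) (Ico (0 : ℝ) 1) := by
    refine antitoneOn_of_deriv_nonpos (convex_Ico 0 1)
      (fun t ht => (hN t ht).continuousAt.continuousWithinAt)
      (fun t ht => (hN t (interior_subset ht)).differentiableAt.differentiableWithinAt)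
      (fun t ht => ?_)
    have ht := interior_subset ht
    rw [(hN t ht).deriv]
    have ht2 : 0 < 1 - t ^ 2 := by nlinarith [ht.1, ht.2]
    have hp := norm_preSchwarzian_le hK hf hd (hmem t ht).1
    rw [(hmem t ht).2, ← hγ] at hp
    set x := deriv h (t * e)
    set y := deriv (deriv h) (t * e)
    have h7 : inner ℝ x (y * e) ≤ ‖x‖ * ‖y‖ := by
      refine (real_inner_le_norm _ _).trans ?_
      rw [norm_mul, he, mul_one]
    have h8 : inner ℝ x (y * e) * (1 - t ^ 2) ≤ (2 * γ + 2 * t) * ‖x‖ ^ 2 := by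
      nlinarith [norm_nonneg x, mul_le_mul_of_nonneg_left hp (norm_nonneg x)]
    have h9 : 2 * inner ℝ x (y * e) * W t + ‖x‖ ^ 2 * (W t * (-(4 * γ + 4 * t) / (1 - t ^ 2)))
        = 2 * W t / (1 - t ^ 2) * (inner ℝ x (y * e) * (1 - t ^ 2) - (2 * γ + 2 * t) * ‖x‖ ^ 2) := by
      field_simp; ring
    rw [h9]
    exact mul_nonpos_of_nonneg_of_nonpos
      (div_nonneg (by linarith [hWpos t ht]) ht2.le) (by linarith)
  have h0 := hanti ⟨le_rfl, one_pos⟩ (⟨hr0, hr1⟩ : r ∈ Ico (0 : ℝ) 1) hr0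
  have hW0 : W 0 = 1 := by simp [hW]
  simp only [Complex.ofReal_zero, zero_mul, hd.deriv_h_zero, norm_one, one_pow, one_mul,
    hW0] at h0
  have h1r : 0 < 1 - r := by linarith
  have h2r : 0 < 1 + r := by linarith
  set B := 2 ^ γ * (1 - r) ^ (-γ - 1) with hB
  have hBpos : 0 < B := by positivity
  have hB2 : 1 ≤ B ^ 2 * W r := by
    have e1 : B ^ 2 = 2 ^ (2 * γ) * (1 - r) ^ (-(2 * γ + 2)) := by
      rw [hB, mul_pow, ← Real.rpow_natCast, ← Real.rpow_natCast, ← Real.rpow_mul (by norm_num),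
        ← Real.rpow_mul h1r.le]
      congr 2 <;> push_cast <;> ring
    have e2 : B ^ 2 * W r = 2 ^ (2 * γ) * (1 + r) ^ (2 - 2 * γ) := by
      rw [e1, hW]
      simp only
      rw [Real.rpow_neg h1r.le]
      have : (1 - r) ^ (2 * γ + 2) ≠ 0 := (Real.rpow_pos_of_pos h1r _).ne'
      field_simp
    rw [e2]
    calc (1 : ℝ) ≤ 2 ^ (2 : ℝ) := Real.one_le_rpow (by norm_num) (by norm_num)
      _ = 2 ^ (2 * γ) * 2 ^ (2 - 2 * γ) := by
          rw [← Real.rpow_add (by norm_num)]; congr 1; ring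
      _ ≤ 2 ^ (2 * γ) * (1 + r) ^ (2 - 2 * γ) := by
          exact mul_le_mul_of_nonneg_left
            (Real.rpow_le_rpow_of_nonpos h2r (by linarith) (by linarith)) (by positivity)
  have hWr := hWpos r ⟨hr0, hr1⟩
  have : ‖deriv h (r * e)‖ ^ 2 ≤ B ^ 2 := le_of_mul_le_mul_right (h0.trans hB2) hWr
  exact le_of_sq_le_sq this hBpos.le

lemma exists_unit_mul (z : ℂ) : ∃ e : ℂ, ‖e‖ = 1 ∧ z = (‖z‖ : ℝ) * e :=
  ⟨Complex.exp (z.arg * Complex.I), Complex.norm_exp_ofReal_mul_I _,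
    (Complex.norm_mul_exp_arg_mul_I z).symm⟩

lemma norm_deriv_le {K : ℝ} (hK : 1 ≤ K) {f h g : ℂ → ℂ} (hf : f ∈ SHK K)
    (hd : IsNormalizedDecomposition f h g) {z : ℂ} (hz : z ∈ unitDisk) :
    ‖deriv h z‖ ≤ 2 ^ gammaStar K * (1 - ‖z‖) ^ (-gammaStar K - 1) := by
  obtain ⟨e, he, hze⟩ := exists_unit_mul z
  have := norm_deriv_ray_le hK hf hd he (norm_nonneg z) (mem_unitDisk.1 hz)
  rwa [← hze] at this

lemma norm_deriv_conj_part_le {K : ℝ} (hK : 1 ≤ K) {f h g : ℂ → ℂ} (hf : f ∈ SHK K)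
    (hd : IsNormalizedDecomposition f h g) {z : ℂ} (hz : z ∈ unitDisk) :
    ‖deriv g z‖ ≤ ‖deriv h z‖ := by
  have h1 := (QCPair.of_mem_SHK hK hf hd).deriv_le z hz
  have h2 := (dilBound_lt_one hK).le
  nlinarith [norm_nonneg (deriv h z)]

lemma norm_le_of_mem_SHK {K : ℝ} (hK : 1 ≤ K) {f h g : ℂ → ℂ} (hf : f ∈ SHK K)
    (hd : IsNormalizedDecomposition f h g) {z : ℂ} (hz : z ∈ unitDisk) :
    ‖f z‖ ≤ 2 ^ gammaStar K * (1 - ‖z‖) ^ (-gammaStar K) := by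
  obtain ⟨e, he, hze⟩ := exists_unit_mul z
  set γ := gammaStar K with hγ
  have hγ2 : 2 ≤ γ := two_le_gammaStar hK
  have hz1 := mem_unitDisk.1 hz
  have hmem : ∀ t ∈ Icc (0 : ℝ) ‖z‖, (t : ℂ) * e ∈ unitDisk ∧ ‖(t : ℂ) * e‖ = t := by
    intro t ht
    have : ‖(t : ℂ) * e‖ = t := by rw [norm_mul, he, mul_one, Complex.norm_real,
      Real.norm_of_nonneg ht.1]
    exact ⟨by rw [mem_unitDisk, this]; linarith [ht.2], this⟩
  have hder : ∀ t ∈ Icc (0 : ℝ) ‖z‖, HasDerivAt (fun t : ℝ => f (t * e))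
      (wirtingerCLM (deriv h (t * e)) (deriv g (t * e)) e) t := by
    intro t ht
    have h3 : HasDerivAt (fun t : ℝ => (t : ℂ) * e) e t := by
      simpa using (Complex.ofRealCLM.hasDerivAt (x := t)).mul_const e
    exact (hd.hasFDerivAt (hmem t ht).1).comp_hasDerivAt t h3
  have hB : ∀ t ∈ Icc (0 : ℝ) ‖z‖, HasDerivAt (fun t : ℝ => 2 ^ γ * (2 / γ) * (1 - t) ^ (-γ))
      (2 * (2 ^ γ * (1 - t) ^ (-γ - 1))) t := by
    intro t ht
    have ha : (1 - t) ≠ 0 := by linarith [ht.2]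
    have h5 := (((hasDerivAt_id t).const_sub 1).rpow_const (p := -γ) (Or.inl ha)).const_mul
      (2 ^ γ * (2 / γ))
    refine h5.congr_deriv ?_
    simp only [id]
    field_simp
  have hf0 : f 0 = 0 := by
    rw [hd.eq_add_conj 0 zero_mem_unitDisk, hd.h_zero, hd.g_zero]; simp
  have := image_norm_le_of_norm_deriv_right_le_deriv_boundary'
    (f := fun t : ℝ => f (t * e)) (a := 0) (b := ‖z‖)
    (fun t ht => (hder t ht).continuousAt.continuousWithinAt)
    (fun t ht => (hder t (Ico_subset_Icc_self ht)).hasDerivWithinAt)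
    (B := fun t : ℝ => 2 ^ γ * (2 / γ) * (1 - t) ^ (-γ))
    (by simp only [Complex.ofReal_zero, zero_mul, hf0, norm_zero, sub_zero, Real.one_rpow]
        positivity)
    (fun t ht => (hB t ht).continuousAt.continuousWithinAt)
    (fun t ht => (hB t (Ico_subset_Icc_self ht)).hasDerivWithinAt)
    (fun t ht => by
      have ht := Ico_subset_Icc_self ht
      refine (ContinuousLinearMap.le_opNorm _ _).trans ?_
      rw [he, mul_one]
      refine (norm_wirtingerCLM_le _ _).trans ?_
      have h1 := norm_deriv_conj_part_le hK hf hd (hmem t ht).1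
      have h2 := norm_deriv_le hK hf hd (hmem t ht).1
      rw [(hmem t ht).2] at h2
      linarith)
    (show ‖z‖ ∈ Icc (0 : ℝ) ‖z‖ from ⟨norm_nonneg _, le_rfl⟩)
  simp only [← hze] at this
  refine this.trans ?_
  have h1 : 2 / γ ≤ 1 := by rw [div_le_one (by linarith)]; exact hγ2
  have h2 : 0 < (1 - ‖z‖) ^ (-γ) := Real.rpow_pos_of_pos (by linarith) _
  calc 2 ^ γ * (2 / γ) * (1 - ‖z‖) ^ (-γ) ≤ 2 ^ γ * 1 * (1 - ‖z‖) ^ (-γ) := by gcongr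
    _ = _ := by ring

/-! ### Green's formula in logarithmic polar coordinates -/

/-- The point `e^{s + iθ}`. -/
noncomputable def logPolar (s θ : ℝ) : ℂ := Complex.exp (s + θ * Complex.I)

lemma norm_logPolar (s θ : ℝ) : ‖logPolar s θ‖ = Real.exp s := by
  simp [logPolar, Complex.norm_exp]

lemma logPolar_ne_zero (s θ : ℝ) : logPolar s θ ≠ 0 := Complex.exp_ne_zero _

lemma logPolar_mem {s : ℝ} (hs : s < 0) (θ : ℝ) : logPolar s θ ∈ unitDisk := by
  rw [mem_unitDisk, norm_logPolar]; simpa using hs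

lemma logPolar_two_pi (s : ℝ) : logPolar s (2 * Real.pi) = logPolar s 0 := by
  rw [logPolar, logPolar, Complex.exp_add, Complex.exp_add]
  push_cast
  rw [Complex.exp_two_pi_mul_I]; simp

lemma continuous_logPolar : Continuous (fun p : ℝ × ℝ => logPolar p.1 p.2) := by
  unfold logPolar; fun_prop

/-- The Euler operator `z d/dz`, which is `d/dw` in the coordinate `z = e^w`. -/
noncomputable def euler (h : ℂ → ℂ) (z : ℂ) : ℂ := z * deriv h z

lemma differentiableOn_euler {h : ℂ → ℂ} (hh : DifferentiableOn ℂ h unitDisk) :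
    DifferentiableOn ℂ (euler h) unitDisk :=
  differentiableOn_id.mul (hh.deriv isOpen_unitDisk)

lemma hasDerivAt_logPolar_left (s θ : ℝ) :
    HasDerivAt (fun s => logPolar s θ) (logPolar s θ) s := by
  have h1 : HasDerivAt (fun s : ℝ => (s : ℂ) + θ * Complex.I) 1 s :=
    (Complex.ofRealCLM.hasDerivAt (x := s)).add_const _
  refine ((Complex.hasDerivAt_exp _).comp s h1).congr_deriv ?_
  simp [logPolar]

lemma hasDerivAt_logPolar_right (s θ : ℝ) :
    HasDerivAt (fun θ => logPolar s θ) (Complex.I * logPolar s θ) θ := by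
  have h1 : HasDerivAt (fun θ : ℝ => (s : ℂ) + θ * Complex.I) Complex.I θ := by
    simpa using ((Complex.ofRealCLM.hasDerivAt (x := θ)).mul_const Complex.I).const_add (s : ℂ)
  refine ((Complex.hasDerivAt_exp _).comp θ h1).congr_deriv ?_
  simp [logPolar, mul_comm]

section Pair

variable {h g : ℂ → ℂ}

lemma hasDerivAt_pair_left (hh : DifferentiableOn ℂ h unitDisk)
    (hg : DifferentiableOn ℂ g unitDisk) {s : ℝ} (hs : s < 0) (θ : ℝ) :
    HasDerivAt (fun s => h (logPolar s θ) + conj (g (logPolar s θ)))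
      (euler h (logPolar s θ) + conj (euler g (logPolar s θ))) s := by
  have hn := isOpen_unitDisk.mem_nhds (logPolar_mem hs θ)
  have := (hasFDerivAt_add_conj (hh.differentiableAt hn).hasDerivAt
    (hg.differentiableAt hn).hasDerivAt).comp_hasDerivAt s (hasDerivAt_logPolar_left s θ)
  refine this.congr_deriv ?_
  simp [euler]

lemma hasDerivAt_pair_right (hh : DifferentiableOn ℂ h unitDisk)
    (hg : DifferentiableOn ℂ g unitDisk) {s : ℝ} (hs : s < 0) (θ : ℝ) :
    HasDerivAt (fun θ => h (logPolar s θ) + conj (g (logPolar s θ)))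
      (Complex.I * (euler h (logPolar s θ) - conj (euler g (logPolar s θ)))) θ := by
  have hn := isOpen_unitDisk.mem_nhds (logPolar_mem hs θ)
  have := (hasFDerivAt_add_conj (hh.differentiableAt hn).hasDerivAt
    (hg.differentiableAt hn).hasDerivAt).comp_hasDerivAt θ (hasDerivAt_logPolar_right s θ)
  refine this.congr_deriv ?_
  simp [euler]; ring

end Pair

/-- The derivative of `(‖x‖² + ε)^q` along a curve with position `x` and velocity `y`. -/
noncomputable def powD (q ε : ℝ) (x y : ℂ) : ℝ :=
  q * (‖x‖ ^ 2 + ε) ^ (q - 1) * (2 * inner ℝ x y)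

/-- The second derivative of `(‖x‖² + ε)^q` along a curve with position `x`, velocity `y` and
acceleration `w`. -/
noncomputable def powDD (q ε : ℝ) (x y w : ℂ) : ℝ :=
  q * (q - 1) * (‖x‖ ^ 2 + ε) ^ (q - 2) * (2 * inner ℝ x y) ^ 2 +
    q * (‖x‖ ^ 2 + ε) ^ (q - 1) * (2 * (‖y‖ ^ 2 + inner ℝ x w))

lemma hasDerivAt_norm_sq_add_rpow {q ε t : ℝ} {x : ℝ → ℂ} {y : ℂ} (hx : HasDerivAt x y t)
    (hpos : 0 < ‖x t‖ ^ 2 + ε) :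
    HasDerivAt (fun t => (‖x t‖ ^ 2 + ε) ^ q) (powD q ε (x t) y) t := by
  refine ((hx.norm_sq.add_const ε).rpow_const (p := q) (Or.inl hpos.ne')).congr_deriv ?_
  simp only [powD]; ring

lemma hasDerivAt_powD {q ε t : ℝ} {x y : ℝ → ℂ} {w : ℂ} (hx : HasDerivAt x (y t) t)
    (hy : HasDerivAt y w t) (hpos : 0 < ‖x t‖ ^ 2 + ε) :
    HasDerivAt (fun t => powD q ε (x t) (y t)) (powDD q ε (x t) (y t) w) t := by
  have h1 := hasDerivAt_norm_sq_add_rpow (q := q - 1) hx hpos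
  have h2 := (h1.const_mul q).mul ((hx.inner ℝ hy).const_mul 2)
  refine h2.congr_deriv ?_
  simp only [powD, powDD]
  rw [real_inner_self_eq_norm_sq, show q - 1 - 1 = q - 2 by ring]
  ring

section Green

variable {h g : ℂ → ℂ} {q ε : ℝ}

/-- The integral of `(|f|² + ε)^q` over the circle `|z| = e^s`, where `f = h + \bar g`. -/
noncomputable def powMean (q ε : ℝ) (h g : ℂ → ℂ) (s : ℝ) : ℝ :=
  ∫ θ in (0 : ℝ)..(2 * Real.pi), (‖h (logPolar s θ) + conj (g (logPolar s θ))‖ ^ 2 + ε) ^ q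

/-- The radial derivative `∂/∂s` of `(|f|² + ε)^q`, as a function of `z = e^{s + iθ}`. -/
noncomputable def radialD (q ε : ℝ) (h g : ℂ → ℂ) (z : ℂ) : ℝ :=
  powD q ε (h z + conj (g z)) (euler h z + conj (euler g z))

/-- The integral of the radial derivative of `(|f|² + ε)^q` over the circle `|z| = e^s`. -/
noncomputable def powMeanD (q ε : ℝ) (h g : ℂ → ℂ) (s : ℝ) : ℝ :=
  ∫ θ in (0 : ℝ)..(2 * Real.pi), radialD q ε h g (logPolar s θ)

/-- The Laplacian of `(|f|² + ε)^q` in the coordinates `(s, θ)`. -/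
noncomputable def powLap (q ε : ℝ) (h g : ℂ → ℂ) (z : ℂ) : ℝ :=
  q * (q - 1) * (‖h z + conj (g z)‖ ^ 2 + ε) ^ (q - 2) *
      (4 * (inner ℝ (h z + conj (g z)) (euler h z + conj (euler g z)) ^ 2 +
        inner ℝ (h z + conj (g z)) (Complex.I * (euler h z - conj (euler g z))) ^ 2)) +
    4 * q * (‖h z + conj (g z)‖ ^ 2 + ε) ^ (q - 1) * (‖euler h z‖ ^ 2 + ‖euler g z‖ ^ 2)

/-- The accelerations of `f` in the directions `s` and `θ` are opposite because `f` is harmonic, so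
they cancel in the Laplacian. -/
lemma powDD_add_powDD (q ε : ℝ) (h g : ℂ → ℂ) (z w : ℂ) :
    powDD q ε (h z + conj (g z)) (euler h z + conj (euler g z)) w +
      powDD q ε (h z + conj (g z)) (Complex.I * (euler h z - conj (euler g z))) (-w) =
    powLap q ε h g z := by
  have h1 : ‖euler h z + conj (euler g z)‖ ^ 2 +
      ‖Complex.I * (euler h z - conj (euler g z))‖ ^ 2 =
      2 * (‖euler h z‖ ^ 2 + ‖euler g z‖ ^ 2) := by
    rw [norm_mul, Complex.norm_I, one_mul]
    have := parallelogram_law_with_norm ℝ (euler h z) (conj (euler g z))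
    rw [RCLike.norm_conj] at this
    linarith [this, sq ‖euler h z + conj (euler g z)‖, sq ‖euler h z - conj (euler g z)‖,
      sq ‖euler h z‖, sq ‖euler g z‖]
  simp only [powDD, powLap, inner_neg_right]
  linear_combination (2 * q * (‖h z + conj (g z)‖ ^ 2 + ε) ^ (q - 1)) * h1

lemma continuousOn_pair {a b : ℂ → ℂ} (ha : ContinuousOn a unitDisk)
    (hb : ContinuousOn b unitDisk) : ContinuousOn (fun z => a z + conj (b z)) unitDisk :=
  ha.add (Complex.continuous_conj.comp_continuousOn hb)

variable (hh : DifferentiableOn ℂ h unitDisk) (hg : DifferentiableOn ℂ g unitDisk)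
  (hpos : ∀ z ∈ unitDisk, z ≠ 0 → 0 < ‖h z + conj (g z)‖ ^ 2 + ε)

/-- Functions continuous in the punctured disk are continuous in the coordinates `(s, θ)`. -/
lemma continuousOn_comp_logPolar {E : Type*} [TopologicalSpace E] {v : ℂ → E}
    (hv : ContinuousOn v (unitDisk \ {0})) :
    ContinuousOn (fun p : ℝ × ℝ => v (logPolar p.1 p.2)) (Iio 0 ×ˢ univ) :=
  hv.comp continuous_logPolar.continuousOn
    fun p hp => ⟨logPolar_mem hp.1 p.2, logPolar_ne_zero _ _⟩

lemma continuous_circle {E : Type*} [TopologicalSpace E] {v : ℂ → E}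
    (hv : ContinuousOn v (unitDisk \ {0})) {s : ℝ} (hs : s < 0) :
    Continuous (fun θ => v (logPolar s θ)) := by
  have := (continuousOn_comp_logPolar hv).comp_continuous (f := fun θ : ℝ => (s, θ))
    (by fun_prop) (fun θ => ⟨hs, mem_univ _⟩)
  exact this

include hh hg hpos

lemma continuousOn_norm_sq_add_rpow (q : ℝ) :
    ContinuousOn (fun z => (‖h z + conj (g z)‖ ^ 2 + ε) ^ q) (unitDisk \ {0}) := by
  have h1 := (continuousOn_pair hh.continuousOn hg.continuousOn).mono
    (sdiff_subset (t := {(0 : ℂ)}))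
  exact ((h1.norm.pow 2).add continuousOn_const).rpow_const
    fun z hz => Or.inl (hpos z hz.1 hz.2).ne'

lemma continuousOn_powDD {y w : ℂ → ℂ} (hy : ContinuousOn y unitDisk)
    (hw : ContinuousOn w unitDisk) :
    ContinuousOn (fun z => powDD q ε (h z + conj (g z)) (y z) (w z)) (unitDisk \ {0}) := by
  have h1 := (continuousOn_pair hh.continuousOn hg.continuousOn).mono
    (sdiff_subset (t := {(0 : ℂ)}))
  have hy := hy.mono (sdiff_subset (t := {(0 : ℂ)}))
  have hw := hw.mono (sdiff_subset (t := {(0 : ℂ)}))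
  have h2 := continuousOn_norm_sq_add_rpow hh hg hpos (q - 1)
  have h3 := continuousOn_norm_sq_add_rpow hh hg hpos (q - 2)
  unfold powDD
  exact ((continuousOn_const.mul h3).mul ((continuousOn_const.mul (h1.inner hy)).pow 2)).add
    ((continuousOn_const.mul h2).mul (continuousOn_const.mul ((hy.norm.pow 2).add (h1.inner hw))))

lemma continuousOn_radialD : ContinuousOn (radialD q ε h g) (unitDisk \ {0}) := by
  have h1 := (continuousOn_pair hh.continuousOn hg.continuousOn).mono
    (sdiff_subset (t := {(0 : ℂ)}))
  have hy := (continuousOn_pair (differentiableOn_euler hh).continuousOn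
    (differentiableOn_euler hg).continuousOn).mono (sdiff_subset (t := {(0 : ℂ)}))
  exact (continuousOn_const.mul (continuousOn_norm_sq_add_rpow hh hg hpos (q - 1))).mul
    (continuousOn_const.mul (h1.inner hy))

lemma continuousOn_powLap : ContinuousOn (powLap q ε h g) (unitDisk \ {0}) := by
  have e1 := (differentiableOn_euler hh).continuousOn
  have e2 := (differentiableOn_euler hg).continuousOn
  refine ((continuousOn_powDD (q := q) hh hg hpos (continuousOn_pair e1 e2)
    (continuousOn_const (c := (0 : ℂ)))).add (continuousOn_powDD (q := q) hh hg hpos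
    ((continuousOn_const (c := Complex.I)).mul
      (e1.sub (Complex.continuous_conj.comp_continuousOn e2)))
    (continuousOn_const (c := -(0 : ℂ))))).congr fun z _ => ?_
  exact (powDD_add_powDD q ε h g z 0).symm

omit hh hg hpos in
lemma integrable_rect {v : ℝ × ℝ → ℝ} (hv : ContinuousOn v (Iio 0 ×ˢ univ)) {s₁ s₂ a b : ℝ}
    (hs : s₁ ≤ s₂) (hs₂ : s₂ < 0) (hab : a ≤ b) :
    IntegrableOn v (uIoc s₁ s₂ ×ˢ uIoc a b) := by
  rw [uIoc_of_le hs, uIoc_of_le hab]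
  have : IntegrableOn v (Icc s₁ s₂ ×ˢ Icc a b) := by
    refine (hv.mono ?_).integrableOn_compact (isCompact_Icc.prod isCompact_Icc)
    rintro ⟨x, y⟩ ⟨hx, -⟩
    exact ⟨lt_of_le_of_lt hx.2 hs₂, mem_univ _⟩
  exact this.mono_set (prod_mono Ioc_subset_Icc_self Ioc_subset_Icc_self)

omit hh hg hpos in
/-- Integrating an `s`-derivative over circles and then over `s`. -/
lemma integral_sub_eq_of_hasDerivAt {v v' : ℝ → ℝ → ℝ}
    (hd : ∀ s < 0, ∀ θ, HasDerivAt (fun s => v s θ) (v' s θ) s)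
    (hv : ContinuousOn (fun p : ℝ × ℝ => v p.1 p.2) (Iio 0 ×ˢ univ))
    (hv' : ContinuousOn (fun p : ℝ × ℝ => v' p.1 p.2) (Iio 0 ×ˢ univ)) {s₁ s₂ : ℝ}
    (hs : s₁ ≤ s₂) (hs₂ : s₂ < 0) :
    (∫ θ in (0 : ℝ)..(2 * Real.pi), v s₂ θ) - (∫ θ in (0 : ℝ)..(2 * Real.pi), v s₁ θ) =
      ∫ s in s₁..s₂, ∫ θ in (0 : ℝ)..(2 * Real.pi), v' s θ := by
  have hc : ∀ s < 0, Continuous fun θ => v s θ := fun s hs' =>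
    hv.comp_continuous (f := fun θ : ℝ => (s, θ)) (by fun_prop) (fun θ => ⟨hs', mem_univ _⟩)
  have hc' : ∀ θ, ContinuousOn (fun s => v' s θ) (Iio 0) := fun θ =>
    hv'.comp (f := fun s : ℝ => (s, θ)) (by fun_prop) (fun s hs' => ⟨hs', mem_univ _⟩)
  rw [← intervalIntegral.integral_sub ((hc s₂ hs₂).intervalIntegrable _ _)
    ((hc s₁ (hs.trans_lt hs₂)).intervalIntegrable _ _),
    intervalIntegral_intervalIntegral_swap (F := v')
      (integrable_rect hv' hs hs₂ (by positivity))]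
  refine intervalIntegral.integral_congr fun θ _ => ?_
  refine (intervalIntegral.integral_eq_sub_of_hasDerivAt (fun s hs' => hd s ?_ θ) ?_).symm
  · rw [uIcc_of_le hs] at hs'; exact hs'.2.trans_lt hs₂
  · refine ((hc' θ).mono ?_).intervalIntegrable
    rw [uIcc_of_le hs]; exact fun x hx => hx.2.trans_lt hs₂

lemma powMean_sub {s₁ s₂ : ℝ} (hs : s₁ ≤ s₂) (hs₂ : s₂ < 0) :
    powMean q ε h g s₂ - powMean q ε h g s₁ = ∫ s in s₁..s₂, powMeanD q ε h g s :=
  integral_sub_eq_of_hasDerivAt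
    (v := fun s θ => (‖h (logPolar s θ) + conj (g (logPolar s θ))‖ ^ 2 + ε) ^ q)
    (v' := fun s θ => radialD q ε h g (logPolar s θ))
    (fun _ hs θ => hasDerivAt_norm_sq_add_rpow (hasDerivAt_pair_left hh hg hs θ)
      (hpos _ (logPolar_mem hs θ) (logPolar_ne_zero _ _)))
    (continuousOn_comp_logPolar (continuousOn_norm_sq_add_rpow hh hg hpos q))
    (continuousOn_comp_logPolar (continuousOn_radialD hh hg hpos)) hs hs₂

lemma intervalIntegrable_powMeanD {s₁ s₂ : ℝ} (hs : s₁ ≤ s₂) (hs₂ : s₂ < 0) :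
    IntervalIntegrable (powMeanD q ε h g) volume s₁ s₂ := by
  have := integrable_rect (continuousOn_comp_logPolar
    (continuousOn_radialD (q := q) hh hg hpos)) hs hs₂
    (show (0 : ℝ) ≤ 2 * Real.pi by positivity)
  rw [IntegrableOn, Measure.volume_eq_prod, ← Measure.prod_restrict] at this
  replace this := this.integral_prod_left
  rw [intervalIntegrable_iff]
  refine this.congr (Eventually.of_forall fun s => ?_)
  simp only [powMeanD]
  rw [intervalIntegral.integral_of_le (by positivity), uIoc_of_le (by positivity)]

/-- Green's formula for `(|f|² + ε)^q` in an annulus. -/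
lemma powMeanD_sub {s₁ s₂ : ℝ} (hs : s₁ ≤ s₂) (hs₂ : s₂ < 0) :
    powMeanD q ε h g s₂ - powMeanD q ε h g s₁ =
      ∫ s in s₁..s₂, ∫ θ in (0 : ℝ)..(2 * Real.pi), powLap q ε h g (logPolar s θ) := by
  have eh := differentiableOn_euler hh
  have eg := differentiableOn_euler hg
  have eeh := (differentiableOn_euler eh).continuousOn
  have eeg := (differentiableOn_euler eg).continuousOn
  set E : ℂ → ℂ := fun z => euler (euler h) z + conj (euler (euler g) z) with hE
  have hEc : ContinuousOn E unitDisk := continuousOn_pair eeh eeg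
  have hEn : ContinuousOn (fun z => -E z) unitDisk := hEc.neg
  set B : ℂ → ℂ := fun z => Complex.I * (euler h z - conj (euler g z)) with hB
  have hBc : ContinuousOn B unitDisk := continuousOn_const.mul
    (eh.continuousOn.sub (Complex.continuous_conj.comp_continuousOn eg.continuousOn))
  have h1 := integral_sub_eq_of_hasDerivAt
    (v := fun s θ => radialD q ε h g (logPolar s θ))
    (v' := fun s θ => powDD q ε (h (logPolar s θ) + conj (g (logPolar s θ)))
      (euler h (logPolar s θ) + conj (euler g (logPolar s θ))) (E (logPolar s θ)))
    (fun s hs θ => hasDerivAt_powD (hasDerivAt_pair_left hh hg hs θ)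
      (hasDerivAt_pair_left eh eg hs θ) (hpos _ (logPolar_mem hs θ) (logPolar_ne_zero _ _)))
    (continuousOn_comp_logPolar (continuousOn_radialD hh hg hpos))
    (continuousOn_comp_logPolar (continuousOn_powDD hh hg hpos
      (continuousOn_pair eh.continuousOn eg.continuousOn) hEc)) hs hs₂
  rw [powMeanD, powMeanD, h1]
  refine intervalIntegral.integral_congr fun s hs' => ?_
  rw [uIcc_of_le hs] at hs'
  have hs0 : s < 0 := hs'.2.trans_lt hs₂
  -- The angular second derivative has mean zero over the circle.
  have hB' : ∀ θ, HasDerivAt (fun θ => B (logPolar s θ)) (-E (logPolar s θ)) θ := by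
    intro θ
    have h2 := hasDerivAt_pair_right (eh.const_mul Complex.I) (eg.const_mul Complex.I) hs0 θ
    have h3 : (fun θ => B (logPolar s θ)) = fun θ => Complex.I * euler h (logPolar s θ) +
        conj (Complex.I * euler g (logPolar s θ)) := by
      funext θ; simp [hB]; ring
    rw [h3]
    refine h2.congr_deriv ?_
    have hn := isOpen_unitDisk.mem_nhds (logPolar_mem hs0 θ)
    have h4 : ∀ v : ℂ → ℂ, DifferentiableOn ℂ v unitDisk →
        euler (fun z => Complex.I * v z) (logPolar s θ) = Complex.I * euler v (logPolar s θ) := by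
      intro v hv
      simp only [euler]
      rw [deriv_const_mul _ (hv.differentiableAt hn)]; ring
    rw [h4 _ eh, h4 _ eg, hE]
    simp only [map_mul, Complex.conj_I]
    linear_combination (euler (euler h) (logPolar s θ) +
      conj (euler (euler g) (logPolar s θ))) * Complex.I_mul_I
  have h0 : ∫ θ in (0 : ℝ)..(2 * Real.pi), powDD q ε
      (h (logPolar s θ) + conj (g (logPolar s θ))) (B (logPolar s θ)) (-E (logPolar s θ)) = 0 := by
    rw [intervalIntegral.integral_eq_sub_of_hasDerivAt
      (f := fun θ => powD q ε (h (logPolar s θ) + conj (g (logPolar s θ))) (B (logPolar s θ)))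
      (fun θ _ => hasDerivAt_powD (hasDerivAt_pair_right hh hg hs0 θ) (hB' θ)
        (hpos _ (logPolar_mem hs0 θ) (logPolar_ne_zero _ _)))
      ((continuous_circle (continuousOn_powDD hh hg hpos hBc hEn) hs0).intervalIntegrable _ _)]
    simp only [logPolar_two_pi, sub_self]
  have h5 := intervalIntegral.integral_add (μ := volume)
    ((continuous_circle (continuousOn_powDD (q := q) hh hg hpos
      (continuousOn_pair eh.continuousOn eg.continuousOn) hEc) hs0).intervalIntegrable
      0 (2 * Real.pi))
    ((continuous_circle (continuousOn_powDD (q := q) hh hg hpos hBc hEn) hs0).intervalIntegrable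
      0 (2 * Real.pi))
  rw [h0, add_zero] at h5
  exact h5.symm.trans (intervalIntegral.integral_congr
    fun θ _ => powDD_add_powDD q ε h g (logPolar s θ) _)

end Green

/-! ### Areas of images of annuli -/

/-- The closed annulus `a ≤ |w| ≤ b`. -/
def closedAnnulus (a b : ℝ) : Set ℂ := {w | a ≤ ‖w‖ ∧ ‖w‖ ≤ b}

lemma isCompact_closedAnnulus (a b : ℝ) : IsCompact (closedAnnulus a b) := by
  refine (isCompact_closedBall (0 : ℂ) b).of_isClosed_subset ?_ fun w hw => by simpa using hw.2
  exact (isClosed_le continuous_const continuous_norm).inter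
    (isClosed_le continuous_norm continuous_const)

lemma integral_closedAnnulus {q ε a b : ℝ} (hq : q ≠ 0) (ha : 0 ≤ a) (hab : a ≤ b)
    (hpos : 0 < a ^ 2 + ε) :
    ∫ w in closedAnnulus a b, (‖w‖ ^ 2 + ε) ^ (q - 1) =
      Real.pi / q * ((b ^ 2 + ε) ^ q - (a ^ 2 + ε) ^ q) := by
  have hpos' : ∀ x, a ≤ x → 0 < x ^ 2 + ε := fun x hx => by nlinarith
  rw [← integral_indicator (isCompact_closedAnnulus a b).measurableSet,
    ← Complex.integral_comp_polarCoord_symm, polarCoord_target]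
  have h1 : ∀ p ∈ Ioi (0 : ℝ) ×ˢ Ioo (-Real.pi) Real.pi,
      p.1 • (closedAnnulus a b).indicator (fun w : ℂ => (‖w‖ ^ 2 + ε) ^ (q - 1))
        (Complex.polarCoord.symm p) =
      (Icc a b).indicator (fun r => r * (r ^ 2 + ε) ^ (q - 1)) p.1 * (fun _ : ℝ => (1 : ℝ)) p.2 := by
    intro p hp
    have hn : ‖Complex.polarCoord.symm p‖ = p.1 := by
      rw [Complex.norm_polarCoord_symm, abs_of_pos hp.1]
    simp only [indicator, closedAnnulus, mem_ofPred_eq, mem_Icc, hn]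
    split_ifs <;> simp
  rw [setIntegral_congr_fun (measurableSet_Ioi.prod measurableSet_Ioo) h1,
    Measure.volume_eq_prod, setIntegral_prod_mul
      ((Icc a b).indicator fun r => r * (r ^ 2 + ε) ^ (q - 1)) (fun _ : ℝ => (1 : ℝ)), setIntegral_indicator measurableSet_Icc]
  have h2 : ∫ r in Ioi (0 : ℝ) ∩ Icc a b, r * (r ^ 2 + ε) ^ (q - 1) =
      ∫ r in a..b, r * (r ^ 2 + ε) ^ (q - 1) := by
    rw [intervalIntegral.integral_of_le hab]
    refine setIntegral_congr_set ?_
    have h3 : Ioc a b ⊆ Ioi (0 : ℝ) ∩ Icc a b := fun x hx =>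
      ⟨lt_of_le_of_lt ha hx.1, hx.1.le, hx.2⟩
    have h4 : Ioi (0 : ℝ) ∩ Icc a b ⊆ Icc a b := inter_subset_right
    exact (Filter.EventuallyLE.antisymm (h4.eventuallyLE.trans Ioc_ae_eq_Icc.symm.le)
      h3.eventuallyLE)
  have h5 : ∫ r in a..b, r * (r ^ 2 + ε) ^ (q - 1) =
      (b ^ 2 + ε) ^ q / (2 * q) - (a ^ 2 + ε) ^ q / (2 * q) := by
    refine intervalIntegral.integral_eq_sub_of_hasDerivAt
      (f := fun r => (r ^ 2 + ε) ^ q / (2 * q)) (fun r hr => ?_) ?_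
    · rw [uIcc_of_le hab] at hr
      have := ((((hasDerivAt_pow 2 r).add_const ε).rpow_const (p := q)
        (Or.inl (hpos' r hr.1).ne')).div_const (2 * q))
      refine this.congr_deriv ?_
      field_simp
      push_cast
      ring
    · refine ContinuousOn.intervalIntegrable ?_
      rw [uIcc_of_le hab]
      exact continuousOn_id.mul (((continuousOn_id.pow 2).add continuousOn_const).rpow_const
        fun x hx => Or.inl (hpos' x hx.1).ne')
  rw [h2, h5]
  simp only [integral_const, smul_eq_mul, mul_one, measureReal_restrict_apply_univ,
    Real.volume_real_Ioo_of_le (by linarith [Real.pi_pos] : -Real.pi ≤ Real.pi)]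
  field_simp
  ring

section Area

variable {h g : ℂ → ℂ} {q ε : ℝ} (hh : DifferentiableOn ℂ h unitDisk)
  (hg : DifferentiableOn ℂ g unitDisk)
  (hpos : ∀ z ∈ unitDisk, z ≠ 0 → 0 < ‖h z + conj (g z)‖ ^ 2 + ε)
  (hle : ∀ z ∈ unitDisk, ‖deriv g z‖ ≤ ‖deriv h z‖)
  (hinj : InjOn (fun z => h z + conj (g z)) unitDisk)

lemma hasFDerivAt_comp_exp (hh : DifferentiableOn ℂ h unitDisk)
    (hg : DifferentiableOn ℂ g unitDisk) {w : ℂ} (hw : w.re < 0) :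
    HasFDerivAt (fun w => h (Complex.exp w) + conj (g (Complex.exp w)))
      (wirtingerCLM (euler h (Complex.exp w)) (euler g (Complex.exp w))) w := by
  have hm : Complex.exp w ∈ unitDisk := by
    rw [mem_unitDisk, Complex.norm_exp]; simpa using hw
  have hn := isOpen_unitDisk.mem_nhds hm
  have h1 := (hh.differentiableAt hn).hasDerivAt.comp w (Complex.hasDerivAt_exp w)
  have h2 := (hg.differentiableAt hn).hasDerivAt.comp w (Complex.hasDerivAt_exp w)
  rw [mul_comm] at h1 h2
  exact hasFDerivAt_add_conj h1 h2

include hh hg hpos hle hinj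

/-- The weighted area of the image of an annulus under an injective map is at most that of any
annulus containing the image. -/
lemma integral_jacobian_le {s₁ s₂ a b : ℝ} (hs : s₁ ≤ s₂) (hs₂ : s₂ < 0) (hq : q ≠ 0)
    (ha : 0 ≤ a) (hab : a ≤ b) (haε : 0 < a ^ 2 + ε)
    (hmaps : ∀ s ∈ Ioo s₁ s₂, ∀ θ,
      h (logPolar s θ) + conj (g (logPolar s θ)) ∈ closedAnnulus a b) :
    ∫ s in s₁..s₂, ∫ θ in (0 : ℝ)..(2 * Real.pi),
      (‖h (logPolar s θ) + conj (g (logPolar s θ))‖ ^ 2 + ε) ^ (q - 1) *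
        (‖euler h (logPolar s θ)‖ ^ 2 - ‖euler g (logPolar s θ)‖ ^ 2) ≤
      Real.pi / q * ((b ^ 2 + ε) ^ q - (a ^ 2 + ε) ^ q) := by
  set v : ℂ → ℝ := fun z => (‖h z + conj (g z)‖ ^ 2 + ε) ^ (q - 1) *
    (‖euler h z‖ ^ 2 - ‖euler g z‖ ^ 2) with hv
  have hvc : ContinuousOn v (unitDisk \ {0}) :=
    (continuousOn_norm_sq_add_rpow hh hg hpos (q - 1)).mul
      (((((differentiableOn_euler hh).continuousOn).mono sdiff_subset).norm.pow 2).sub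
        ((((differentiableOn_euler hg).continuousOn).mono sdiff_subset).norm.pow 2))
  have hint := integrable_rect (continuousOn_comp_logPolar hvc) hs hs₂
    (show (0 : ℝ) ≤ 2 * Real.pi by positivity)
  set Q : Set (ℝ × ℝ) := Ioo s₁ s₂ ×ˢ Ioo 0 (2 * Real.pi) with hQ
  -- Rewrite the iterated integral as an integral over a rectangle in the `w`-plane.
  have e1 : ∫ s in s₁..s₂, ∫ θ in (0 : ℝ)..(2 * Real.pi), v (logPolar s θ) =
      ∫ p in Q, v (logPolar p.1 p.2) := by
    rw [uIoc_of_le hs, uIoc_of_le (by positivity)] at hint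
    rw [intervalIntegral.integral_of_le hs, hQ]
    simp_rw [intervalIntegral.integral_of_le (show (0 : ℝ) ≤ 2 * Real.pi by positivity)]
    rw [← setIntegral_prod (fun p : ℝ × ℝ => v (logPolar p.1 p.2)) hint,
      ← Measure.volume_eq_prod]
    exact setIntegral_congr_set
      (Measure.set_prod_ae_eq Ioo_ae_eq_Ioc Ioo_ae_eq_Ioc).symm
  set S : Set ℂ := Complex.measurableEquivRealProd ⁻¹' Q with hS
  have hSm : MeasurableSet S :=
    Complex.measurableEquivRealProd.measurable (measurableSet_Ioo.prod measurableSet_Ioo)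
  have hSmem : ∀ w, w ∈ S ↔ w.re ∈ Ioo s₁ s₂ ∧ w.im ∈ Ioo 0 (2 * Real.pi) := fun w => by
    simp [hS, hQ, Complex.measurableEquivRealProd_apply]
  have hlp : ∀ w : ℂ, logPolar w.re w.im = Complex.exp w := fun w => by
    rw [logPolar, Complex.re_add_im]
  have e2 : ∫ p in Q, v (logPolar p.1 p.2) = ∫ w in S, v (Complex.exp w) := by
    rw [← Complex.volume_preserving_equiv_real_prod.setIntegral_preimage_emb
      Complex.measurableEquivRealProd.measurableEmbedding]
    simp only [Complex.measurableEquivRealProd_apply, hlp]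
    rfl
  set F : ℂ → ℂ := fun w => h (Complex.exp w) + conj (g (Complex.exp w)) with hF
  have hSneg : ∀ w ∈ S, w.re < 0 := fun w hw => (((hSmem w).1 hw).1.2).trans hs₂
  have hFd : ∀ w ∈ S, HasFDerivWithinAt F
      (wirtingerCLM (euler h (Complex.exp w)) (euler g (Complex.exp w))) S w := fun w hw =>
    (hasFDerivAt_comp_exp hh hg (hSneg w hw)).hasFDerivWithinAt
  have hFinj : InjOn F S := by
    intro w hw w' hw' heq
    have hm : ∀ w ∈ S, Complex.exp w ∈ unitDisk := fun w hw => by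
      rw [← hlp]; exact logPolar_mem (hSneg w hw) _
    obtain ⟨n, hn⟩ := Complex.exp_eq_exp_iff_exists_int.1 (hinj (hm w hw) (hm w' hw') heq)
    have h1 := ((hSmem w).1 hw).2
    have h2 := ((hSmem w').1 hw').2
    have him : w.im = w'.im + n * (2 * Real.pi) := by
      rw [hn]; simp
    have hpi := Real.pi_pos
    have hn0 : n = 0 := by
      have h3 : (n : ℝ) * (2 * Real.pi) < 1 * (2 * Real.pi) := by linarith [h1.2, h2.1]
      have h4 : (-1 : ℝ) * (2 * Real.pi) < n * (2 * Real.pi) := by linarith [h1.1, h2.2]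
      have h5 := lt_of_mul_lt_mul_right h3 (by positivity)
      have h6 := lt_of_mul_lt_mul_right h4 (by positivity)
      have h7 : n < 1 := by exact_mod_cast h5
      have h8 : -1 < n := by exact_mod_cast h6
      omega
    rw [hn, hn0]; simp
  have e3 : ∫ w in S, v (Complex.exp w) = ∫ x in F '' S, (‖x‖ ^ 2 + ε) ^ (q - 1) := by
    rw [integral_image_eq_integral_abs_det_fderiv_smul volume hSm hFd hFinj]
    refine setIntegral_congr_fun hSm fun w hw => ?_
    have hm : Complex.exp w ∈ unitDisk := by
      rw [← hlp]; exact logPolar_mem (hSneg w hw) _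
    have h1 : ‖euler g (Complex.exp w)‖ ≤ ‖euler h (Complex.exp w)‖ := by
      simp only [euler, norm_mul]
      exact mul_le_mul_of_nonneg_left (hle _ hm) (norm_nonneg _)
    have h2 : 0 ≤ ‖euler h (Complex.exp w)‖ ^ 2 - ‖euler g (Complex.exp w)‖ ^ 2 := by
      nlinarith [norm_nonneg (euler g (Complex.exp w))]
    simp only [det_wirtingerCLM, abs_of_nonneg h2, smul_eq_mul, hv, hF]
    ring
  have hsub : F '' S ⊆ closedAnnulus a b := by
    rintro _ ⟨w, hw, rfl⟩
    have := hmaps w.re ((hSmem w).1 hw).1 w.im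
    rwa [hlp] at this
  have hpos' : ∀ x ∈ closedAnnulus a b, 0 < ‖x‖ ^ 2 + ε := fun x hx => by
    have := hx.1; nlinarith
  have e4 : ∫ x in F '' S, (‖x‖ ^ 2 + ε) ^ (q - 1) ≤
      ∫ x in closedAnnulus a b, (‖x‖ ^ 2 + ε) ^ (q - 1) := by
    refine setIntegral_mono_set ?_ ?_ hsub.eventuallyLE
    · refine ContinuousOn.integrableOn_compact (isCompact_closedAnnulus a b) ?_
      exact ((continuous_norm.continuousOn.pow 2).add continuousOn_const).rpow_const
        fun x hx => Or.inl (hpos' x hx).ne'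
    · refine (ae_restrict_iff' (isCompact_closedAnnulus a b).measurableSet).2
        (Eventually.of_forall fun x hx => ?_)
      exact (Real.rpow_pos_of_pos (hpos' x hx) _).le
  calc _ = ∫ s in s₁..s₂, ∫ θ in (0 : ℝ)..(2 * Real.pi), v (logPolar s θ) := rfl
    _ ≤ _ := by
      rw [e1, e2, e3]
      exact e4.trans_eq (integral_closedAnnulus hq ha hab haε)

end Area

/-! ### Integral means -/

/-- Bounded dilatation makes the Laplacian of `(|f|² + ε)^q` comparable with
`(|f|² + ε)^{q-1}` times the Jacobian. -/
lemma powLap_le {q ε k : ℝ} {h g : ℂ → ℂ} {z : ℂ} (hq : 0 < q) (hε : 0 < ε) (hk : k < 1)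
    (hk0 : 0 ≤ k) (hle : ‖deriv g z‖ ≤ k * ‖deriv h z‖) :
    powLap q ε h g z ≤ (8 * q * |q - 1| + 4 * q) * (2 / (1 - k ^ 2)) *
      ((‖h z + conj (g z)‖ ^ 2 + ε) ^ (q - 1) * (‖euler h z‖ ^ 2 - ‖euler g z‖ ^ 2)) := by
  set F := h z + conj (g z) with hF
  set a := euler h z with ha
  set b := euler g z with hb
  have hab : ‖b‖ ≤ k * ‖a‖ := by
    rw [ha, hb, euler, euler, norm_mul, norm_mul]
    nlinarith [norm_nonneg z, mul_le_mul_of_nonneg_left hle (norm_nonneg z)]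
  have hupos : 0 < ‖F‖ ^ 2 + ε := by positivity
  set u := ‖F‖ ^ 2 + ε with hu
  have hN : ‖a‖ ^ 2 + ‖b‖ ^ 2 ≤ 2 / (1 - k ^ 2) * (‖a‖ ^ 2 - ‖b‖ ^ 2) := by
    have hk2 : 0 < 1 - k ^ 2 := by nlinarith
    rw [div_mul_eq_mul_div, le_div_iff₀ hk2]
    have h1 : ‖b‖ ^ 2 ≤ k ^ 2 * ‖a‖ ^ 2 := by
      rw [← mul_pow]; exact pow_le_pow_left₀ (norm_nonneg _) hab 2
    have h2 : 0 ≤ k ^ 2 := sq_nonneg k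
    have h3 : 0 ≤ (3 - k ^ 2) * (k ^ 2 * ‖a‖ ^ 2 - ‖b‖ ^ 2) :=
      mul_nonneg (by linarith) (by linarith)
    have h4 : 0 ≤ ‖a‖ ^ 2 * (1 - k ^ 2) ^ 2 := by positivity
    linarith
  have hX : inner ℝ F (a + conj b) ^ 2 + inner ℝ F (Complex.I * (a - conj b)) ^ 2 ≤
      2 * u * (‖a‖ ^ 2 + ‖b‖ ^ 2) := by
    have h1 := abs_real_inner_le_norm F (a + conj b)
    have h2 := abs_real_inner_le_norm F (Complex.I * (a - conj b))
    rw [norm_mul, Complex.norm_I, one_mul] at h2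
    have h3 := sq_le_sq' (neg_le_of_abs_le h1) (le_of_abs_le h1)
    have h4 := sq_le_sq' (neg_le_of_abs_le h2) (le_of_abs_le h2)
    have h5 := parallelogram_law_with_norm ℝ a (conj b)
    rw [RCLike.norm_conj] at h5
    have h6 : ‖F‖ ^ 2 ≤ u := by rw [hu]; linarith
    have h7 : ‖F‖ ^ 2 * (‖a‖ ^ 2 + ‖b‖ ^ 2) ≤ u * (‖a‖ ^ 2 + ‖b‖ ^ 2) := by gcongr
    rw [mul_pow] at h3 h4
    nlinarith
  have hX0 : 0 ≤ inner ℝ F (a + conj b) ^ 2 + inner ℝ F (Complex.I * (a - conj b)) ^ 2 := by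
    positivity
  have hpow : u ^ (q - 2) * u = u ^ (q - 1) := by
    rw [← Real.rpow_add_one hupos.ne']; congr 1; ring
  have hu1 : 0 < u ^ (q - 1) := Real.rpow_pos_of_pos hupos _
  have hu2 : 0 < u ^ (q - 2) := Real.rpow_pos_of_pos hupos _
  calc powLap q ε h g z
      = q * (q - 1) * u ^ (q - 2) *
        (4 * (inner ℝ F (a + conj b) ^ 2 + inner ℝ F (Complex.I * (a - conj b)) ^ 2)) +
        4 * q * u ^ (q - 1) * (‖a‖ ^ 2 + ‖b‖ ^ 2) := rfl
    _ ≤ q * |q - 1| * u ^ (q - 2) * (4 * (2 * u * (‖a‖ ^ 2 + ‖b‖ ^ 2))) +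
        4 * q * u ^ (q - 1) * (‖a‖ ^ 2 + ‖b‖ ^ 2) := by
        gcongr
        exact le_abs_self _
    _ = (8 * q * |q - 1| + 4 * q) * u ^ (q - 1) * (‖a‖ ^ 2 + ‖b‖ ^ 2) := by
        rw [← hpow]; ring
    _ ≤ (8 * q * |q - 1| + 4 * q) * u ^ (q - 1) *
        (2 / (1 - k ^ 2) * (‖a‖ ^ 2 - ‖b‖ ^ 2)) := by gcongr
    _ = _ := by ring

lemma integral_circle_le {v : ℝ → ℝ} {C : ℝ} (hC : ∀ θ, v θ ≤ C) (hv : Continuous v) :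
    ∫ θ in (0 : ℝ)..(2 * Real.pi), v θ ≤ 2 * Real.pi * C := by
  have := intervalIntegral.integral_mono (μ := volume) (by positivity : (0 : ℝ) ≤ 2 * Real.pi)
    (hv.intervalIntegrable _ _) (continuous_const.intervalIntegrable _ _) hC
  simpa using this

section Prawitz

variable {K : ℝ} (hK : 1 ≤ K) {f h g : ℂ → ℂ} (hf : f ∈ SHK K)
  (hd : IsNormalizedDecomposition f h g)
include hK hf hd

lemma norm_pair_logPolar_le {s : ℝ} (hs : s < 0) (θ : ℝ) :
    ‖h (logPolar s θ) + conj (g (logPolar s θ))‖ ≤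
      2 ^ gammaStar K * (1 - Real.exp s) ^ (-gammaStar K) := by
  have := norm_le_of_mem_SHK hK hf hd (logPolar_mem hs θ)
  rwa [norm_logPolar, hd.eq_add_conj _ (logPolar_mem hs θ)] at this

/-- Green's formula together with the area estimate for the disk containing the image. -/
lemma powMeanD_sub_le {q : ℝ} (hq : 0 < q) {s₁ s₂ : ℝ} (hs : s₁ ≤ s₂) (hs₂ : s₂ < 0) :
    powMeanD q 1 h g s₂ - powMeanD q 1 h g s₁ ≤
      (8 * q * |q - 1| + 4 * q) * (2 / (1 - dilBound K ^ 2)) * (Real.pi / q) *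
        ((2 ^ gammaStar K * (1 - Real.exp s₂) ^ (-gammaStar K)) ^ 2 + 1) ^ q := by
  have hqc := QCPair.of_mem_SHK hK hf hd
  have hpos : ∀ z ∈ unitDisk, z ≠ 0 → 0 < ‖h z + conj (g z)‖ ^ 2 + 1 :=
    fun z _ _ => by positivity
  have hk0 := dilBound_nonneg hK
  have hk1 := dilBound_lt_one hK
  have hγ := two_le_gammaStar hK
  set γ := gammaStar K with hγdef
  set C₀ := (8 * q * |q - 1| + 4 * q) * (2 / (1 - dilBound K ^ 2)) with hC₀
  have hC₀0 : 0 ≤ C₀ := by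
    have : 0 < 1 - dilBound K ^ 2 := by nlinarith
    positivity
  have hexp : ∀ s < 0, 0 < 1 - Real.exp s := fun s hs => by
    have : Real.exp s < 1 := by simpa using hs
    linarith
  have hM0 : 0 < 2 ^ γ * (1 - Real.exp s₂) ^ (-γ) :=
    mul_pos (by positivity) (Real.rpow_pos_of_pos (hexp _ hs₂) _)
  set M := 2 ^ γ * (1 - Real.exp s₂) ^ (-γ) with hM
  set v : ℂ → ℝ := fun z => (‖h z + conj (g z)‖ ^ 2 + 1) ^ (q - 1) *
    (‖euler h z‖ ^ 2 - ‖euler g z‖ ^ 2) with hv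
  have hvc : ContinuousOn v (unitDisk \ {0}) :=
    (continuousOn_norm_sq_add_rpow hd.analytic_h hd.analytic_g hpos (q - 1)).mul
      (((((differentiableOn_euler hd.analytic_h).continuousOn).mono sdiff_subset).norm.pow 2).sub
        ((((differentiableOn_euler hd.analytic_g).continuousOn).mono sdiff_subset).norm.pow 2))
  have hLc := continuousOn_powLap (q := q) hd.analytic_h hd.analytic_g hpos
  have hint : ∀ v : ℂ → ℝ, ContinuousOn v (unitDisk \ {0}) → IntervalIntegrable
      (fun s => ∫ θ in (0 : ℝ)..(2 * Real.pi), v (logPolar s θ)) volume s₁ s₂ := by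
    intro v hvc
    have := integrable_rect (continuousOn_comp_logPolar hvc) hs hs₂
      (show (0 : ℝ) ≤ 2 * Real.pi by positivity)
    rw [IntegrableOn, Measure.volume_eq_prod, ← Measure.prod_restrict] at this
    replace this := this.integral_prod_left
    rw [intervalIntegrable_iff]
    refine this.congr (Eventually.of_forall fun s => ?_)
    simp only
    rw [intervalIntegral.integral_of_le (by positivity), uIoc_of_le (by positivity)]
  have h1 : ∫ s in s₁..s₂, ∫ θ in (0 : ℝ)..(2 * Real.pi), powLap q 1 h g (logPolar s θ) ≤
      ∫ s in s₁..s₂, C₀ * ∫ θ in (0 : ℝ)..(2 * Real.pi), v (logPolar s θ) := by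
    refine intervalIntegral.integral_mono_on hs (hint _ hLc) ((hint _ hvc).const_mul C₀)
      fun s hs' => ?_
    have hs0 : s < 0 := hs'.2.trans_lt hs₂
    rw [← intervalIntegral.integral_const_mul]
    refine intervalIntegral.integral_mono (by positivity)
      ((continuous_circle hLc hs0).intervalIntegrable _ _)
      (((continuous_circle hvc hs0).const_mul C₀).intervalIntegrable _ _) fun θ => ?_
    exact powLap_le hq one_pos hk1 hk0 (hqc.deriv_le _ (logPolar_mem hs0 θ))
  have h2 : ∫ s in s₁..s₂, ∫ θ in (0 : ℝ)..(2 * Real.pi), v (logPolar s θ) ≤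
      Real.pi / q * ((M ^ 2 + 1) ^ q - (0 ^ 2 + 1) ^ q) := by
    refine integral_jacobian_le hd.analytic_h hd.analytic_g hpos
      (fun z hz => norm_deriv_conj_part_le hK hf hd hz) hqc.inj hs hs₂ hq.ne' le_rfl hM0.le
      (by norm_num) fun s hs' θ => ⟨norm_nonneg _, ?_⟩
    refine (norm_pair_logPolar_le hK hf hd (hs'.2.trans hs₂) θ).trans ?_
    refine mul_le_mul_of_nonneg_left ?_ (by positivity)
    refine Real.rpow_le_rpow_of_nonpos (hexp _ hs₂) ?_ (by linarith)
    have := Real.exp_le_exp.2 hs'.2.le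
    linarith
  rw [powMeanD_sub hd.analytic_h hd.analytic_g hpos hs hs₂]
  refine h1.trans ?_
  rw [intervalIntegral.integral_const_mul]
  refine (mul_le_mul_of_nonneg_left h2 hC₀0).trans ?_
  rw [mul_assoc C₀]
  refine mul_le_mul_of_nonneg_left ?_ hC₀0
  refine mul_le_mul_of_nonneg_left ?_ (by positivity)
  simp

end Prawitz

lemma one_sub_exp_neg_log_two : 1 - Real.exp (-Real.log 2) = 1 / 2 := by
  rw [Real.exp_neg, Real.exp_log (by norm_num)]; norm_num

set_option maxHeartbeats 1000000 in
/-- Growth of the means of `(|f|² + 1)^{p/2}`, uniformly over the class. The base circle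
`|z| = 1/2`, where everything is bounded, supplies the constants of integration. -/
lemma exists_powMean_le {K : ℝ} (hK : 1 ≤ K) {p : ℝ} (hp : 0 < p)
    (hγp : 1 < gammaStar K * p) :
    ∃ C : ℝ, 0 ≤ C ∧ ∀ f h g : ℂ → ℂ, f ∈ SHK K → IsNormalizedDecomposition f h g →
      ∀ s ∈ Ico (-Real.log 2) 0,
        powMean (p / 2) 1 h g s ≤ C * (1 - Real.exp s) ^ (1 - gammaStar K * p) := by
  have hγ := two_le_gammaStar hK
  set γ := gammaStar K with hγdef
  have hk0 := dilBound_nonneg hK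
  have hk1 := dilBound_lt_one hK
  set q := p / 2 with hq
  have hq0 : 0 < q := by positivity
  set s₀ : ℝ := -Real.log 2 with hs₀
  have hs₀0 : s₀ < 0 := by rw [hs₀]; have := Real.log_pos (by norm_num : (1 : ℝ) < 2); linarith
  have hes₀ : 1 - Real.exp s₀ = 1 / 2 := one_sub_exp_neg_log_two
  set m : ℝ := 2 ^ γ * (1 / 2 : ℝ) ^ (-γ) with hm
  set m' : ℝ := 2 ^ γ * (1 / 2 : ℝ) ^ (-γ - 1) with hm'
  set C₁ : ℝ := 2 * Real.pi * (q * (m ^ 2 + 1) ^ q * (2 * (m * (2 * m')))) with hC₁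
  set C₀ : ℝ := (8 * q * |q - 1| + 4 * q) * (2 / (1 - dilBound K ^ 2)) * (Real.pi / q) with hC₀
  have hC₀0 : 0 ≤ C₀ := by
    have : 0 < 1 - dilBound K ^ 2 := by nlinarith
    positivity
  have hC₁0 : 0 ≤ C₁ := by positivity
  set C₂ : ℝ := C₁ + C₀ * (2 ^ q * 2 ^ (γ * p)) with hC₂
  have hC₂0 : 0 ≤ C₂ := by positivity
  set C₃ : ℝ := 2 * Real.pi * (m ^ 2 + 1) ^ q with hC₃
  have hC₃0 : 0 ≤ C₃ := by positivity
  have hγp1 : 0 < γ * p - 1 := by linarith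
  refine ⟨C₃ + 2 * C₂ / (γ * p - 1), by positivity, ?_⟩
  intro f h g hf hd s hs
  have hpos : ∀ z ∈ unitDisk, z ≠ 0 → 0 < ‖h z + conj (g z)‖ ^ 2 + 1 :=
    fun z _ _ => by positivity
  have hexp : ∀ s < 0, 0 < 1 - Real.exp s := fun s hs => by
    have : Real.exp s < 1 := by simpa using hs
    linarith
  have hFm : ∀ θ, ‖h (logPolar s₀ θ) + conj (g (logPolar s₀ θ))‖ ≤ m := fun θ => by
    have := norm_pair_logPolar_le hK hf hd hs₀0 θ
    rwa [hes₀] at this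
  have hum : ∀ θ, (‖h (logPolar s₀ θ) + conj (g (logPolar s₀ θ))‖ ^ 2 + 1) ^ q ≤
      (m ^ 2 + 1) ^ q := fun θ => by
    have := hFm θ
    gcongr
  have hstart : powMean q 1 h g s₀ ≤ C₃ :=
    integral_circle_le hum (continuous_circle
      (continuousOn_norm_sq_add_rpow hd.analytic_h hd.analytic_g hpos q) hs₀0)
  have hstartD : powMeanD q 1 h g s₀ ≤ C₁ := by
    refine integral_circle_le (fun θ => ?_) (continuous_circle
      (continuousOn_radialD hd.analytic_h hd.analytic_g hpos) hs₀0)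
    have hz := logPolar_mem hs₀0 θ
    have hzn : ‖logPolar s₀ θ‖ = 1 / 2 := by rw [norm_logPolar]; linarith
    have h1 := norm_deriv_le hK hf hd hz
    rw [hzn, ← hγdef, show (1 - 1 / 2 : ℝ) = 1 / 2 by norm_num, ← hm'] at h1
    have h2 := norm_deriv_conj_part_le hK hf hd hz
    have h3 : ‖euler h (logPolar s₀ θ) + conj (euler g (logPolar s₀ θ))‖ ≤ 2 * m' := by
      refine (norm_add_le _ _).trans ?_
      rw [RCLike.norm_conj, euler, euler, norm_mul, norm_mul, hzn]
      have := norm_nonneg (deriv h (logPolar s₀ θ))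
      linarith
    simp only [radialD, powD]
    set x := h (logPolar s₀ θ) + conj (g (logPolar s₀ θ)) with hx
    have hu1 : (‖x‖ ^ 2 + 1) ^ (q - 1) ≤ (m ^ 2 + 1) ^ q :=
      (Real.rpow_le_rpow_of_exponent_le (by nlinarith [sq_nonneg ‖x‖]) (by linarith)).trans
        (hum θ)
    have h4 := (real_inner_le_norm x
      (euler h (logPolar s₀ θ) + conj (euler g (logPolar s₀ θ)))).trans
      (mul_le_mul (hFm θ) h3 (norm_nonneg _) (by positivity))
    calc _ ≤ q * (‖x‖ ^ 2 + 1) ^ (q - 1) * (2 * (m * (2 * m'))) := by gcongr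
      _ ≤ _ := by gcongr
  -- The derivative of the mean is controlled by the maximum of `|f|^p`.
  have hDle : ∀ t ∈ Icc s₀ s, powMeanD q 1 h g t ≤
      2 * C₂ * (Real.exp t * (1 - Real.exp t) ^ (-(γ * p))) := by
    intro t ht
    have ht0 : t < 0 := ht.2.trans_lt hs.2
    have het := hexp t ht0
    have h1 := powMeanD_sub_le hK hf hd hq0 ht.1 ht0
    rw [← hγdef, ← hC₀] at h1
    set X := (1 - Real.exp t) ^ (-(γ * p)) with hX
    have hX1 : 1 ≤ X := Real.one_le_rpow_of_pos_of_le_one_of_nonpos het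
      (by linarith [Real.exp_pos t]) (by linarith)
    have hM : 1 ≤ 2 ^ γ * (1 - Real.exp t) ^ (-γ) := by
      have h2 : (1 : ℝ) ≤ 2 ^ γ := Real.one_le_rpow (by norm_num) (by linarith)
      have h3 : 1 ≤ (1 - Real.exp t) ^ (-γ) := Real.one_le_rpow_of_pos_of_le_one_of_nonpos het
        (by linarith [Real.exp_pos t]) (by linarith)
      nlinarith
    have hMp : ((2 ^ γ * (1 - Real.exp t) ^ (-γ)) ^ 2 + 1) ^ q ≤ 2 ^ q * 2 ^ (γ * p) * X := by
      set M := 2 ^ γ * (1 - Real.exp t) ^ (-γ) with hMdef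
      have h4 : (M ^ 2 + 1) ^ q ≤ (2 * M ^ 2) ^ q :=
        Real.rpow_le_rpow (by positivity) (by nlinarith) hq0.le
      refine h4.trans_eq ?_
      have hM0 : 0 ≤ M := by linarith
      rw [Real.mul_rpow (by norm_num) (sq_nonneg M), ← Real.rpow_natCast M 2,
        ← Real.rpow_mul hM0, hMdef, Real.mul_rpow (by positivity) (by positivity),
        ← Real.rpow_mul (by norm_num), ← Real.rpow_mul het.le, hX, mul_assoc]
      congr 3
      · rw [hq]; push_cast; ring_nf
      · rw [hq]; push_cast; ring
    have h5 : powMeanD q 1 h g t ≤ C₂ * X := by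
      have h6 : C₀ * ((2 ^ γ * (1 - Real.exp t) ^ (-γ)) ^ 2 + 1) ^ q ≤
          C₀ * (2 ^ q * 2 ^ (γ * p) * X) := mul_le_mul_of_nonneg_left hMp hC₀0
      have h7 : C₁ * 1 ≤ C₁ * X := by gcongr
      have h8 : C₂ * X = C₁ * X + C₀ * (2 ^ q * 2 ^ (γ * p) * X) := by rw [hC₂]; ring
      linarith
    have h9 : (1 : ℝ) ≤ 2 * Real.exp t := by
      have := Real.exp_le_exp.2 ht.1
      linarith
    have h10 : C₂ * X * 1 ≤ C₂ * X * (2 * Real.exp t) := by gcongr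
    linarith
  have hcont : ContinuousOn (fun t => 2 * C₂ * (Real.exp t * (1 - Real.exp t) ^ (-(γ * p))))
      (Icc s₀ s) := by
    refine continuousOn_const.mul (Real.continuous_exp.continuousOn.mul
      ((continuousOn_const.sub Real.continuous_exp.continuousOn).rpow_const fun t ht =>
        Or.inl (hexp t (ht.2.trans_lt hs.2)).ne'))
  have hI1 : ∫ t in s₀..s, powMeanD q 1 h g t ≤
      ∫ t in s₀..s, 2 * C₂ * (Real.exp t * (1 - Real.exp t) ^ (-(γ * p))) := by
    refine intervalIntegral.integral_mono_on hs.1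
      (intervalIntegrable_powMeanD hd.analytic_h hd.analytic_g hpos hs.1 hs.2) ?_ hDle
    exact ContinuousOn.intervalIntegrable (by rwa [uIcc_of_le hs.1])
  have hI2 : ∫ t in s₀..s, 2 * C₂ * (Real.exp t * (1 - Real.exp t) ^ (-(γ * p))) =
      2 * C₂ / (γ * p - 1) * (1 - Real.exp s) ^ (1 - γ * p) -
        2 * C₂ / (γ * p - 1) * (1 - Real.exp s₀) ^ (1 - γ * p) := by
    refine intervalIntegral.integral_eq_sub_of_hasDerivAt
      (f := fun t => 2 * C₂ / (γ * p - 1) * (1 - Real.exp t) ^ (1 - γ * p)) (fun t ht => ?_) ?_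
    · rw [uIcc_of_le hs.1] at ht
      have het := hexp t (ht.2.trans_lt hs.2)
      have := (((Real.hasDerivAt_exp t).const_sub 1).rpow_const (p := 1 - γ * p)
        (Or.inl het.ne')).const_mul (2 * C₂ / (γ * p - 1))
      refine this.congr_deriv ?_
      rw [show 1 - γ * p - 1 = -(γ * p) by ring]
      field_simp
      ring
    · exact ContinuousOn.intervalIntegrable (by rwa [uIcc_of_le hs.1])
  have hsub := powMean_sub (q := q) hd.analytic_h hd.analytic_g hpos hs.1 hs.2
  have hY0 : 0 ≤ 2 * C₂ / (γ * p - 1) * (1 - Real.exp s₀) ^ (1 - γ * p) := by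
    rw [hes₀]; positivity
  have hY1 : 1 ≤ (1 - Real.exp s) ^ (1 - γ * p) :=
    Real.one_le_rpow_of_pos_of_le_one_of_nonpos (hexp s hs.2) (by linarith [Real.exp_pos s])
      (by linarith)
  have h7 : C₃ * 1 ≤ C₃ * (1 - Real.exp s) ^ (1 - γ * p) := by gcongr
  rw [add_mul]
  linarith

lemma logPolar_log {r : ℝ} (hr : 0 < r) (θ : ℝ) :
    logPolar (Real.log r) θ = r * Complex.exp (θ * Complex.I) := by
  rw [logPolar, Complex.exp_add, ← Complex.ofReal_exp, Real.exp_log hr]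

/-- Growth of the integral means, uniformly over the class. -/
lemma exists_integralMean_le {K : ℝ} (hK : 1 ≤ K) {p : ℝ} (hp : 0 < p)
    (hγp : 1 < gammaStar K * p) :
    ∃ C : ℝ, 0 ≤ C ∧ ∀ f ∈ SHK K, ∀ r ∈ Ico (1 / 2 : ℝ) 1,
      integralMean p f r ≤ C * (1 - r) ^ (-(gammaStar K - 1 / p)) := by
  obtain ⟨C, hC0, hC⟩ := exists_powMean_le hK hp hγp
  refine ⟨(1 / (2 * Real.pi) * C) ^ (1 / p), by positivity, ?_⟩
  intro f hf r hr
  obtain ⟨h, g, hd⟩ := hf.1.1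
  have hr0 : 0 < r := by linarith [hr.1]
  have h1r : 0 < 1 - r := by linarith [hr.2]
  have hpos : ∀ z ∈ unitDisk, z ≠ 0 → 0 < ‖h z + conj (g z)‖ ^ 2 + 1 :=
    fun z _ _ => by positivity
  have hs0 : Real.log r < 0 := Real.log_neg hr0 hr.2
  have hs : Real.log r ∈ Ico (-Real.log 2) 0 := by
    refine ⟨?_, hs0⟩
    rw [← Real.log_inv]
    exact Real.log_le_log (by norm_num) (by linarith [hr.1])
  have h1 := hC f h g hf hd _ hs
  rw [Real.exp_log hr0] at h1
  have hFc := continuous_circle ((continuousOn_pair hd.analytic_h.continuousOn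
    hd.analytic_g.continuousOn).mono (sdiff_subset (t := {(0 : ℂ)}))) hs0
  have h2 : ∫ θ in (0 : ℝ)..(2 * Real.pi), ‖f (r * Complex.exp (θ * Complex.I))‖ ^ p ≤
      powMean (p / 2) 1 h g (Real.log r) := by
    have e : ∀ θ : ℝ, ‖f (r * Complex.exp (θ * Complex.I))‖ =
        ‖h (logPolar (Real.log r) θ) + conj (g (logPolar (Real.log r) θ))‖ := fun θ => by
      rw [← logPolar_log hr0, hd.eq_add_conj _ (logPolar_mem hs0 θ)]
    simp_rw [e]
    refine intervalIntegral.integral_mono (by positivity)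
      ((hFc.norm.rpow_const fun _ => Or.inr hp.le).intervalIntegrable _ _)
      ((continuous_circle (continuousOn_norm_sq_add_rpow hd.analytic_h hd.analytic_g hpos
        (p / 2)) hs0).intervalIntegrable _ _) fun θ => ?_
    simp only
    set x := h (logPolar (Real.log r) θ) + conj (g (logPolar (Real.log r) θ))
    have : ‖x‖ ^ p = (‖x‖ ^ 2) ^ (p / 2) := by
      rw [← Real.rpow_natCast, ← Real.rpow_mul (norm_nonneg _)]; congr 1; push_cast; ring
    rw [this]
    exact Real.rpow_le_rpow (by positivity) (by linarith) (by positivity)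
  have h3 : 0 ≤ ∫ θ in (0 : ℝ)..(2 * Real.pi), ‖f (r * Complex.exp (θ * Complex.I))‖ ^ p :=
    intervalIntegral.integral_nonneg (by positivity) fun θ _ => by positivity
  rw [integralMean]
  calc _ ≤ (1 / (2 * Real.pi) * (C * (1 - r) ^ (1 - gammaStar K * p))) ^ (1 / p) := by
        refine Real.rpow_le_rpow (by positivity) ?_ (by positivity)
        exact mul_le_mul_of_nonneg_left (h2.trans h1) (by positivity)
    _ = _ := by
        rw [← mul_assoc, Real.mul_rpow (by positivity) (by positivity), ← Real.rpow_mul h1r.le]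
        congr 2
        field_simp
        ring

/-! ### Power series on circles -/

/-- `v(z) = ∑ c_m z^m` in the unit disk. -/
def HasExpansion (v : ℂ → ℂ) (c : ℕ → ℂ) : Prop :=
  ∀ z ∈ unitDisk, HasSum (fun m : ℕ => c m * z ^ m) (v z)

lemma exists_hasExpansion {v : ℂ → ℂ} (hv : DifferentiableOn ℂ v unitDisk) :
    ∃ c : ℕ → ℂ, HasExpansion v c ∧ c 0 = v 0 ∧ c 1 = deriv v 0 := by
  refine ⟨fun m => (m.factorial : ℂ)⁻¹ * iteratedDeriv m v 0, fun z hz => ?_, by simp,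
    by simp [iteratedDeriv_one]⟩
  have := Complex.hasSum_taylorSeries_on_ball hv hz
  refine this.congr_fun ?_
  intro m
  simp only [sub_zero, smul_eq_mul]
  ring

lemma logPolar_pow (s θ : ℝ) (m : ℕ) :
    logPolar s θ ^ m = Real.exp (m * s) * Complex.exp (((m : ℤ) : ℂ) * θ * Complex.I) := by
  rw [logPolar, ← Complex.exp_nat_mul, Complex.ofReal_exp, ← Complex.exp_add]
  congr 1
  push_cast
  ring

lemma HasExpansion.summable {v : ℂ → ℂ} {c : ℕ → ℂ} (hc : HasExpansion v c) {s : ℝ}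
    (hs : s < 0) : Summable fun m : ℕ => ‖c m‖ * Real.exp (m * s) := by
  have := (hc _ (logPolar_mem hs 0)).summable.norm
  refine this.congr fun m => ?_
  rw [norm_mul, norm_pow, norm_logPolar, ← Real.exp_nat_mul]

/-- A power series may be integrated term by term over a circle against a continuous weight. -/
lemma HasExpansion.hasSum_integral {v : ℂ → ℂ} {c : ℕ → ℂ} (hc : HasExpansion v c) {s : ℝ}
    (hs : s < 0) {ψ : ℝ → ℂ} (hψ : Continuous ψ) :
    HasSum (fun m : ℕ => c m * Real.exp (m * s) *
        ∫ θ in (0 : ℝ)..(2 * Real.pi), Complex.exp (((m : ℤ) : ℂ) * θ * Complex.I) * ψ θ)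
      (∫ θ in (0 : ℝ)..(2 * Real.pi), v (logPolar s θ) * ψ θ) := by
  obtain ⟨B, hB⟩ := (isCompact_uIcc (a := (0 : ℝ)) (b := 2 * Real.pi)).exists_bound_of_continuousOn
    hψ.continuousOn
  have h1 : ∀ m : ℕ, Continuous fun θ : ℝ => c m * logPolar s θ ^ m * ψ θ := fun m => by
    have := continuous_logPolar.comp (Continuous.prodMk_right (X := ℝ) (Y := ℝ) s)
    exact (continuous_const.mul (this.pow m)).mul hψ
  have h2 := intervalIntegral.hasSum_integral_of_dominated_convergence
    (μ := volume) (a := (0 : ℝ)) (b := 2 * Real.pi)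
    (F := fun (m : ℕ) (θ : ℝ) => c m * logPolar s θ ^ m * ψ θ)
    (f := fun θ => v (logPolar s θ) * ψ θ)
    (fun m _ => ‖c m‖ * Real.exp (m * s) * B)
    (fun m => (h1 m).aestronglyMeasurable) (fun m => Eventually.of_forall fun θ hθ => ?_)
    (Eventually.of_forall fun θ _ => (hc.summable hs).mul_right B)
    (by simp) (Eventually.of_forall fun θ _ => (hc _ (logPolar_mem hs θ)).mul_right _)
  · refine h2.congr_fun ?_
    intro m
    rw [← intervalIntegral.integral_const_mul]
    refine intervalIntegral.integral_congr fun θ _ => ?_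
    simp only [logPolar_pow]
    ring
  · rw [norm_mul, norm_mul, norm_pow, norm_logPolar, ← Real.exp_nat_mul]
    gcongr
    exact hB θ (uIoc_subset_uIcc hθ)

lemma integral_exp_int_mul (j : ℤ) :
    ∫ θ in (0 : ℝ)..(2 * Real.pi), Complex.exp ((j : ℂ) * θ * Complex.I) =
      if j = 0 then (2 * Real.pi : ℂ) else 0 := by
  split_ifs with hj
  · simp [hj]
  · have h1 : (j : ℂ) * Complex.I ≠ 0 := mul_ne_zero (by exact_mod_cast hj) Complex.I_ne_zero
    have h2 := integral_exp_mul_complex (a := 0) (b := 2 * Real.pi) h1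
    have h3 : Complex.exp ((j : ℂ) * Complex.I * ((2 * Real.pi : ℝ) : ℂ)) = 1 := by
      rw [← Complex.exp_int_mul_two_pi_mul_I j]; congr 1; push_cast; ring
    rw [h3] at h2
    simp only [Complex.ofReal_zero, mul_zero, Complex.exp_zero, sub_self, zero_div] at h2
    rw [← h2]
    congr 1 with θ
    congr 1; ring

lemma HasExpansion.integral_mul_exp {v : ℂ → ℂ} {c : ℕ → ℂ} (hc : HasExpansion v c) {s : ℝ}
    (hs : s < 0) (n : ℕ) :
    ∫ θ in (0 : ℝ)..(2 * Real.pi),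
      v (logPolar s θ) * Complex.exp (-((n : ℂ) * θ * Complex.I)) =
      2 * Real.pi * (c n * Real.exp (n * s)) := by
  refine (hc.hasSum_integral hs (ψ := fun θ => Complex.exp (-((n : ℂ) * θ * Complex.I)))
    (by fun_prop)).unique ?_
  have h1 : ∀ m : ℕ, c m * Real.exp (m * s) * ∫ θ in (0 : ℝ)..(2 * Real.pi),
      Complex.exp (((m : ℤ) : ℂ) * θ * Complex.I) * Complex.exp (-((n : ℂ) * θ * Complex.I)) =
      if m = n then 2 * Real.pi * (c n * Real.exp (n * s)) else (0 : ℂ) := by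
    intro m
    have h2 : ∀ θ : ℝ, Complex.exp (((m : ℤ) : ℂ) * θ * Complex.I) *
        Complex.exp (-((n : ℂ) * θ * Complex.I)) =
        Complex.exp ((((m : ℤ) - n : ℤ) : ℂ) * θ * Complex.I) := fun θ => by
      rw [← Complex.exp_add]; congr 1; push_cast; ring
    simp_rw [h2]
    rw [integral_exp_int_mul]
    by_cases hmn : m = n
    · subst hmn; simp; ring
    · rw [if_neg hmn, if_neg (by omega), mul_zero]
  simp_rw [h1]
  exact hasSum_ite_eq n _

lemma HasExpansion.integral_mul_exp_eq_zero {v : ℂ → ℂ} {c : ℕ → ℂ} (hc : HasExpansion v c)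
    {s : ℝ} (hs : s < 0) {n : ℕ} (hn : 1 ≤ n) :
    ∫ θ in (0 : ℝ)..(2 * Real.pi),
      v (logPolar s θ) * Complex.exp ((n : ℂ) * θ * Complex.I) = 0 := by
  refine (hc.hasSum_integral hs (ψ := fun θ => Complex.exp ((n : ℂ) * θ * Complex.I))
    (by fun_prop)).unique ?_
  have h1 : ∀ m : ℕ, c m * Real.exp (m * s) * ∫ θ in (0 : ℝ)..(2 * Real.pi),
      Complex.exp (((m : ℤ) : ℂ) * θ * Complex.I) * Complex.exp ((n : ℂ) * θ * Complex.I) = 0 := by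
    intro m
    have h2 : ∀ θ : ℝ, Complex.exp (((m : ℤ) : ℂ) * θ * Complex.I) *
        Complex.exp ((n : ℂ) * θ * Complex.I) =
        Complex.exp ((((m : ℤ) + n : ℤ) : ℂ) * θ * Complex.I) := fun θ => by
      rw [← Complex.exp_add]; congr 1; push_cast; ring
    simp_rw [h2]
    rw [integral_exp_int_mul, if_neg (by omega), mul_zero]
  simp_rw [h1]
  exact hasSum_zero

lemma intervalIntegral_conj (v : ℝ → ℂ) {a b : ℝ} (hab : a ≤ b) :
    ∫ θ in a..b, conj (v θ) = conj (∫ θ in a..b, v θ) := by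
  rw [intervalIntegral.integral_of_le hab, intervalIntegral.integral_of_le hab, integral_conj]

/-- Parseval's formula on circles. -/
lemma HasExpansion.hasSum_norm_sq {v : ℂ → ℂ} {c : ℕ → ℂ} (hc : HasExpansion v c)
    (hv : ContinuousOn v unitDisk) {s : ℝ} (hs : s < 0) :
    HasSum (fun m : ℕ => 2 * Real.pi * (‖c m‖ ^ 2 * Real.exp (2 * m * s)))
      (∫ θ in (0 : ℝ)..(2 * Real.pi), ‖v (logPolar s θ)‖ ^ 2) := by
  have hvc : Continuous fun θ => v (logPolar s θ) :=
    continuous_circle (hv.mono sdiff_subset) hs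
  have h1 := hc.hasSum_integral hs (ψ := fun θ => conj (v (logPolar s θ)))
    (Complex.continuous_conj.comp hvc)
  rw [← Complex.hasSum_ofReal]
  have h2 : ((∫ θ in (0 : ℝ)..(2 * Real.pi), ‖v (logPolar s θ)‖ ^ 2 : ℝ) : ℂ) =
      ∫ θ in (0 : ℝ)..(2 * Real.pi), v (logPolar s θ) * conj (v (logPolar s θ)) := by
    rw [← intervalIntegral.integral_ofReal]
    refine intervalIntegral.integral_congr fun θ _ => ?_
    simp only [Complex.mul_conj']
    push_cast; rfl
  rw [h2]
  refine h1.congr_fun ?_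
  intro m
  have h3 : ∫ θ in (0 : ℝ)..(2 * Real.pi), Complex.exp (((m : ℤ) : ℂ) * θ * Complex.I) *
      conj (v (logPolar s θ)) = conj (2 * Real.pi * (c m * Real.exp (m * s))) := by
    rw [← hc.integral_mul_exp hs m, ← intervalIntegral_conj _ (by positivity)]
    refine intervalIntegral.integral_congr fun θ _ => ?_
    simp only [map_mul, ← Complex.exp_conj, map_neg, Complex.conj_ofReal, Complex.conj_I,
      map_natCast]
    rw [mul_comm]
    congr 2
    push_cast; ring
  rw [h3]
  have h4 : c m * conj (c m) = ((‖c m‖ ^ 2 : ℝ) : ℂ) := by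
    rw [Complex.mul_conj']; push_cast; rfl
  have h5 : Real.exp (2 * m * s) = Real.exp (m * s) * Real.exp (m * s) := by
    rw [← Real.exp_add]; congr 1; ring
  simp only [map_mul, Complex.conj_ofReal, h5]
  push_cast at h4 ⊢
  simp only [map_ofNat]
  linear_combination (-2 * Real.pi * Complex.exp (m * s) * Complex.exp (m * s)) * h4

/-! ### Bieberbach's bound of the second coefficient -/

/-- A nonvanishing analytic function `u` with `u(0) = 1` has an analytic logarithm. -/
lemma exists_log {u : ℂ → ℂ} (hu : DifferentiableOn ℂ u unitDisk)
    (hne : ∀ z ∈ unitDisk, u z ≠ 0) (h1 : u 0 = 1) :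
    ∃ l : ℂ → ℂ, (∀ z ∈ unitDisk, HasDerivAt l (deriv u z / u z) z) ∧
      (∀ z ∈ unitDisk, u z = Complex.exp (l z)) ∧ l 0 = 0 := by
  have hop := isOpen_unitDisk
  obtain ⟨l₀, hl₀⟩ := DifferentiableOn.isExactOn_ball ((hu.deriv hop).div hu hne)
  have hl : ∀ z ∈ unitDisk, HasDerivAt (fun z => l₀ z - l₀ 0) (deriv u z / u z) z :=
    fun z hz => (hl₀ z hz).sub_const _
  refine ⟨fun z => l₀ z - l₀ 0, hl, fun z hz => ?_, sub_self _⟩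
  have hconst : ∀ z ∈ unitDisk,
      HasDerivAt (fun z => u z * Complex.exp (-(l₀ z - l₀ 0))) 0 z := by
    intro z hz
    have h2 := ((hu.differentiableAt (hop.mem_nhds hz)).hasDerivAt.mul
      ((Complex.hasDerivAt_exp _).comp z (hl z hz).neg))
    refine h2.congr_deriv ?_
    have := hne z hz
    simp only [Function.comp]
    field_simp
    ring
  have h3 := (convex_ball (0 : ℂ) 1).norm_image_sub_le_of_norm_hasDerivWithin_le (C := 0)
    (fun z hz => (hconst z hz).hasDerivWithinAt) (fun z _ => by simp) zero_mem_unitDisk hz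
  rw [zero_mul, norm_le_zero_iff, sub_eq_zero] at h3
  simp only [h1, sub_self, neg_zero, Complex.exp_zero, mul_one] at h3
  rw [Complex.exp_neg] at h3
  field_simp at h3
  exact h3

lemma powLap_zero_right {q : ℝ} {h : ℂ → ℂ} {z : ℂ} (hz : h z ≠ 0) :
    powLap q 0 h (fun _ => 0) z = 4 * q ^ 2 *
      ((‖h z + conj ((fun _ => (0 : ℂ)) z)‖ ^ 2 + 0) ^ (q - 1) *
        (‖euler h z‖ ^ 2 - ‖euler (fun _ => 0) z‖ ^ 2)) := by
  have hE : euler (fun _ => (0 : ℂ)) z = 0 := by simp [euler]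
  have hpos : 0 < ‖h z‖ ^ 2 := by positivity
  have hX : ∀ x y : ℂ, inner ℝ x y ^ 2 + inner ℝ x (Complex.I * y) ^ 2 = ‖x‖ ^ 2 * ‖y‖ ^ 2 := by
    intro x y
    simp only [Complex.inner, Complex.mul_re, Complex.mul_im, Complex.conj_re, Complex.conj_im,
      Complex.I_re, Complex.I_im, Complex.sq_norm, Complex.normSq_apply]
    ring
  have hp : (‖h z‖ ^ 2) ^ (q - 1) = (‖h z‖ ^ 2) ^ (q - 2) * ‖h z‖ ^ 2 := by
    rw [← Real.rpow_add_one hpos.ne']; congr 1; ring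
  simp only [powLap, hE, map_zero, add_zero, sub_zero, hX, norm_zero, hp]
  ring

section Bieberbach

variable {h : ℂ → ℂ} (hh : DifferentiableOn ℂ h unitDisk) (hinj : InjOn h unitDisk)
  (h0 : h 0 = 0) (h1 : deriv h 0 = 1)

include hinj h0 in
lemma ne_zero_of_injOn {z : ℂ} (hz : z ∈ unitDisk) (hz0 : z ≠ 0) : h z ≠ 0 := fun hc =>
  hz0 (hinj hz zero_mem_unitDisk (hc.trans h0.symm))

include hh hinj h0

/-- Green's formula together with the area estimate for the region outside the disk of radius
`a`. -/
lemma powMeanD_sub_le_of_injOn {α : ℝ} (hα : 0 < α) {s₁ s₂ a : ℝ} (hs : s₁ ≤ s₂)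
    (hs₂ : s₂ < 0) (ha : 0 < a) (hle : ∀ s ∈ Ioo s₁ s₂, ∀ θ, a ≤ ‖h (logPolar s θ)‖) :
    powMeanD (-α) 0 h (fun _ => 0) s₂ - powMeanD (-α) 0 h (fun _ => 0) s₁ ≤
      4 * Real.pi * α * (a ^ 2) ^ (-α) := by
  have hg : DifferentiableOn ℂ (fun _ : ℂ => (0 : ℂ)) unitDisk := differentiableOn_const _
  have hpos : ∀ z ∈ unitDisk, z ≠ 0 → 0 < ‖h z + conj ((fun _ => (0 : ℂ)) z)‖ ^ 2 + 0 := by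
    intro z hz hz0
    have := ne_zero_of_injOn hinj h0 hz hz0
    simp only [map_zero, add_zero]
    positivity
  obtain ⟨b₀, hb₀⟩ := (isCompact_closedBall (0 : ℂ) (Real.exp s₂)).exists_bound_of_continuousOn
    (hh.continuousOn.mono (Metric.closedBall_subset_ball (by simpa using hs₂)))
  have hb : ∀ s ∈ Ioo s₁ s₂, ∀ θ, ‖h (logPolar s θ)‖ ≤ max a b₀ := by
    intro s hs' θ
    refine (hb₀ _ ?_).trans (le_max_right _ _)
    rw [Metric.mem_closedBall, dist_zero_right, norm_logPolar]
    exact Real.exp_le_exp.2 hs'.2.le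
  have hJ := integral_jacobian_le (q := -α) (a := a) (b := max a b₀) hh hg hpos (by simp)
    (by simpa using hinj) hs hs₂ (by linarith [hα] : -α < 0).ne ha.le (le_max_left _ _)
    (by positivity) (fun s hs' θ => by simpa using ⟨hle s hs' θ, hb s hs' θ⟩)
  have hL : ∫ s in s₁..s₂, ∫ θ in (0 : ℝ)..(2 * Real.pi),
      powLap (-α) 0 h (fun _ => 0) (logPolar s θ) = 4 * (-α) ^ 2 *
      ∫ s in s₁..s₂, ∫ θ in (0 : ℝ)..(2 * Real.pi),
        (‖h (logPolar s θ) + conj ((fun _ => (0 : ℂ)) (logPolar s θ))‖ ^ 2 + 0) ^ (-α - 1) *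
        (‖euler h (logPolar s θ)‖ ^ 2 - ‖euler (fun _ => 0) (logPolar s θ)‖ ^ 2) := by
    rw [← intervalIntegral.integral_const_mul]
    refine intervalIntegral.integral_congr fun s hs' => ?_
    rw [uIcc_of_le hs] at hs'
    simp only
    rw [← intervalIntegral.integral_const_mul]
    refine intervalIntegral.integral_congr fun θ _ => ?_
    exact powLap_zero_right (ne_zero_of_injOn hinj h0 (logPolar_mem (hs'.2.trans_lt hs₂) θ)
      (logPolar_ne_zero _ _))
  rw [powMeanD_sub hh hg hpos hs hs₂, hL]
  refine (mul_le_mul_of_nonneg_left hJ (by positivity)).trans ?_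
  have hb0 : 0 ≤ ((max a b₀) ^ 2 + 0) ^ (-α) := by positivity
  have e : 4 * (-α) ^ 2 * (Real.pi / -α * ((max a b₀ ^ 2 + 0) ^ (-α) - (a ^ 2 + 0) ^ (-α))) =
      4 * Real.pi * α * ((a ^ 2) ^ (-α) - (max a b₀ ^ 2 + 0) ^ (-α)) := by
    rw [add_zero (a ^ 2)]
    field_simp
    ring
  rw [e]
  exact mul_le_mul_of_nonneg_left (by linarith) (by positivity)

include h1

/-- For `0 < α < 1/2` the means of `|h|^{-2α}` decrease: by Green's formula and the area estimate
their derivative at `s₂` is bounded by an expression in `ρ = e^{s₁}` of size `O(ρ^{1 - 2α})`, and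
`ρ` may tend to `0`. -/
lemma powMeanD_nonpos {α : ℝ} (hα : 0 < α) (hα2 : α < 1 / 2) {s : ℝ} (hs : s < 0) :
    powMeanD (-α) 0 h (fun _ => 0) s ≤ 0 := by
  have hop := isOpen_unitDisk
  have hn0 := hop.mem_nhds zero_mem_unitDisk
  set u : ℂ → ℂ := dslope h 0 with hu
  have hud : DifferentiableOn ℂ u unitDisk := (Complex.differentiableOn_dslope hn0).2 hh
  have hu0 : u 0 = 1 := by rw [hu, dslope_same, h1]
  have hzu : ∀ z, h z = z * u z := fun z => by
    have := sub_smul_dslope h 0 z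
    rw [h0, sub_zero, sub_zero, smul_eq_mul] at this
    exact this.symm
  -- Both `u` and the density `B` of the mean equal `1 + O(|z|)` at the origin.
  set B : ℂ → ℝ := fun z => (‖u z‖ ^ 2) ^ (-α - 1) * inner ℝ (u z) (deriv h z) with hB
  have hdu : DifferentiableAt ℝ u 0 := (hud.differentiableAt hn0).restrictScalars ℝ
  have hdh' : DifferentiableAt ℝ (deriv h) 0 :=
    ((hh.deriv hop).differentiableAt hn0).restrictScalars ℝ
  have hBd : DifferentiableAt ℝ B 0 := by
    refine DifferentiableAt.mul ((hdu.norm_sq ℝ).rpow_const (Or.inl ?_)) (hdu.inner ℝ hdh')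
    rw [hu0]; norm_num
  have hB0 : B 0 = 1 := by
    simp only [hB, hu0, h1]
    simp
  obtain ⟨C₁, hC₁⟩ := hdu.hasFDerivAt.isBigO_sub.bound
  obtain ⟨C₂, hC₂⟩ := hBd.hasFDerivAt.isBigO_sub.bound
  rw [hu0] at hC₁
  rw [hB0] at hC₂
  obtain ⟨r, hr0, hr⟩ := Metric.eventually_nhds_iff.1 (hC₁.and hC₂)
  simp only [dist_zero_right, sub_zero] at hr
  set C : ℝ := max (max C₁ C₂) 1 with hC
  have hC1 : 1 ≤ C := le_max_right _ _
  have hbd : ∀ z : ℂ, ‖z‖ < r → ‖u z - 1‖ ≤ C * ‖z‖ ∧ ‖B z - 1‖ ≤ C * ‖z‖ := by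
    intro z hz
    refine ⟨(hr hz).1.trans ?_, (hr hz).2.trans ?_⟩ <;> gcongr
    · exact (le_max_left _ _).trans (le_max_left _ _)
    · exact (le_max_right _ _).trans (le_max_left _ _)
  set r₀ : ℝ := min (r / 2) (1 / (2 * C)) with hr₀
  have hr₀0 : 0 < r₀ := lt_min (by positivity) (by positivity)
  have hr₀r : r₀ < r := (min_le_left _ _).trans_lt (by linarith)
  have hr₀C : C * r₀ ≤ 1 / 2 := by
    have := mul_le_mul_of_nonneg_left (min_le_right (r / 2) (1 / (2 * C))) (by positivity : 0 ≤ C)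
    rw [← hr₀] at this
    refine this.trans_eq ?_
    field_simp
  -- Away from the origin, `|h|` is bounded below.
  obtain ⟨c₀, hc₀0, hc₀⟩ : ∃ c₀ : ℝ, 0 < c₀ ∧
      ∀ z : ℂ, r₀ ≤ ‖z‖ → ‖z‖ ≤ Real.exp s → c₀ ≤ ‖h z‖ := by
    have hsub : closedAnnulus r₀ (Real.exp s) ⊆ unitDisk := fun z hz => by
      rw [mem_unitDisk]
      exact hz.2.trans_lt (by simpa using hs)
    obtain ⟨c₀, h2, h3⟩ := (isCompact_closedAnnulus r₀ (Real.exp s)).exists_forall_le'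
      (f := fun z => ‖h z‖) (a := 0) (hh.continuousOn.mono hsub).norm fun z hz => by
        have hz0 : z ≠ 0 := norm_pos_iff.1 (hr₀0.trans_le hz.1)
        exact norm_pos_iff.2 (ne_zero_of_injOn hinj h0 (hsub hz) hz0)
    exact ⟨c₀, h2, fun z hz1 hz2 => h3 z ⟨hz1, hz2⟩⟩
  have hmain : ∀ᶠ ρ : ℝ in 𝓝[>] 0, powMeanD (-α) 0 h (fun _ => 0) s ≤
      12 * Real.pi * α * C * ρ ^ (1 - 2 * α) := by
    have hev : Ioo (0 : ℝ) (min (min r₀ c₀) (Real.exp s)) ∈ 𝓝[>] (0 : ℝ) :=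
      Ioo_mem_nhdsGT (lt_min (lt_min hr₀0 hc₀0) (Real.exp_pos s))
    filter_upwards [hev] with ρ hρ
    have hρ0 : 0 < ρ := hρ.1
    have hρr : ρ < r₀ := hρ.2.trans_le ((min_le_left _ _).trans (min_le_left _ _))
    have hρc : ρ < c₀ := hρ.2.trans_le ((min_le_left _ _).trans (min_le_right _ _))
    have hρs : ρ < Real.exp s := hρ.2.trans_le (min_le_right _ _)
    have hCρ : C * ρ ≤ 1 / 2 := (mul_le_mul_of_nonneg_left hρr.le (by positivity)).trans hr₀C
    have hCρ0 : 0 < C * ρ := by positivity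
    set s₁ := Real.log ρ with hs₁
    have hes₁ : Real.exp s₁ = ρ := Real.exp_log hρ0
    have hs₁s : s₁ ≤ s := by rw [← Real.exp_le_exp, hes₁]; exact hρs.le
    have hs₁0 : s₁ < 0 := hs₁s.trans_lt hs
    have ha : 0 < ρ * (1 - C * ρ) := mul_pos hρ0 (by linarith)
    have hlow : ∀ t ∈ Ioo s₁ s, ∀ θ, ρ * (1 - C * ρ) ≤ ‖h (logPolar t θ)‖ := by
      intro t ht θ
      have hzn := norm_logPolar t θ
      set z := logPolar t θ with hz
      have hρz : ρ ≤ ‖z‖ := by rw [hzn, ← hes₁]; exact Real.exp_le_exp.2 ht.1.le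
      rcases lt_or_ge ‖z‖ r₀ with hlt | hge
      · have h2 := (hbd z (hlt.trans hr₀r)).1
        have h3 : 1 - C * ‖z‖ ≤ ‖u z‖ := by
          have := norm_sub_norm_le (1 : ℂ) (u z)
          rw [norm_one, norm_sub_rev] at this
          linarith
        have h4 : C * ‖z‖ ≤ 1 / 2 :=
          (mul_le_mul_of_nonneg_left hlt.le (by positivity)).trans hr₀C
        rw [hzu, norm_mul]
        calc ρ * (1 - C * ρ) ≤ ‖z‖ * (1 - C * ‖z‖) := by
              have : 0 ≤ (‖z‖ - ρ) * (1 - C * ‖z‖ - C * ρ) :=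
                mul_nonneg (by linarith) (by linarith)
              linarith
          _ ≤ _ := by gcongr
      · have h2 := hc₀ z hge (by rw [hzn]; exact Real.exp_le_exp.2 ht.2.le)
        have : ρ * (1 - C * ρ) ≤ ρ * 1 := by gcongr; linarith
        linarith
    have hsub := powMeanD_sub_le_of_injOn hh hinj h0 hα hs₁s hs ha hlow
    have hstart : powMeanD (-α) 0 h (fun _ => 0) s₁ ≤
        2 * Real.pi * (-(2 * α) * (ρ ^ 2) ^ (-α) * (1 - C * ρ)) := by
      have hpos : ∀ z ∈ unitDisk, z ≠ 0 → 0 < ‖h z + conj ((fun _ => (0 : ℂ)) z)‖ ^ 2 + 0 := by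
        intro z hz hz0
        have := ne_zero_of_injOn hinj h0 hz hz0
        simp only [map_zero, add_zero]
        positivity
      refine integral_circle_le (fun θ => ?_) (continuous_circle
        (continuousOn_radialD hh (differentiableOn_const _) hpos) hs₁0)
      have hzn := norm_logPolar s₁ θ
      rw [hes₁] at hzn
      set z := logPolar s₁ θ with hz
      have h2 := (hbd z (by rw [hzn]; linarith)).2
      rw [hzn, Real.norm_eq_abs] at h2
      have h3 : 1 - C * ρ ≤ B z := by linarith [neg_le_of_abs_le h2]
      have hinner : inner ℝ (z * u z) (z * deriv h z) = ρ ^ 2 * inner ℝ (u z) (deriv h z) := by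
        rw [← hzn]
        simp only [Complex.inner, Complex.mul_re, Complex.mul_im, Complex.conj_re,
          Complex.conj_im, Complex.sq_norm, Complex.normSq_apply]
        ring
      have hrad : radialD (-α) 0 h (fun _ => 0) z = -(2 * α) * (ρ ^ 2) ^ (-α) * B z := by
        simp only [radialD, powD, euler, deriv_const', mul_zero, map_zero, add_zero]
        rw [hzu z, hinner, norm_mul, mul_pow, hzn, Real.mul_rpow (by positivity) (by positivity),
          Real.rpow_sub_one (by positivity) (-α)]
        simp only [hB]
        field_simp
      rw [hrad]
      have h4 : 0 ≤ 2 * α * (ρ ^ 2) ^ (-α) := by positivity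
      have := mul_le_mul_of_nonneg_left h3 h4
      linarith
    have hb1 : (0 : ℝ) < 1 - C * ρ := by linarith
    have hpowle : ((1 - C * ρ) ^ 2) ^ (-α) ≤ 1 + 2 * (C * ρ) := by
      have e1 : ((1 - C * ρ) ^ 2) ^ (-α) = (1 - C * ρ) ^ (-(2 * α)) := by
        rw [← Real.rpow_natCast, ← Real.rpow_mul hb1.le]; congr 1; push_cast; ring
      have e2 : (1 - C * ρ) ^ (-(2 * α)) ≤ (1 - C * ρ) ^ (-1 : ℝ) :=
        Real.rpow_le_rpow_of_exponent_ge hb1 (by linarith) (by linarith)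
      rw [e1]
      refine e2.trans ?_
      rw [Real.rpow_neg_one, inv_le_iff_one_le_mul₀ hb1]
      nlinarith
    have hfac : ((ρ * (1 - C * ρ)) ^ 2) ^ (-α) = (ρ ^ 2) ^ (-α) * ((1 - C * ρ) ^ 2) ^ (-α) := by
      rw [mul_pow, Real.mul_rpow (by positivity) (by positivity)]
    have hρpow : ρ ^ (1 - 2 * α) = (ρ ^ 2) ^ (-α) * ρ := by
      rw [← Real.rpow_natCast, ← Real.rpow_mul hρ0.le, ← Real.rpow_add_one hρ0.ne']
      congr 1; push_cast; ring
    rw [hfac] at hsub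
    rw [hρpow]
    set X := (ρ ^ 2) ^ (-α) with hX
    have hX0 : 0 < X := Real.rpow_pos_of_pos (by positivity) _
    have h5 : 4 * Real.pi * α * (X * ((1 - C * ρ) ^ 2) ^ (-α)) ≤
        4 * Real.pi * α * (X * (1 + 2 * (C * ρ))) := by gcongr
    linarith
  have hlim : Tendsto (fun ρ : ℝ => 12 * Real.pi * α * C * ρ ^ (1 - 2 * α)) (𝓝[>] 0) (𝓝 0) := by
    have h2 : Tendsto (fun ρ : ℝ => ρ ^ (1 - 2 * α)) (𝓝 0) (𝓝 (0 ^ (1 - 2 * α))) :=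
      (Real.continuousAt_rpow_const 0 (1 - 2 * α) (Or.inr (by linarith))).tendsto
    rw [Real.zero_rpow (by linarith)] at h2
    simpa using (h2.mono_left nhdsWithin_le_nhds).const_mul (12 * Real.pi * α * C)
  exact ge_of_tendsto hlim hmain

/-- The first two terms of Parseval's formula for the means of `|h|^{-2α}` decrease, because the
means do and all the other terms increase. -/
lemma mul_norm_sq_le_of_lt_half {α : ℝ} (hα : 0 < α) (hα2 : α < 1 / 2) :
    α * (1 - α) * (‖deriv (deriv h) 0‖ / 2) ^ 2 ≤ 1 := by
  have hop := isOpen_unitDisk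
  have hn0 := hop.mem_nhds zero_mem_unitDisk
  set u : ℂ → ℂ := dslope h 0 with hu
  have hud : DifferentiableOn ℂ u unitDisk := (Complex.differentiableOn_dslope hn0).2 hh
  have hu0 : u 0 = 1 := by rw [hu, dslope_same, h1]
  have hzu : ∀ z, h z = z * u z := fun z => by
    have := sub_smul_dslope h 0 z
    rw [h0, sub_zero, sub_zero, smul_eq_mul] at this
    exact this.symm
  have hune : ∀ z ∈ unitDisk, u z ≠ 0 := by
    intro z hz hc
    rcases eq_or_ne z 0 with rfl | hz0
    · rw [hu0] at hc; exact one_ne_zero hc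
    · exact ne_zero_of_injOn hinj h0 hz hz0 (by rw [hzu, hc, mul_zero])
  have hdu : ∀ z ∈ unitDisk, HasDerivAt u (deriv u z) z := fun z hz =>
    (hud.differentiableAt (hop.mem_nhds hz)).hasDerivAt
  -- The second coefficient of `h` is the first one of `h(z) / z`.
  have hu' : deriv (deriv h) 0 = 2 * deriv u 0 := by
    have h2 : ∀ z ∈ unitDisk, deriv h z = u z + z * deriv u z := by
      intro z hz
      have h3 := ((hasDerivAt_id z).mul (hdu z hz))
      have h4 : h = fun z => id z * u z := funext hzu
      have h5 := h3.deriv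
      rw [show deriv h z = deriv (id * u) z by rw [h4]; rfl, h5]
      simp
    have h6 : HasDerivAt (fun z => u z + z * deriv u z) (2 * deriv u 0) 0 := by
      have h7 := (hdu 0 zero_mem_unitDisk).add ((hasDerivAt_id (0 : ℂ)).mul
        ((hud.deriv hop).differentiableAt hn0).hasDerivAt)
      refine h7.congr_deriv ?_
      simp; ring
    refine (h6.congr_of_eventuallyEq ?_).deriv
    filter_upwards [hn0] with w hw using h2 w hw
  obtain ⟨l, hl, hul, hl0⟩ := exists_log hud hune hu0
  set v : ℂ → ℂ := fun z => Complex.exp (-(α : ℂ) * l z) with hv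
  have hvd : ∀ z ∈ unitDisk, HasDerivAt v (v z * (-(α : ℂ) * (deriv u z / u z))) z := fun z hz =>
    (Complex.hasDerivAt_exp _).comp z ((hl z hz).const_mul _)
  have hvD : DifferentiableOn ℂ v unitDisk := fun z hz =>
    (hvd z hz).differentiableAt.differentiableWithinAt
  have hvn : ∀ z ∈ unitDisk, ‖v z‖ ^ 2 = (‖u z‖ ^ 2) ^ (-α) := by
    intro z hz
    rw [hul z hz, hv]
    simp only [Complex.norm_exp]
    rw [← Real.exp_nat_mul, ← Real.exp_nat_mul, ← Real.exp_mul]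
    congr 1
    simp
    ring
  obtain ⟨d, hd, hd0, hd1⟩ := exists_hasExpansion hvD
  have hv0 : v 0 = 1 := by simp [hv, hl0]
  rw [hv0] at hd0
  rw [(hvd 0 zero_mem_unitDisk).deriv, hv0, hu0, one_mul, div_one] at hd1
  -- Parseval's formula for the means.
  have hI : ∀ s < 0, HasSum
      (fun m : ℕ => 2 * Real.pi * (‖d m‖ ^ 2 * Real.exp ((2 * m - 2 * α) * s)))
      (powMean (-α) 0 h (fun _ => 0) s) := by
    intro s hs
    have h2 := (hd.hasSum_norm_sq hvD.continuousOn hs).mul_left (Real.exp (-(2 * α) * s))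
    have h3 : Real.exp (-(2 * α) * s) * ∫ θ in (0 : ℝ)..(2 * Real.pi), ‖v (logPolar s θ)‖ ^ 2 =
        powMean (-α) 0 h (fun _ => 0) s := by
      rw [powMean, ← intervalIntegral.integral_const_mul]
      refine intervalIntegral.integral_congr fun θ _ => ?_
      have hz := logPolar_mem hs θ
      simp only [map_zero, add_zero]
      rw [hvn _ hz, hzu, norm_mul, mul_pow, Real.mul_rpow (by positivity) (by positivity),
        norm_logPolar, ← Real.exp_nat_mul, ← Real.exp_mul]
      congr 2
      push_cast; ring
    rw [h3] at h2
    refine h2.congr_fun ?_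
    intro m
    have : Real.exp ((2 * m - 2 * α) * s) = Real.exp (-(2 * α) * s) * Real.exp (2 * m * s) := by
      rw [← Real.exp_add]; congr 1; ring
    rw [this]; ring
  have hpos : ∀ z ∈ unitDisk, z ≠ 0 → 0 < ‖h z + conj ((fun _ => (0 : ℂ)) z)‖ ^ 2 + 0 := by
    intro z hz hz0
    have := ne_zero_of_injOn hinj h0 hz hz0
    simp only [map_zero, add_zero]
    positivity
  have hIanti : ∀ s t : ℝ, s ≤ t → t < 0 →
      powMean (-α) 0 h (fun _ => 0) t ≤ powMean (-α) 0 h (fun _ => 0) s := by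
    intro s t hst ht
    have h2 := powMean_sub (q := -α) hh (differentiableOn_const (0 : ℂ)) hpos hst ht
    have h3 : ∫ x in s..t, powMeanD (-α) 0 h (fun _ => 0) x ≤ 0 := by
      have h4 : 0 ≤ ∫ x in s..t, -powMeanD (-α) 0 h (fun _ => 0) x := by
        refine intervalIntegral.integral_nonneg hst fun x hx => ?_
        have := powMeanD_nonpos hh hinj h0 h1 hα hα2 (hx.2.trans_lt ht)
        linarith
      rw [intervalIntegral.integral_neg] at h4
      linarith
    linarith
  set D : ℝ := ‖d 1‖ ^ 2 with hD
  have hψ : AntitoneOn (fun s : ℝ => Real.exp (-(2 * α) * s) + D * Real.exp ((2 - 2 * α) * s))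
      (Iio 0) := by
    intro s hs t ht hst
    have hs' := (hasSum_nat_add_iff' 2).2 (hI s hs)
    have ht' := (hasSum_nat_add_iff' 2).2 (hI t ht)
    have hle := hasSum_le (fun m : ℕ => ?_) hs' ht'
    · have hmono := hIanti s t hst ht
      simp only [Finset.sum_range_succ, Finset.sum_range_zero, hd0, norm_one, Nat.cast_zero,
        Nat.cast_one, ← hD] at hle
      have h2 : 2 * Real.pi *
          ((Real.exp (-(2 * α) * t) + D * Real.exp ((2 - 2 * α) * t)) -
          (Real.exp (-(2 * α) * s) + D * Real.exp ((2 - 2 * α) * s))) ≤ 0 := by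
        ring_nf at hle hmono ⊢
        linarith
      have h3 := nonpos_of_mul_nonpos_right h2 (by positivity)
      simp only
      linarith
    · have : (2 * ((m + 2 : ℕ) : ℝ) - 2 * α) * s ≤ (2 * ((m + 2 : ℕ) : ℝ) - 2 * α) * t := by
        refine mul_le_mul_of_nonneg_left hst ?_
        push_cast
        have : (0 : ℝ) ≤ m := Nat.cast_nonneg m
        linarith
      have := Real.exp_le_exp.2 this
      gcongr
  have hder : ∀ s < 0, D * (1 - α) * Real.exp (2 * s) ≤ α := by
    intro s hs
    have h2 : HasDerivAt (fun s : ℝ => Real.exp (-(2 * α) * s) + D * Real.exp ((2 - 2 * α) * s))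
        (Real.exp (-(2 * α) * s) * (-(2 * α)) +
          D * (Real.exp ((2 - 2 * α) * s) * (2 - 2 * α))) s := by
      refine HasDerivAt.add ?_ (HasDerivAt.const_mul D ?_)
      · simpa using ((hasDerivAt_id s).const_mul (-(2 * α))).exp
      · simpa using ((hasDerivAt_id s).const_mul (2 - 2 * α)).exp
    have h3 := hψ.derivWithin_nonpos (x := s)
    rw [derivWithin_of_isOpen isOpen_Iio hs, h2.deriv] at h3
    have h4 : Real.exp ((2 - 2 * α) * s) = Real.exp (-(2 * α) * s) * Real.exp (2 * s) := by
      rw [← Real.exp_add]; congr 1; ring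
    rw [h4] at h3
    have h5 : Real.exp (-(2 * α) * s) * (D * (1 - α) * Real.exp (2 * s) - α) ≤ 0 := by linarith
    have := nonpos_of_mul_nonpos_right h5 (Real.exp_pos _)
    linarith
  have hlim : D * (1 - α) ≤ α := by
    have h2 : Tendsto (fun s : ℝ => D * (1 - α) * Real.exp (2 * s)) (𝓝[<] 0)
        (𝓝 (D * (1 - α) * Real.exp (2 * 0))) :=
      ((by fun_prop : Continuous fun s : ℝ => D * (1 - α) * Real.exp (2 * s)).tendsto 0).mono_left
        nhdsWithin_le_nhds
    rw [mul_zero, Real.exp_zero, mul_one] at h2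
    exact le_of_tendsto h2 (eventually_mem_nhdsWithin.mono fun s hs => hder s hs)
  have hD' : D = α ^ 2 * (‖deriv (deriv h) 0‖ / 2) ^ 2 := by
    rw [hD, hd1, hu', norm_mul, norm_mul, norm_neg, Complex.norm_real,
      Real.norm_of_nonneg hα.le, Complex.norm_ofNat]
    ring
  rw [hD'] at hlim
  have : α * (α * (1 - α) * (‖deriv (deriv h) 0‖ / 2) ^ 2) ≤ α * 1 := by linarith
  exact le_of_mul_le_mul_left this hα

/-- Bieberbach's inequality for the second coefficient of a univalent function. -/
theorem norm_deriv_deriv_zero_le_four : ‖deriv (deriv h) 0‖ ≤ 4 := by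
  set x := (‖deriv (deriv h) 0‖ / 2) ^ 2 with hx
  have h2 : Tendsto (fun α : ℝ => α * (1 - α) * x) (𝓝[<] (1 / 2))
      (𝓝 (1 / 2 * (1 - 1 / 2) * x)) :=
    ((by fun_prop : Continuous fun α : ℝ => α * (1 - α) * x).tendsto _).mono_left
      nhdsWithin_le_nhds
  have h3 : 1 / 2 * (1 - 1 / 2) * x ≤ 1 := by
    refine le_of_tendsto h2 ?_
    filter_upwards [Ioo_mem_nhdsLT (show (0 : ℝ) < 1 / 2 by norm_num)] with α hα
    exact mul_norm_sq_le_of_lt_half hh hinj h0 h1 hα.1 hα.2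
  have h4 : (‖deriv (deriv h) 0‖ / 2) ^ 2 ≤ 2 ^ 2 := by rw [← hx]; linarith
  have := le_of_sq_le_sq h4 (by norm_num)
  linarith

end Bieberbach

/-! ### The coefficients -/

lemma HasNormalizedExpansion.hasExpansion {h : ℂ → ℂ} {a : ℕ → ℂ}
    (ha : HasNormalizedExpansion h a) :
    HasExpansion h (fun m => if m = 0 then 0 else if m = 1 then 1 else a m) := by
  intro z hz
  refine (hasSum_nat_add_iff' 2).1 ?_
  have := ha z hz
  simpa [Finset.sum_range_succ] using this

/-- Cauchy's estimate for the coefficients of `h` in terms of the means of `f = h + \bar g`. -/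
lemma norm_coeff_mul_pow_le {f h g : ℂ → ℂ} {a : ℕ → ℂ}
    (hd : IsNormalizedDecomposition f h g) (ha : HasNormalizedExpansion h a)
    {r : ℝ} (hr0 : 0 < r) (hr1 : r < 1) {n : ℕ} (hn : 2 ≤ n) :
    ‖a n‖ * r ^ n ≤ integralMean 1 f r := by
  have hs : Real.log r < 0 := Real.log_neg hr0 hr1
  set s := Real.log r with hsdef
  obtain ⟨c, hc, -, -⟩ := exists_hasExpansion hd.analytic_g
  have hcont : ∀ v : ℂ → ℂ, ContinuousOn v unitDisk → Continuous fun θ => v (logPolar s θ) :=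
    fun v hv => continuous_circle (hv.mono sdiff_subset) hs
  have hhc := hcont h hd.analytic_h.continuousOn
  have hgc := hcont g hd.analytic_g.continuousOn
  -- The anti-analytic part does not contribute to a Fourier coefficient of positive index.
  have h1 : ∫ θ in (0 : ℝ)..(2 * Real.pi),
      f (logPolar s θ) * Complex.exp (-((n : ℂ) * θ * Complex.I)) =
      2 * Real.pi * (a n * Real.exp (n * s)) := by
    have e : ∀ θ : ℝ, f (logPolar s θ) * Complex.exp (-((n : ℂ) * θ * Complex.I)) =
        h (logPolar s θ) * Complex.exp (-((n : ℂ) * θ * Complex.I)) +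
        conj (g (logPolar s θ) * Complex.exp ((n : ℂ) * θ * Complex.I)) := by
      intro θ
      rw [hd.eq_add_conj _ (logPolar_mem hs θ), add_mul, map_mul, ← Complex.exp_conj]
      simp only [map_mul, Complex.conj_ofReal, Complex.conj_I, map_natCast, mul_neg]
    simp_rw [e]
    rw [intervalIntegral.integral_add, intervalIntegral_conj _ (by positivity),
      ha.hasExpansion.integral_mul_exp hs, hc.integral_mul_exp_eq_zero hs (by omega), map_zero,
      add_zero, if_neg (by omega), if_neg (by omega)]
    · exact (hhc.mul (by fun_prop)).intervalIntegrable _ _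
    · exact (Complex.continuous_conj.comp (hgc.mul (by fun_prop))).intervalIntegrable _ _
  have h2 := intervalIntegral.norm_integral_le_integral_norm (μ := volume)
    (f := fun θ : ℝ => f (logPolar s θ) * Complex.exp (-((n : ℂ) * θ * Complex.I)))
    (by positivity : (0 : ℝ) ≤ 2 * Real.pi)
  have h3 : ∀ θ : ℝ, ‖f (logPolar s θ) * Complex.exp (-((n : ℂ) * θ * Complex.I))‖ =
      ‖f (r * Complex.exp (θ * Complex.I))‖ := by
    intro θ
    have : -((n : ℂ) * θ * Complex.I) = ((-(n * θ) : ℝ) : ℂ) * Complex.I := by push_cast; ring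
    rw [norm_mul, this, Complex.norm_exp_ofReal_mul_I, mul_one, logPolar_log hr0]
  rw [h1] at h2
  simp only [h3, norm_mul, Complex.norm_ofNat, Complex.norm_real, Real.norm_eq_abs,
    abs_of_pos Real.pi_pos, Real.abs_exp] at h2
  have h4 : Real.exp (n * s) = r ^ n := by rw [Real.exp_nat_mul, hsdef, Real.exp_log hr0]
  rw [h4] at h2
  rw [integralMean]
  simp only [Real.rpow_one, div_one]
  rw [one_div, ← div_eq_inv_mul, le_div_iff₀ (by positivity)]
  linarith

/-- Cauchy's estimate on the circle of radius `1 - 1/n`. -/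
lemma exists_norm_coeff_le {K : ℝ} (hK : 1 ≤ K) :
    ∃ C : ℝ, ∀ (f h g : ℂ → ℂ) (a : ℕ → ℂ), f ∈ SHK K → IsNormalizedDecomposition f h g →
      HasNormalizedExpansion h a → ∀ n : ℕ, 2 ≤ n → ‖a n‖ ≤ C * (n : ℝ) ^ (gammaStar K - 1) := by
  have hγ := two_le_gammaStar hK
  obtain ⟨C, hC0, hC⟩ := exists_integralMean_le hK one_pos (by linarith)
  refine ⟨C * Real.exp 2, fun f h g a hf hd ha n hn => ?_⟩
  have hn2 : (2 : ℝ) ≤ n := by exact_mod_cast hn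
  have hn0 : (0 : ℝ) < n := by linarith
  set r : ℝ := 1 - 1 / n with hr
  have hinv : 1 / (n : ℝ) ≤ 1 / 2 := one_div_le_one_div_of_le (by norm_num) hn2
  have hinv0 : 0 < 1 / (n : ℝ) := by positivity
  have hr2 : 1 / 2 ≤ r := by rw [hr]; linarith
  have hr0 : 0 < r := by linarith
  have hr1 : r < 1 := by rw [hr]; linarith
  have h1 := (norm_coeff_mul_pow_le hd ha hr0 hr1 hn).trans (hC f hf r ⟨hr2, hr1⟩)
  have h2 : (1 - r) ^ (-(gammaStar K - 1 / 1)) = (n : ℝ) ^ (gammaStar K - 1) := by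
    rw [hr, sub_sub_cancel, one_div, Real.inv_rpow hn0.le, ← Real.rpow_neg hn0.le]
    norm_num
  rw [h2] at h1
  -- `r⁻¹ ≤ e^{2/n}`, since `1 / (1 - x) ≤ e^{2x}` for `x ≤ 1/2`.
  have h3 : 1 ≤ Real.exp 2 * r ^ n := by
    have h4 : 1 ≤ Real.exp (2 / n) * r := by
      have h5 := Real.add_one_le_exp (2 / (n : ℝ))
      have h6 : 2 / (n : ℝ) = 2 * (1 / n) := by ring
      rw [h6] at h5 ⊢
      have h7 : 1 ≤ (2 * (1 / (n : ℝ)) + 1) * r := by rw [hr]; nlinarith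
      exact h7.trans (by gcongr)
    calc (1 : ℝ) ≤ (Real.exp (2 / n) * r) ^ n := one_le_pow₀ h4
      _ = _ := by
        rw [mul_pow, ← Real.exp_nat_mul]
        congr 2
        field_simp
  calc ‖a n‖ = ‖a n‖ * 1 := (mul_one _).symm
    _ ≤ ‖a n‖ * (Real.exp 2 * r ^ n) := by gcongr
    _ = Real.exp 2 * (‖a n‖ * r ^ n) := by ring
    _ ≤ Real.exp 2 * (C * (n : ℝ) ^ (gammaStar K - 1)) := by gcongr
    _ = _ := by ring

lemma gammaStar_one_le : gammaStar 1 ≤ 2 := by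
  refine csSup_le ⟨_, mem_secondCoeffs (koebe_mem_SHK le_rfl) koebe_decomposition⟩ ?_
  rintro _ ⟨f, hf, rfl⟩
  obtain ⟨h, g, hd⟩ := hf.1.1
  have hq := QCPair.of_mem_SHK le_rfl hf hd
  have hg0 : ∀ z ∈ unitDisk, g z = 0 := by
    intro z hz
    have h1 := (convex_ball (0 : ℂ) 1).norm_image_sub_le_of_norm_deriv_le (C := 0) (f := g)
      (fun w hw => hd.analytic_g.differentiableAt (isOpen_unitDisk.mem_nhds hw))
      (fun w hw => by simpa [dilBound] using hq.deriv_le w hw) zero_mem_unitDisk hz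
    simpa [hd.g_zero] using h1
  have hinj : InjOn h unitDisk := hq.inj.congr fun z hz => by simp [hg0 z hz]
  have h2 := norm_deriv_deriv_zero_le_four hd.analytic_h hinj hd.h_zero hd.deriv_h_zero
  simp only [hd.dz_dz_zero]
  linarith

lemma koebe_expansion : HasNormalizedExpansion koebe (fun n => n) := by
  intro z hz
  have h1 := hasSum_coe_mul_geometric_of_norm_lt_one (mem_unitDisk.1 hz)
  have h2 := (hasSum_nat_add_iff' 2).2 h1
  simpa [Finset.sum_range_succ, koebe] using h2

lemma not_natCast_le_rpow {β : ℝ} (hβ : β < 1) :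
    ¬ ∃ C : ℝ, ∀ n : ℕ, 2 ≤ n → ‖((n : ℕ) : ℂ)‖ ≤ C * (n : ℝ) ^ β := by
  rintro ⟨C, hC⟩
  have h1 : Tendsto (fun n : ℕ => (n : ℝ) ^ (1 - β)) atTop atTop :=
    (tendsto_rpow_atTop (by linarith)).comp tendsto_natCast_atTop_atTop
  obtain ⟨n, hn2, hn⟩ := ((eventually_ge_atTop 2).and (h1.eventually_gt_atTop C)).exists
  have hn0 : (0 : ℝ) < n := by exact_mod_cast (by omega : 0 < n)
  have h2 := hC n hn2
  rw [Complex.norm_natCast] at h2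
  have h3 : (n : ℝ) = (n : ℝ) ^ (1 - β) * (n : ℝ) ^ β := by
    rw [← Real.rpow_add hn0, sub_add_cancel, Real.rpow_one]
  have h4 : C * (n : ℝ) ^ β < (n : ℝ) ^ (1 - β) * (n : ℝ) ^ β :=
    mul_lt_mul_of_pos_right hn (Real.rpow_pos_of_pos hn0 _)
  linarith

end HarmonicQR


theorem mainTheorem1 (K : ℝ) (hK : 1 ≤ K) :
    -- the supremum defining `γ*` is that of a nonempty set and is finite
    ((HarmonicQR.secondCoeffs K).Nonempty ∧ BddAbove (HarmonicQR.secondCoeffs K)) ∧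
    -- growth of the integral means
    (∀ f ∈ HarmonicQR.SHK K, ∀ p : ℝ, 1 / HarmonicQR.gammaStar K < p →
      (fun r : ℝ => HarmonicQR.integralMean p f r) =O[𝓝[<] (1 : ℝ)]
        (fun r : ℝ => 1 / (1 - r) ^ (HarmonicQR.gammaStar K - 1 / p))) ∧
    -- growth of the coefficients
    (∃ C : ℝ, ∀ (f h g : ℂ → ℂ) (a : ℕ → ℂ), f ∈ HarmonicQR.SHK K →
      HarmonicQR.IsNormalizedDecomposition f h g → HarmonicQR.HasNormalizedExpansion h a →
        ∀ n : ℕ, 2 ≤ n → ‖a n‖ ≤ C * (n : ℝ) ^ (HarmonicQR.gammaStar K - 1)) ∧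
    -- sharpness of the exponent for `K = 1`
    (K = 1 → ∃ (f h g : ℂ → ℂ) (a : ℕ → ℂ), f ∈ HarmonicQR.SHK K ∧
      HarmonicQR.IsNormalizedDecomposition f h g ∧ HarmonicQR.HasNormalizedExpansion h a ∧
        ∀ β : ℝ, β < HarmonicQR.gammaStar K - 1 →
          ¬ ∃ C : ℝ, ∀ n : ℕ, 2 ≤ n → ‖a n‖ ≤ C * (n : ℝ) ^ β) := by
  have hγ := HarmonicQR.two_le_gammaStar hK
  have hγ0 : 0 < HarmonicQR.gammaStar K := by linarith
  refine ⟨⟨⟨_, HarmonicQR.mem_secondCoeffs (HarmonicQR.koebe_mem_SHK hK)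
    HarmonicQR.koebe_decomposition⟩, HarmonicQR.bddAbove_secondCoeffs hK⟩, fun f hf p hp => ?_,
    HarmonicQR.exists_norm_coeff_le hK, ?_⟩
  · have hp0 : 0 < p := lt_trans (by positivity) hp
    have hγp : 1 < HarmonicQR.gammaStar K * p := by
      rw [div_lt_iff₀ hγ0] at hp; linarith
    obtain ⟨C, hC0, hC⟩ := HarmonicQR.exists_integralMean_le hK hp0 hγp
    refine Asymptotics.IsBigO.of_bound C ?_
    filter_upwards [Ioo_mem_nhdsLT (show (1 / 2 : ℝ) < 1 by norm_num)] with r hr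
    have h1r : 0 < 1 - r := by linarith [hr.2]
    have hM0 : 0 ≤ HarmonicQR.integralMean p f r := by
      refine Real.rpow_nonneg (mul_nonneg (by positivity) ?_) _
      exact intervalIntegral.integral_nonneg (by positivity) fun θ _ => by positivity
    rw [Real.norm_of_nonneg hM0, Real.norm_of_nonneg (by positivity), one_div ((1 - r) ^ _),
      ← Real.rpow_neg h1r.le]
    exact hC f hf r ⟨hr.1.le, hr.2⟩
  · rintro rfl
    refine ⟨_, _, _, _, HarmonicQR.koebe_mem_SHK le_rfl, HarmonicQR.koebe_decomposition,
      HarmonicQR.koebe_expansion, fun β hβ => HarmonicQR.not_natCast_le_rpow ?_⟩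
    have := HarmonicQR.gammaStar_one_le
    linarith
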